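/- Let $T$ be a normal Aronszajn tree (an $\omega_1$-tree, i.e. a tree of height $\omega_1$ with countable levels, without cofinal branches; normal: it has a root, is Hausdorff, and every element has incomparable elements and uncountably many elements above it). Let $\mathcal S \subseteq \omega\setminus 2$ be non-empty such that every $x\in T$ satisfies $|\mathrm{Imm}_T(x)| \ge \sup(\mathcal S)$, where $\mathrm{Imm}_T(x)$ is the set of immediate successors of $x$. Write $T_\beta$ for level $\beta$ of $T$, and for tuples write $\vec a\le\vec b$ coordinatewise and $\mathcal Y\restriction\alpha$ for the set of tuples of elements of $T_\alpha$ that lie coordinatewise below some member of $\mathcal Y$. An *$\mathcal S$-splitting subtree function with top level $\beta<\omega_1$* is a function $F : T\restriction(\beta+1)\to 2$ such that $F(\mathrm{root})=1$; if $F(a)=1$ then $F(b)=1$ for all $b<_T a$; if $x$ has height $<\beta$ and $F(x)=1$, then $F(y)=1$ for some $y\in T_\beta$ above $x$; and if $x$ has height $<\beta$ and $F(x)=1$, then $|\{y\in \mathrm{Imm}_T(x): F(y)=1\}|\in\mathcal S$. A *generalized promise on $T$ with dimension $m$ ($0<m<\omega$) and base level $\gamma<\omega_1$* is a function $\mathcal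 U$ with domain $[\gamma,\omega_1)$ for which there are distinct $x_0,\dots,x_{m-1}\in T$ of the same height such that for all $\gamma\le\beta<\omega_1$: (1) $\mathcal U(\beta)$ is a non-empty countable set whose members are countably infinite sets of tuples $\vec a\in T_\beta^m$ with $\vec x\le\vec a$; (2) for every $\mathcal Y\in\mathcal U(\beta)$ and every finite $t\subseteq T_\beta$, some tuple in $\mathcal Y$ has no entry in $t$; (3) if $\gamma\le\alpha<\beta$ and $\mathcal Y\in\mathcal U(\beta)$, then $\mathcal Y\restriction\alpha\in\mathcal U(\alpha)$. A subtree function $F$ with top level $\beta\ge\gamma$ *fulfills* $\mathcal U$ if for every finite $t\subseteq T_\beta$ and every $\mathcal Y\in\mathcal U(\beta)$ there is a tuple in $\mathcal Y$ with no entry in $t$, all of whose entries have $F$-value $1$. Let $\mathbb P=\mathbb P(T,\mathcal S)$ be the forcing poset of all pairs $(F,\Gamma)$ where $F$ is an $\mathcal S$-splitting subtree function and $\Gamma$ is a countable set of generalized promises on $T$ whose base levels are at most the top level of $F$, all of which are fulfilled by $F$; $(G,\Sigma)\le(F,\Gamma)$ iff $F\subseteq G$ and $\Gamma\subseteq\Sigma$.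 The top level of $(F,\Gamma)$ is that of $F$. Then: 1. For every regular cardinal $\lambda$, every countable $N\prec H(\lambda)$ with $T,\mathbb P\in N$, and every $p\in N\cap\mathbb P$, there is $q\le p$ with top level $N\cap\omega_1$ which is a total master condition for $N$: for every dense open $D\subseteq\mathbb P$ with $D\in N$ there is $v\in D\cap N$ with $q\le v$. 2. $\mathbb P$ is totally proper, i.e. it is proper and does not add reals. (Proper: for all sufficiently large regular $\lambda$ there is a parameter $a\in H(\lambda)$ such that for every countable $N\prec H(\lambda)$ with $a,\mathbb P\in N$, every $p\in N\cap\mathbb P$ has an extension $q\le p$ that is $(N,\mathbb P)$-generic, i.e. $D\cap N$ is predense below $q$ for every dense $D\subseteq\mathbb P$ in $N$.) 3. If $\mathsf{CH}$ holds, then $\mathbb P$ is $\omega_2$-c.c., i.e. every antichain of $\mathbb P$ has size less than $\aleph_2$. -/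

import Mathlib

universe u v

open scoped Cardinal Ordinal

namespace SubtreeForcing

/-! ## Trees of height `ω₁` -/

section Trees

variable {T : Type u} [PartialOrder T] [WellFoundedLT T]

/-- The height of `x`: the order type of the set of its strict predecessors, computed as the rank of
`x` in the well-founded relation `<`. -/
noncomputable def ht (x : T) : Ordinal.{u} := IsWellFounded.rank (α := T) (· < ·) x

/-- The immediate successors of `x`. -/
def Imm (x : T) : Set T := {y | x ⋖ y}

variable (T)

/-- `T` is an `ω₁`-tree: predecessors of a point are linearly ordered (and well-ordered, since `<` is
well-founded), the height of the tree is `ω₁`, and the levels are countable. -/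
structure IsOmega1Tree : Prop where
  chain : ∀ x : T, IsChain (· ≤ ·) (Set.Iio x)
  ht_lt : ∀ x : T, ht x < ω₁
  level_nonempty : ∀ α : Ordinal.{u}, α < ω₁ → ∃ x : T, ht x = α
  level_countable : ∀ α : Ordinal.{u}, α < ω₁ → {x : T | ht x = α}.Countable

/-- An Aronszajn tree: an `ω₁`-tree without uncountable chains (equivalently, without cofinal
branches). -/
structure IsAronszajn : Prop extends IsOmega1Tree T where
  chain_countable : ∀ b : Set T, IsChain (· ≤ ·) b → b.Countable

/-- Normality: there is a root, the tree is Hausdorff, every point has incomparable points above it,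
and every point has uncountably many points above it. -/
structure IsNormal : Prop where
  root : ∃ r : T, IsBot r
  hausdorff : ∀ x y : T, Order.IsSuccLimit (ht x) → ht x = ht y → Set.Iio x = Set.Iio y → x = y
  incomparable : ∀ x : T, ∃ y z : T, x < y ∧ x < z ∧ ¬ y ≤ z ∧ ¬ z ≤ y
  uncountable : ∀ x : T, ¬ (Set.Ioi x).Countable

variable {T}

/-- The product of the cones above the entries of `x`: tuples which lie coordinatewise above `x` and
whose entries all have the same height. -/
def derivedTree {m : ℕ} (x : Fin m → T) : Set (Fin m → T) :=
  {a | (∀ i, x i ≤ a i) ∧ ∀ i j, ht (a i) = ht (a j)}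

/-- The restriction of a set of `m`-tuples to level `α`: all tuples of height `α` lying
coordinatewise below some member of the set. -/
def restrict {m : ℕ} (Y : Set (Fin m → T)) (α : Ordinal.{u}) : Set (Fin m → T) :=
  {a | (∀ i, ht (a i) = α) ∧ ∃ b ∈ Y, ∀ i, a i ≤ b i}

end Trees

/-! ## Generalized promises, subtree functions and the forcing poset -/

section Forcing

variable (T : Type u) [PartialOrder T] [WellFoundedLT T]

/-- A generalized promise of dimension `dim` and base level `base`: a function with domain
`[base, ω₁)`. It is represented by a function on all ordinals with value `∅` off the domain; values
on the domain are non-empty. -/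
structure GenPromise where
  dim : ℕ
  dim_pos : 0 < dim
  base : Ordinal.{u}
  base_lt : base < ω₁
  val : Ordinal.{u} → Set (Set (Fin dim → T))
  val_eq_empty : ∀ β, β ∉ Set.Ico base ω₁ → val β = ∅
  /-- For some derived tree of dimension `dim`, the members of `val β` are countably infinite sets of
  tuples of height `β` from that derived tree. -/
  exists_derived : ∃ x : Fin dim → T, Function.Injective x ∧ (∀ i j, ht (x i) = ht (x j)) ∧
    ∀ β ∈ Set.Ico base ω₁, ∀ Y ∈ val β, Y.Infinite ∧ Y.Countable ∧
      ∀ a ∈ Y, a ∈ derivedTree x ∧ ∀ i, ht (a i) = β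
  nonempty : ∀ β ∈ Set.Ico base ω₁, (val β).Nonempty
  countable : ∀ β ∈ Set.Ico base ω₁, (val β).Countable
  well_distributed : ∀ β ∈ Set.Ico base ω₁, ∀ Y ∈ val β, ∀ t : Finset T, (∀ y ∈ t, ht y = β) →
    ∃ a ∈ Y, ∀ i, a i ∉ t
  restrict_mem : ∀ α β, base ≤ α → α < β → β < ω₁ → ∀ Y ∈ val β, restrict Y α ∈ val α

/-- A subtree function with top level `top`, that is a function from the points of height `≤ top`
to `{0, 1}`. It is represented by the set `one` of points where the value is `1`. -/
structure SubtreeFun where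
  top : Ordinal.{u}
  top_lt : top < ω₁
  one : Set T
  ht_le : ∀ x ∈ one, ht x ≤ top
  root_mem : ∀ r : T, IsBot r → r ∈ one
  down : ∀ x y, x ≤ y → y ∈ one → x ∈ one
  exists_top : ∀ x ∈ one, ht x < top → ∃ y ∈ one, x ≤ y ∧ ht y = top

variable {T}

/-- `F` fulfills the generalized promise `U` (used when `U.base ≤ F.top`). -/
def SubtreeFun.Fulfills (F : SubtreeFun T) (U : GenPromise T) : Prop :=
  ∀ t : Finset T, (∀ y ∈ t, ht y = F.top) → ∀ Y ∈ U.val F.top,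
    ∃ a ∈ Y, ∀ i, a i ∉ t ∧ a i ∈ F.one

/-- `F` is `S`-splitting: below the top level, each point with value `1` has exactly `n` immediate
successors with value `1`, for some `n ∈ S`. -/
def SubtreeFun.IsSplitting (F : SubtreeFun T) (S : Set ℕ) : Prop :=
  ∀ x ∈ F.one, ht x < F.top → ∃ n ∈ S, (Imm x ∩ F.one).encard = (n : ℕ∞)

/-- `G` extends `F` as a function. -/
def SubtreeFun.Extends (G F : SubtreeFun T) : Prop :=
  F.top ≤ G.top ∧ ∀ x : T, ht x ≤ F.top → (x ∈ F.one ↔ x ∈ G.one)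

variable (T)

/-- The conditions of the forcing poset `ℙ(T, S)`. -/
structure Condition (S : Set ℕ) where
  F : SubtreeFun T
  splitting : F.IsSplitting S
  Γ : Set (GenPromise T)
  countable : Γ.Countable
  base_le : ∀ U ∈ Γ, U.base ≤ F.top
  fulfills : ∀ U ∈ Γ, F.Fulfills U

variable {T}

/-- `(G, Σ) ≤ (F, Γ)` iff `F ⊆ G` and `Γ ⊆ Σ`. -/
instance (S : Set ℕ) : Preorder (Condition T S) where
  le q p := q.F.Extends p.F ∧ p.Γ ⊆ q.Γ
  le_refl p := ⟨⟨le_rfl, fun _ _ => Iff.rfl⟩, subset_rfl⟩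
  le_trans r q p hrq hqp := ⟨⟨hqp.1.1.trans hrq.1.1, fun x hx =>
    (hqp.1.2 x hx).trans (hrq.1.2 x (hx.trans hqp.1.1))⟩, hqp.2.trans hrq.2⟩

instance : Small.{u} (GenPromise T) := by
  let f : GenPromise T → Σ (d : ℕ) (_ : Set.Iio (ω₁ : Ordinal.{u})),
      (Set.Iio (ω₁ : Ordinal.{u}) → Set (Set (Fin d → T))) :=
    fun U => ⟨U.dim, ⟨U.base, U.base_lt⟩, fun β => U.val β⟩
  refine small_of_injective (f := f) ?_
  intro U V h
  obtain ⟨d, _, b, _, val, he, _, _, _, _, _⟩ := U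
  obtain ⟨d', _, b', _, val', he', _, _, _, _, _⟩ := V
  simp only [f, Sigma.mk.injEq] at h
  obtain ⟨rfl, h⟩ := h
  simp only [heq_eq_eq, Sigma.mk.injEq] at h
  obtain ⟨hb, h⟩ := h
  obtain rfl : b = b' := congrArg Subtype.val hb
  have : val = val' := by
    funext β
    by_cases hβ : β ∈ Set.Ico b ω₁
    · exact congrFun h ⟨β, hβ.2⟩
    · rw [he β hβ, he' β hβ]
  subst this
  rfl

instance (S : Set ℕ) : Small.{u} (Condition T S) := by
  let f : Condition T S → Set.Iio (ω₁ : Ordinal.{u}) × Set T × (GenPromise T → Prop) :=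
    fun p => (⟨p.F.top, p.F.top_lt⟩, p.F.one, p.Γ)
  refine small_of_injective (f := f) ?_
  rintro ⟨⟨t, _, o, _, _, _, _⟩, _, G, _, _, _⟩ ⟨⟨t', _, o', _, _, _, _⟩, _, G', _, _, _⟩ h
  obtain rfl : t = t' := congrArg (fun z => z.1.1) h
  obtain rfl : o = o' := congrArg (fun z => z.2.1) h
  obtain rfl : G = G' := congrArg (fun z => z.2.2) h
  rfl

end Forcing

/-! ## Realization of the objects as sets

A tree on a type `T` is realized as a set along an injection `e : T ↪ ZFSet`; ordinals are realized as
von Neumann ordinals, functions as sets of Kuratowski pairs. -/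

section Codes

/-- A preordered type, realized along `e` as the pair (underlying set, order relation `≤`). -/
noncomputable def posetCode {Q : Type v} [Preorder Q] [Small.{u} Q] (e : Q → ZFSet.{u}) : ZFSet.{u} :=
  ZFSet.pair (ZFSet.range e)
    (ZFSet.range fun r : {r : Q × Q // r.1 ≤ r.2} => ZFSet.pair (e r.1.1) (e r.1.2))

/-- A subset `D` of a type, realized along `e`. -/
noncomputable def setCode {Q : Type v} [Small.{u} Q] (e : Q → ZFSet.{u}) (D : Set Q) : ZFSet.{u} :=
  ZFSet.range fun d : D => e d

variable {T : Type u}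

/-- The tree `(T, <)`, realized along `e`. -/
noncomputable def treeCode [PartialOrder T] (e : T → ZFSet.{u}) : ZFSet.{u} :=
  ZFSet.pair (ZFSet.range e)
    (ZFSet.range fun r : {r : T × T // r.1 < r.2} => ZFSet.pair (e r.1.1) (e r.1.2))

/-- An `m`-tuple as a function with domain `m = {0, …, m - 1}`. -/
noncomputable def tupleCode (e : T → ZFSet.{u}) {m : ℕ} (a : Fin m → T) : ZFSet.{u} :=
  ZFSet.range fun i : Fin m => ZFSet.pair (Ordinal.toZFSet ((i : ℕ) : Ordinal.{u})) (e (a i))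

theorem tupleCode_inj (e : T ↪ ZFSet.{u}) {m n : ℕ} {a : Fin m → T} {b : Fin n → T}
    (h : tupleCode e a = tupleCode e b) : ∃ hd : m = n, a = b ∘ Fin.cast hd := by
  have key : ∀ {m n : ℕ} {a : Fin m → T} {b : Fin n → T}, tupleCode e a = tupleCode e b →
      ∀ i : Fin m, ∃ j : Fin n, (j : ℕ) = i ∧ b j = a i := by
    intro m n a b h i
    have hi : ZFSet.pair (Ordinal.toZFSet ((i : ℕ) : Ordinal.{u})) (e (a i)) ∈ tupleCode e b := by
      rw [← h]; exact ZFSet.mem_range.2 ⟨i, rfl⟩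
    obtain ⟨j, hj⟩ := ZFSet.mem_range.1 hi
    obtain ⟨h1, h2⟩ := ZFSet.pair_inj.1 hj
    exact ⟨j, by exact_mod_cast Ordinal.toZFSet_injective h1, e.injective h2⟩
  have hd : m = n := by
    apply le_antisymm
    · by_contra hlt
      obtain ⟨j, hj, -⟩ := key h ⟨n, by omega⟩
      have := j.2
      simp at hj
      omega
    · by_contra hlt
      obtain ⟨j, hj, -⟩ := key h.symm ⟨m, by omega⟩
      have := j.2
      simp at hj
      omega
  refine ⟨hd, ?_⟩
  subst hd
  funext i
  obtain ⟨j, hj, hb⟩ := key h i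
  obtain rfl : j = i := Fin.ext hj
  exact hb.symm

variable [PartialOrder T] [WellFoundedLT T]

/-- A generalized promise as a function with domain `[base, ω₁)`. -/
noncomputable def GenPromise.code (e : T → ZFSet.{u}) (U : GenPromise T) : ZFSet.{u} :=
  ZFSet.range fun β : Set.Ico U.base (ω₁ : Ordinal.{u}) =>
    ZFSet.pair (Ordinal.toZFSet β)
      (ZFSet.range fun Y : U.val β => setCode (tupleCode e) Y.1)

open Classical in
/-- A subtree function as a function from the set of points of height `≤ top` to `2 = {0, 1}`. -/
noncomputable def SubtreeFun.code (e : T → ZFSet.{u}) (F : SubtreeFun T) : ZFSet.{u} :=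
  ZFSet.range fun x : {x : T // ht x ≤ F.top} =>
    ZFSet.pair (e x) (Ordinal.toZFSet (if x.1 ∈ F.one then 1 else 0))

/-- A condition as the pair `(F, Γ)`. -/
noncomputable def Condition.code (e : T → ZFSet.{u}) {S : Set ℕ} (p : Condition T S) : ZFSet.{u} :=
  ZFSet.pair (p.F.code e) (setCode (GenPromise.code e) p.Γ)

theorem setCode_inj {Q : Type v} [Small.{u} Q] {e : Q → ZFSet.{u}} (he : Function.Injective e)
    {D E : Set Q} (h : setCode e D = setCode e E) : D = E := by
  have key : ∀ {D E : Set Q}, setCode e D = setCode e E → D ⊆ E := by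
    intro D E h x hx
    have : e x ∈ setCode e E := by rw [← h]; exact ZFSet.mem_range.2 ⟨⟨x, hx⟩, rfl⟩
    obtain ⟨⟨y, hy⟩, hxy⟩ := ZFSet.mem_range.1 this
    rwa [← he hxy]
  exact (key h).antisymm (key h.symm)

theorem GenPromise.code_injective (e : T ↪ ZFSet.{u}) :
    Function.Injective (GenPromise.code (T := T) e) := by
  have key : ∀ {U V : GenPromise T}, U.code e = V.code e → ∀ β ∈ Set.Ico U.base ω₁,
      β ∈ Set.Ico V.base ω₁ ∧
      (∀ Y ∈ U.val β, ∃ Z ∈ V.val β, setCode (tupleCode e) Y = setCode (tupleCode e) Z) ∧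
      (∀ Z ∈ V.val β, ∃ Y ∈ U.val β, setCode (tupleCode e) Y = setCode (tupleCode e) Z) := by
    intro U V h β hβ
    have : ZFSet.pair (Ordinal.toZFSet β)
        (ZFSet.range fun Y : U.val β => setCode (tupleCode e) Y.1) ∈ V.code e := by
      rw [← h]; exact ZFSet.mem_range.2 ⟨⟨β, hβ⟩, rfl⟩
    obtain ⟨⟨γ, hγ⟩, hp⟩ := ZFSet.mem_range.1 this
    obtain ⟨h1, h2⟩ := ZFSet.pair_inj.1 hp
    obtain rfl : γ = β := Ordinal.toZFSet_injective h1
    refine ⟨hγ, fun Y hY => ?_, fun Z hZ => ?_⟩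
    · have : setCode (tupleCode e) Y ∈
          ZFSet.range fun Y : V.val γ => setCode (tupleCode e) Y.1 := by
        rw [h2]; exact ZFSet.mem_range.2 ⟨⟨Y, hY⟩, rfl⟩
      obtain ⟨⟨Z, hZ⟩, h3⟩ := ZFSet.mem_range.1 this
      exact ⟨Z, hZ, h3.symm⟩
    · have : setCode (tupleCode e) Z ∈
          ZFSet.range fun Y : U.val γ => setCode (tupleCode e) Y.1 := by
        rw [← h2]; exact ZFSet.mem_range.2 ⟨⟨Z, hZ⟩, rfl⟩
      obtain ⟨⟨Y, hY⟩, h3⟩ := ZFSet.mem_range.1 this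
      exact ⟨Y, hY, h3⟩
  intro U V h
  have hbU : U.base ∈ Set.Ico U.base (ω₁ : Ordinal.{u}) := ⟨le_rfl, U.base_lt⟩
  have hb : U.base = V.base := le_antisymm
    (key h.symm V.base ⟨le_rfl, V.base_lt⟩).1.1 (key h U.base hbU).1.1
  have hd : U.dim = V.dim := by
    obtain ⟨Y, hY⟩ := U.nonempty _ hbU
    obtain ⟨a, ha, -⟩ := U.well_distributed _ hbU Y hY ∅ (by simp)
    obtain ⟨Z, -, hYZ⟩ := (key h _ hbU).2.1 Y hY
    have : tupleCode e a ∈ setCode (tupleCode e) Z := by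
      rw [← hYZ]; exact ZFSet.mem_range.2 ⟨⟨a, ha⟩, rfl⟩
    obtain ⟨b, hb⟩ := ZFSet.mem_range.1 this
    exact (tupleCode_inj e hb).1.symm
  obtain ⟨d, dp, b, bl, val, h1, h2, h3, h4, h5, h6⟩ := U
  obtain ⟨d', dp', b', bl', val', h1', h2', h3', h4', h5', h6'⟩ := V
  dsimp only at hd hb
  subst hd hb
  have hinj : Function.Injective (tupleCode e (m := d)) := by
    intro a b hab
    obtain ⟨-, rfl⟩ := tupleCode_inj e hab
    rfl
  have hv : val = val' := by
    funext β
    by_cases hβ : β ∈ Set.Ico b ω₁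
    · obtain ⟨-, k1, k2⟩ := key h β hβ
      ext Y
      constructor
      · intro hY
        obtain ⟨Z, hZ, hYZ⟩ := k1 Y hY
        obtain rfl := setCode_inj hinj hYZ
        exact hZ
      · intro hY
        obtain ⟨Z, hZ, hYZ⟩ := k2 Y hY
        obtain rfl := setCode_inj hinj hYZ
        exact hZ
    · rw [h1 β hβ, h1' β hβ]
  subst hv
  rfl

theorem SubtreeFun.code_injective (hT : IsOmega1Tree T) (e : T ↪ ZFSet.{u}) :
    Function.Injective (SubtreeFun.code (T := T) e) := by
  have key : ∀ {F G : SubtreeFun T}, F.code e = G.code e → F.top ≤ G.top ∧ F.one ⊆ G.one := by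
    intro F G h
    have mem : ∀ x : T, ht x ≤ F.top → ht x ≤ G.top ∧ (x ∈ F.one → x ∈ G.one) := by
      intro x hx
      classical
      have : ZFSet.pair (e x) (Ordinal.toZFSet (if x ∈ F.one then 1 else 0)) ∈ G.code e := by
        rw [← h]; exact ZFSet.mem_range.2 ⟨⟨x, hx⟩, by congr⟩
      obtain ⟨⟨y, hy⟩, hp⟩ := ZFSet.mem_range.1 this
      obtain ⟨h1, h2⟩ := ZFSet.pair_inj.1 hp
      obtain rfl : y = x := e.injective h1
      refine ⟨hy, fun hF => ?_⟩
      have h3 := Ordinal.toZFSet_injective h2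
      by_contra hG
      simp [hF, hG] at h3
    obtain ⟨x, hx⟩ := hT.level_nonempty F.top F.top_lt
    exact ⟨hx ▸ (mem x hx.le).1, fun x hx => (mem x (F.ht_le x hx)).2 hx⟩
  intro F G h
  have h1 := le_antisymm (key h).1 (key h.symm).1
  have h2 := (key h).2.antisymm (key h.symm).2
  obtain ⟨t, _, o, _, _, _, _⟩ := F
  obtain ⟨t', _, o', _, _, _, _⟩ := G
  dsimp only at h1 h2
  subst h1 h2
  rfl

/-- The realization of the conditions as sets is injective, so `ℙ(T, S)` is isomorphic to a forcing
poset whose conditions are sets. -/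
noncomputable def Condition.codeEmb (hT : IsOmega1Tree T) (e : T ↪ ZFSet.{u}) (S : Set ℕ) :
    Condition T S ↪ ZFSet.{u} where
  toFun := Condition.code e
  inj' := by
    intro p q h
    obtain ⟨h1, h2⟩ := ZFSet.pair_inj.1 h
    have h3 := SubtreeFun.code_injective hT e h1
    have h4 := setCode_inj (GenPromise.code_injective e) h2
    obtain ⟨F, _, G, _, _, _⟩ := p
    obtain ⟨F', _, G', _, _, _⟩ := q
    dsimp only at h3 h4
    subst h3 h4
    rfl

end Codes

/-! ## Elementary submodels of `H(κ)` -/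

section Models

/-- The only symbol of the language of set theory is the binary relation symbol for membership. -/
inductive MemRel : ℕ → Type
  | mem : MemRel 2

/-- The first-order language of set theory. -/
def setLanguage : FirstOrder.Language := ⟨fun _ => Empty, MemRel⟩

/-- `x` is hereditarily of cardinality less than `κ`: its transitive closure has fewer than `κ`
elements. -/
def HeredCardLT (κ : Cardinal.{u}) (x : ZFSet.{u}) : Prop :=
  #{y : ZFSet.{u} // Relation.TransGen (· ∈ ·) y x} < Cardinal.lift.{u + 1} κ

/-- The structure `H(κ)` of all sets which are hereditarily of cardinality less than `κ`. -/
def H (κ : Cardinal.{u}) : Type (u + 1) := {x : ZFSet.{u} // HeredCardLT κ x}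

instance (κ : Cardinal.{u}) : setLanguage.Structure (H κ) where
  funMap := fun f => Empty.elim f
  RelMap := fun {_} r => match r with
    | MemRel.mem => fun v => (v 0).1 ∈ (v 1).1

/-- An elementary substructure of `H(κ)`. -/
abbrev Submodel (κ : Cardinal.{u}) := setLanguage.ElementarySubstructure (H κ)

/-- The set `x` is an element of `N`. -/
def Submodel.Has {κ : Cardinal.{u}} (N : Submodel κ) (x : ZFSet.{u}) : Prop :=
  ∃ h : HeredCardLT κ x, (⟨x, h⟩ : H κ) ∈ N

/-- `N ∩ ω₁`, as a set of ordinals. -/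
def Submodel.omega1 {κ : Cardinal.{u}} (N : Submodel κ) : Set Ordinal.{u} :=
  {α | α < ω₁ ∧ N.Has (Ordinal.toZFSet α)}

end Models

/-! ## Properness, no new reals, chain condition

Stronger conditions are smaller. -/

section Posets

variable {Q : Type v} [Preorder Q]

def Compatible (p q : Q) : Prop := ∃ r, r ≤ p ∧ r ≤ q

def IsDense (D : Set Q) : Prop := ∀ p, ∃ q ∈ D, q ≤ p

section Master

variable [Small.{u} Q] {κ : Cardinal.{u}}

/-- `q` is a total master condition for `N`: for every dense open set `D` in `N`, some condition in
`D ∩ N` is above `q`. (Open sets are the downwards closed ones.) -/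
def IsTotalMaster (e : Q ↪ ZFSet.{u}) (N : Submodel κ) (q : Q) : Prop :=
  ∀ D : Set Q, IsDense D → IsLowerSet D → N.Has (setCode e D) → ∃ w ∈ D, N.Has (e w) ∧ q ≤ w

/-- `q` is `(N, Q)`-generic: for every dense set `D` in `N`, the set `D ∩ N` is predense
below `q`. -/
def IsGenericCondition (e : Q ↪ ZFSet.{u}) (N : Submodel κ) (q : Q) : Prop :=
  ∀ D : Set Q, IsDense D → N.Has (setCode e D) →
    ∀ r ≤ q, ∃ w ∈ D, N.Has (e w) ∧ Compatible r w

/-- Properness of the forcing poset `Q`, realized as a set along `e`: for all sufficiently large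
regular `κ` there is a parameter `a ∈ H(κ)` such that for all countable `N ≺ H(κ)` containing `a` and
the poset, each condition in `N` has an `(N, Q)`-generic extension. -/
def IsProper (e : Q ↪ ZFSet.{u}) : Prop :=
  ∃ μ : Cardinal.{u}, ∀ κ : Cardinal.{u}, μ ≤ κ → κ.IsRegular →
    ∃ a : ZFSet.{u}, HeredCardLT κ a ∧
      ∀ N : Submodel κ, (N : Set (H κ)).Countable → N.Has a → N.Has (posetCode e) →
        ∀ p, N.Has (e p) → ∃ q ≤ p, IsGenericCondition e N q

end Master

/-- `Q`-names: small sets of pairs (name, condition). -/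
inductive PName (Q : Type v) : Type (v + 1)
  | mk (ι : Type v) (name : ι → PName Q) (cond : ι → Q) : PName Q

/-- The canonical name of a set of the ground model. -/
def PName.check : PSet.{v} → PName Q
  | PSet.mk α A => PName.mk (α × Q) (fun i => PName.check (A i.1)) (fun i => i.2)

/-- `p` forces `x = y`: densely often below `p` each member of `x` is equal to a member of `y`, and
conversely. -/
def ForcesEq : PName Q → PName Q → Q → Prop
  | PName.mk ι x c, PName.mk ι' y d => fun p =>
    (∀ i : ι, ∀ q ≤ p, q ≤ c i → ∃ r ≤ q, ∃ j : ι', r ≤ d j ∧ ForcesEq (x i) (y j) r) ∧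
    (∀ j : ι', ∀ q ≤ p, q ≤ d j → ∃ r ≤ q, ∃ i : ι, r ≤ c i ∧ ForcesEq (x i) (y j) r)

/-- `p` forces `x ∈ y`. -/
def ForcesMem (x : PName Q) : PName Q → Q → Prop
  | PName.mk ι y d => fun p => ∀ q ≤ p, ∃ r ≤ q, ∃ j : ι, r ≤ d j ∧ ForcesEq x (y j) r

/-- `p` forces `x ⊆ y`. -/
def ForcesSubset : PName Q → PName Q → Q → Prop
  | PName.mk ι x c, y => fun p => ∀ i : ι, ∀ q ≤ p, q ≤ c i → ForcesMem (x i) y q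

variable (Q) in
/-- `Q` does not add reals: whenever `p` forces `x ⊆ ω`, some `q ≤ p` forces `x` to be equal to some
set of the ground model. -/
def AddsNoReals : Prop :=
  ∀ (x : PName Q) (p : Q), ForcesSubset x (PName.check PSet.omega) p →
    ∃ q ≤ p, ∃ A : PSet.{v}, ForcesEq x (PName.check A) q

/-- Totally proper: proper and not adding reals. -/
def IsTotallyProper [Small.{u} Q] (e : Q ↪ ZFSet.{u}) : Prop :=
  IsProper e ∧ AddsNoReals Q

variable (Q) in
/-- The `ω₂`-chain condition: every antichain has size less than `ℵ₂`. -/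
def IsOmega2CC : Prop :=
  ∀ A : Set Q, (∀ p ∈ A, ∀ q ∈ A, p ≠ q → ¬ Compatible p q) → #A < ℵ_ 2

end Posets

end SubtreeForcing

open SubtreeForcing

/-! The heart is a density argument, `Condition.exists_level_of_dense`. Let `D` be dense and let `a`
be a tuple of distinct points of value 1 on the top level of a condition `p`. Then some countable
level `β` catches every tuple `b` of level `β` above `a`: some `q ≤ p` in `D` with top level below
`β` gives value 1 to all traces of `b`. Otherwise the uncaught tuples form a downwards closed set
with members on every level from that of `a` on. Prune it so that each remaining tuple extends to
all countable levels (`exists_isPruned`). Since `T` has no uncountable chain, remaining tuples split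
in all coordinates at once, and a comb of such splittings yields infinitely many disjoint tuples on
one level whose downward closure is at most binary (`IsPruned.exists_spread`). As `S` has an element
that is at least 2, `p` extends to a condition containing all of them, and this condition may adopt
the pruned set as a promise. An extension `q ∈ D` then contains a tuple of the pruned set on its top
level, so it catches an uncaught tuple one level higher, a contradiction.

Now let `N` be a countable elementary submodel and `δ = N ∩ ω₁`. If `D` and `p` are in `N`,
elementarity places a catching level below `δ`. Finitely many points of level `δ` with distinct
traces of value 1 in `p` restrict to a tuple on that level, which belongs to `N`; so some `q ∈ D ∩
N` below `p` still gives value 1 to their traces (`exists_le_mem_has`). Hence a descending sequence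
in `N` can meet every dense set of `N` while more and more points of level `δ` are reserved,
finitely many at each stage, until every node of value 1 is covered and every promise is fulfilled
on level `δ`. The limit is a total master condition (`exists_totalMaster`). Membership in `N` is
handled by definability in `H(κ)`; the key fact is that a tree point belongs to `N` exactly when its
height does (`has_iff_ht_mem`).

Total master conditions are generic, which gives properness. Countably many dense sets fit into one
`N`, so the poset is countably distributive and adds no reals. Conditions with the same subtree
function are compatible, and under CH there are at most `ℵ₁` subtree functions. -/

namespace SubtreeForcing

/-! ### Meeting countably many dense sets. -/

section GenericSequence

/-- Rasiowa–Sikorski: a countable family of dense sets is met by a descending sequence. -/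
theorem exists_generic_seq {Q : Type*} [Preorder Q] {ι : Type*} [Countable ι]
    (D : ι → Set Q) (hD : ∀ i, IsDense (D i)) (p : Q) :
    ∃ s : ℕ → Q, Antitone s ∧ s 0 = p ∧ ∀ i, ∃ k, s k ∈ D i := by
  classical
  have := Encodable.ofCountable ι
  choose f hf hle using hD
  let step : ℕ → Q → Q := fun n q =>
    match Encodable.decode (α := ι) n with
    | some i => f i q
    | none => q
  let s : ℕ → Q := fun n => Nat.rec p (fun n q => step n q) n
  refine ⟨s, antitone_nat_of_succ_le fun n => ?_, rfl, fun i => ⟨Encodable.encode i + 1, ?_⟩⟩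
  · change step n (s n) ≤ s n
    unfold step
    split
    · exact hle _ _
    · exact le_rfl
  · change step (Encodable.encode i) (s _) ∈ D i
    simp only [step, Encodable.encodek]
    exact hf _ _

end GenericSequence

/-! ### Countable ordinals. -/

section CountableOrdinals

theorem countable_Iio_of_lt_omega1 {α : Ordinal.{u}} (h : α < ω₁) : (Set.Iio α).Countable := by
  rw [← Cardinal.le_aleph0_iff_set_countable, Cardinal.mk_Iio_ordinal, Cardinal.lift_le_aleph0]
  rwa [← Cardinal.ord_aleph, Cardinal.lt_ord, ← zero_add (1 : Ordinal),
    ← Cardinal.succ_aleph, Cardinal.aleph_zero, Order.lt_succ_iff] at h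

theorem succ_lt_omega1 {α : Ordinal.{u}} (h : α < ω₁) : Order.succ α < ω₁ :=
  (Cardinal.isSuccLimit_omega 1).succ_lt h

theorem exists_lt_omega1_forall_lt {ι : Type*} [Countable ι] (f : ι → Ordinal.{u})
    (hf : ∀ i, f i < ω₁) : ∃ β < ω₁, ∀ i, f i < β := by
  refine ⟨_, succ_lt_omega1 (Ordinal.iSup_lt_omega_one hf), fun i => Order.lt_succ_of_le ?_⟩
  exact le_ciSup (f := f) ⟨ω₁, by rintro _ ⟨j, rfl⟩; exact (hf j).le⟩ i

end CountableOrdinals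

/-! ### Heights, restrictions and levels of `ω₁`-trees. -/

section TreeBasics

variable {T : Type u} [PartialOrder T] [WellFoundedLT T]

theorem ht_lt_ht {x y : T} (h : x < y) : ht x < ht y :=
  IsWellFounded.rank_lt_of_rel h

theorem ht_le_ht {x y : T} (h : x ≤ y) : ht x ≤ ht y := by
  rcases h.eq_or_lt with rfl | h
  · exact le_rfl
  · exact (ht_lt_ht h).le

theorem eq_of_le_of_ht_le {x y : T} (h : x ≤ y) (h' : ht y ≤ ht x) : x = y := by
  rcases h.eq_or_lt with rfl | h
  · rfl
  · exact absurd (ht_lt_ht h) h'.not_gt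

theorem exists_le_ht_eq (x : T) : ∀ α ≤ ht x, ∃ y ≤ x, ht y = α := by
  induction x using WellFoundedLT.induction with
  | _ x ih =>
    intro α hα
    rcases hα.eq_or_lt with rfl | hα
    · exact ⟨x, le_rfl, rfl⟩
    · rw [ht, IsWellFounded.rank_eq, Ordinal.lt_iSup_iff] at hα
      obtain ⟨⟨y, hy⟩, h⟩ := hα
      obtain ⟨z, hz, rfl⟩ := ih y hy α (Order.lt_succ_iff.1 h)
      exact ⟨z, hz.trans hy.le, rfl⟩

open Classical in
/-- The predecessor of `x` at level `α`, for `α ≤ ht x`. -/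
noncomputable def res (α : Ordinal.{u}) (x : T) : T :=
  if h : α ≤ ht x then (exists_le_ht_eq x α h).choose else x

theorem res_le (α : Ordinal.{u}) (x : T) : res α x ≤ x := by
  unfold res
  split_ifs with h
  · exact (exists_le_ht_eq x α h).choose_spec.1
  · exact le_rfl

theorem ht_res {α : Ordinal.{u}} {x : T} (h : α ≤ ht x) : ht (res α x) = α := by
  unfold res
  rw [dif_pos h]
  exact (exists_le_ht_eq x α h).choose_spec.2

theorem covBy_of_ht {x y : T} (h : x ≤ y) (hy : ht y = Order.succ (ht x)) : x ⋖ y := by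
  refine ⟨lt_of_le_of_ne h fun he => ?_, fun z h1 h2 => ?_⟩
  · rw [he] at hy
    exact (Order.lt_succ (ht y)).ne hy
  · have := ht_lt_ht h2
    rw [hy, Order.lt_succ_iff] at this
    exact this.not_gt (ht_lt_ht h1)

namespace IsOmega1Tree

variable (hT : IsOmega1Tree T)
include hT

theorem le_total_of_le {x y z : T} (hy : y ≤ x) (hz : z ≤ x) : y ≤ z ∨ z ≤ y := by
  rcases hy.eq_or_lt with rfl | hy
  · exact Or.inr hz
  rcases hz.eq_or_lt with rfl | hz
  · exact Or.inl hy.le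
  exact (hT.chain x).total hy hz

theorem le_of_ht_le {x y z : T} (hy : y ≤ x) (hz : z ≤ x) (h : ht y ≤ ht z) : y ≤ z := by
  rcases hT.le_total_of_le hy hz with h' | h'
  · exact h'
  · exact (eq_of_le_of_ht_le h' h).ge

theorem eq_of_ht_eq {x y z : T} (hy : y ≤ x) (hz : z ≤ x) (h : ht y = ht z) : y = z :=
  eq_of_le_of_ht_le (hT.le_of_ht_le hy hz h.le) h.ge

theorem res_eq {x y : T} (h : y ≤ x) {α : Ordinal.{u}} (hα : ht y = α) : res α x = y :=
  hT.eq_of_ht_eq (res_le _ _) h (by rw [ht_res (hα ▸ ht_le_ht h), hα])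

theorem le_res {x y : T} (h : y ≤ x) {α : Ordinal.{u}} (hα : ht y ≤ α) (hx : α ≤ ht x) :
    y ≤ res α x :=
  hT.le_of_ht_le h (res_le _ _) (by rwa [ht_res hx])

theorem res_mono {x y : T} (h : y ≤ x) {α : Ordinal.{u}} (hα : α ≤ ht y) : res α x = res α y :=
  hT.res_eq ((res_le _ _).trans h) (ht_res hα)

theorem res_res {x : T} {α β : Ordinal.{u}} (h : α ≤ β) (hx : β ≤ ht x) :
    res α (res β x) = res α x :=
  (hT.res_mono (res_le _ _) (by rwa [ht_res hx])).symm

theorem ht_covBy {x y : T} (h : x ⋖ y) : ht y = Order.succ (ht x) := by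
  refine le_antisymm ?_ (Order.succ_le_of_lt (ht_lt_ht h.lt))
  by_contra hlt
  rw [not_le] at hlt
  have h1 := ht_res hlt.le
  have h2 : x < res (Order.succ (ht x)) y := by
    refine lt_of_le_of_ne (hT.le_res h.le (Order.le_succ _) hlt.le) fun he => ?_
    rw [← he] at h1
    exact (Order.lt_succ (ht x)).ne h1
  refine h.2 h2 (lt_of_le_of_ne (res_le _ _) fun he => ?_)
  rw [he] at h1
  exact hlt.ne' h1

theorem covBy_res {x y : T} (h : x < y) : x ⋖ res (Order.succ (ht x)) y :=
  have h1 := Order.succ_le_of_lt (ht_lt_ht h)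
  covBy_of_ht (hT.le_res h.le (Order.le_succ _) h1) (ht_res h1)

theorem countable_level (α : Ordinal.{u}) : {x : T | ht x = α}.Countable := by
  by_cases h : α < ω₁
  · exact hT.level_countable α h
  · convert Set.countable_empty
    ext x
    simp only [Set.mem_ofPred_eq, Set.mem_empty_iff_false, iff_false]
    rintro rfl
    exact h (hT.ht_lt x)

theorem countable_ht_lt {α : Ordinal.{u}} (h : α < ω₁) : {x : T | ht x < α}.Countable := by
  have : {x : T | ht x < α} = ⋃ β ∈ Set.Iio α, {x : T | ht x = β} := by
    ext x; simp
  rw [this]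
  exact (countable_Iio_of_lt_omega1 h).biUnion fun β _ => hT.countable_level β

theorem countable_tuples (m : ℕ) (α : Ordinal.{u}) :
    {a : Fin m → T | ∀ i, ht (a i) = α}.Countable := by
  exact Set.countable_pi (fun _ : Fin m => hT.countable_level α)

/-- Only countably many points have height below `α`, so one of the uncountably many points above
`x` reaches level `α`. -/
theorem exists_ge_ht_eq (hn : IsNormal T) (x : T) {α : Ordinal.{u}} (hα : α < ω₁)
    (hx : ht x ≤ α) : ∃ y, x ≤ y ∧ ht y = α := by
  by_contra! hcon
  refine hn.uncountable x ((hT.countable_ht_lt hα).mono fun y hy => ?_)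
  by_contra hlt
  rw [Set.mem_ofPred_eq, not_lt] at hlt
  exact hcon _ (hT.le_res hy.le hx hlt) (ht_res hlt)

end IsOmega1Tree

end TreeBasics

/-! ### Extending subtree functions and conditions to higher levels. -/

section Extension

variable {T : Type u} [PartialOrder T] [WellFoundedLT T]

/-- Well-order level `β` with the points of `C` first, and let `d x` be the least point above `x`.
This choice is coherent: if `x ≤ y ≤ d x`, the minimum over the cone of `x` already lies in the
smaller cone of `y`. -/
theorem IsOmega1Tree.exists_guide (hT : IsOmega1Tree T) (hn : IsNormal T) {β : Ordinal.{u}}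
    (hβ : β < ω₁) (C : Set T) :
    ∃ d : T → T, (∀ x, ht x ≤ β → x ≤ d x ∧ ht (d x) = β) ∧
      (∀ x y, x ≤ y → y ≤ d x → ht x ≤ β → d y = d x) ∧
      ∀ x, ht x ≤ β → (∃ c ∈ C, x ≤ c ∧ ht c = β) → d x ∈ C := by
  classical
  obtain ⟨f, hf⟩ := (Set.countable_iff_exists_injOn).1 (hT.countable_level β)
  let rk : T → ℕ ×ₗ ℕ := fun c => toLex (if c ∈ C then 0 else 1, f c)
  have hrk : ∀ c c', ht c = β → ht c' = β → rk c = rk c' → c = c' := by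
    intro c c' h h' he
    exact hf h h' (congrArg (fun z => (ofLex z).2) he)
  have hex : ∀ x, ∃ d, ht x ≤ β → (x ≤ d ∧ ht d = β) ∧ ∀ c, x ≤ c → ht c = β → rk d ≤ rk c := by
    intro x
    by_cases hx : ht x ≤ β
    · have hne : {c | x ≤ c ∧ ht c = β}.Nonempty := hT.exists_ge_ht_eq hn x hβ hx
      refine ⟨Function.argminOn rk _ hne, fun _ =>
        ⟨Function.argminOn_mem rk _ hne, fun c h1 h2 => ?_⟩⟩
      exact Function.argminOn_le rk {c | x ≤ c ∧ ht c = β} (a := c) ⟨h1, h2⟩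
    · exact ⟨x, fun h => absurd h hx⟩
  choose d hd using hex
  refine ⟨d, fun x hx => (hd x hx).1, fun x y hxy hyd hx => ?_, fun x hx ⟨c, hc, hxc, hcβ⟩ => ?_⟩
  · have hy : ht y ≤ β := (ht_le_ht hyd).trans (hd x hx).1.2.le
    refine hrk _ _ (hd y hy).1.2 (hd x hx).1.2 (le_antisymm ?_ ?_)
    · exact (hd y hy).2 _ hyd (hd x hx).1.2
    · exact (hd x hx).2 _ (hxy.trans (hd y hy).1.1) (hd y hy).1.2
  · have h := (hd x hx).2 c hxc hcβ
    by_contra hcon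
    have : rk c < rk (d x) := by
      simp only [rk, hc, hcon, if_true, if_false]
      exact Prod.Lex.toLex_lt_toLex.2 (Or.inl Nat.zero_lt_one)
    exact this.not_ge h

/-- From the top level of `F` on, each node `x` receives a set `I x` of `n` immediate successors,
containing those below `C` and the one towards its guide `d x`. A point has value 1 if its branch
follows `F` and then the sets `I`. By coherence of the guides, `d x` has value 1 whenever `x` does,
so every node reaches level `β` without any recursion through limit levels. -/
theorem SubtreeFun.exists_extension (hT : IsOmega1Tree T) (hn : IsNormal T) {S : Set ℕ} {n : ℕ}
    (hnS : n ∈ S) (hn1 : 1 ≤ n) (hImm : ∀ x : T, (n : ℕ∞) ≤ (Imm x).encard)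
    (F : SubtreeFun T) (hF : F.IsSplitting S) {β : Ordinal.{u}} (hβ : β < ω₁) (hγ : F.top ≤ β)
    (C : Set T) (hC : ∀ c ∈ C, ht c = β ∧ res F.top c ∈ F.one)
    (hsucc : ∀ x, F.top ≤ ht x → ht x < β → {y ∈ Imm x | ∃ c ∈ C, y ≤ c}.encard ≤ n) :
    ∃ G : SubtreeFun T, G.top = β ∧ G.Extends F ∧ G.IsSplitting S ∧ C ⊆ G.one := by
  obtain ⟨d, hd, hdd, hdC⟩ := hT.exists_guide hn hβ C
  have hI : ∀ x, ∃ I : Set T, F.top ≤ ht x → ht x < β → I ⊆ Imm x ∧ I.encard = n ∧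
      (∀ y ∈ Imm x, (∃ c ∈ C, y ≤ c) → y ∈ I) ∧ res (Order.succ (ht x)) (d x) ∈ I := by
    intro x
    by_cases hx : F.top ≤ ht x ∧ ht x < β
    swap
    · exact ⟨∅, fun h1 h2 => absurd ⟨h1, h2⟩ hx⟩
    have hxd : x < d x := by
      refine lt_of_le_of_ne (hd x hx.2.le).1 fun he => ?_
      have := (hd x hx.2.le).2
      rw [← he] at this
      exact hx.2.ne this
    set u := res (Order.succ (ht x)) (d x)
    have hu : x ⋖ u := hT.covBy_res hxd
    let A : Set T := {y ∈ Imm x | ∃ c ∈ C, y ≤ c}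
    -- If a successor of `x` lies below `C`, then `d x ∈ C` and `u` is already in `A`; otherwise `u`
    -- is the only point to accommodate.
    have hA : (A ∪ {u}).encard ≤ n := by
      by_cases hne : A.Nonempty
      · obtain ⟨y, hy, c, hc, hyc⟩ := hne
        have : d x ∈ C := hdC x hx.2.le ⟨c, hc, hy.le.trans hyc, (hC c hc).1⟩
        have huA : u ∈ A := ⟨hu, d x, this, res_le _ _⟩
        rw [Set.union_eq_left.2 (Set.singleton_subset_iff.2 huA)]
        exact hsucc x hx.1 hx.2
      · rw [Set.not_nonempty_iff_eq_empty.1 hne, Set.empty_union, Set.encard_singleton]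
        exact_mod_cast hn1
    have hAsub : A ∪ {u} ⊆ Imm x := by
      rintro y (hy | rfl)
      · exact hy.1
      · exact hu
    obtain ⟨I, h1, h2, h3⟩ := Set.exists_superset_subset_encard_eq hAsub hA (hImm x)
    exact ⟨I, fun _ _ => ⟨h2, h3, fun y hy hc => h1 (Or.inl ⟨hy, hc⟩), h1 (Or.inr rfl)⟩⟩
  choose I hI using hI
  -- The minimum treats both cases at once: up to the top level of `F` the restricted point is `y`
  -- itself, above it the trace of `y`.
  let O : Set T := {y | ht y ≤ β ∧ res (min F.top (ht y)) y ∈ F.one ∧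
    ∀ x < y, F.top ≤ ht x → res (Order.succ (ht x)) y ∈ I x}
  have hlow : ∀ x, ht x ≤ F.top → (x ∈ F.one ↔ x ∈ O) := by
    intro x hx
    have h1 : res (min F.top (ht x)) x = x := by
      rw [min_eq_right hx]; exact hT.res_eq le_rfl rfl
    refine ⟨fun h => ⟨hx.trans hγ, by rwa [h1], fun y hy hy' => ?_⟩, fun h => by
      rw [← h1]; exact h.2.1⟩
    exact absurd (ht_lt_ht hy) (hx.trans hy').not_gt
  have hdO : ∀ x ∈ O, F.top ≤ ht x → d x ∈ O := by
    intro x hx hx'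
    have hdx := hd x hx.1
    refine ⟨hdx.2.le, ?_, fun y hy hy' => ?_⟩
    · have := hx.2.1
      rw [min_eq_left hx'] at this
      rw [hdx.2, min_eq_left hγ, hT.res_mono hdx.1 hx']
      exact this
    · by_cases hyx : ht y < ht x
      · have hyx' : y < x := lt_of_le_of_ne (hT.le_of_ht_le hy.le hdx.1 hyx.le) fun he => by
          rw [he] at hyx; exact hyx.false
        rw [hT.res_mono hdx.1 (Order.succ_le_of_lt hyx)]
        exact hx.2.2 y hyx' hy'
      -- Between `x` and `d x` the guide of `y` is still `d x`, so `I y` contains the successor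
      -- towards it.
      · have hxy : x ≤ y := hT.le_of_ht_le hdx.1 hy.le (not_lt.1 hyx)
        rw [← hdd x y hxy hy.le hx.1]
        exact (hI y hy' ((ht_lt_ht hy).trans_eq hdx.2)).2.2.2
  refine ⟨⟨β, hβ, O, fun x hx => hx.1, fun r hr => ?_, fun x y hxy hy => ?_, fun x hx hxβ => ?_⟩,
    rfl, ⟨hγ, hlow⟩, fun x hx hxβ => ?_, fun c hc => ?_⟩
  · refine (hlow r ?_).1 (F.root_mem r hr)
    exact F.ht_le r (F.root_mem r hr)
  · refine ⟨(ht_le_ht hxy).trans hy.1, F.down _ _ ?_ hy.2.1, fun z hz hz' => ?_⟩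
    · have hle := ht_le_ht hxy
      refine hT.le_res ((res_le _ _).trans hxy) ?_ (min_le_right _ _)
      rw [ht_res (min_le_right _ _)]
      exact min_le_min le_rfl hle
    · rw [← hT.res_mono hxy (Order.succ_le_of_lt (ht_lt_ht hz))]
      exact hy.2.2 z (hz.trans_le hxy) hz'
  · by_cases hx' : F.top ≤ ht x
    · exact ⟨d x, hdO x hx hx', (hd x hx.1).1, (hd x hx.1).2⟩
    · rw [not_le] at hx'
      obtain ⟨y, hy, hxy, hyt⟩ := F.exists_top x ((hlow x hx'.le).2 hx) hx'
      have hyO := (hlow y hyt.le).1 hy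
      exact ⟨d y, hdO y hyO hyt.ge, hxy.trans (hd y hyO.1).1, (hd y hyO.1).2⟩
  · change x ∈ O at hx
    change ht x < β at hxβ
    by_cases hx' : F.top ≤ ht x
    · refine ⟨n, hnS, ?_⟩
      obtain ⟨h1, h2, h3, h4⟩ := hI x hx' hxβ
      rw [← h2]
      congr 1
      ext y
      constructor
      · rintro ⟨hy, hyO⟩
        have := hyO.2.2 x hy.lt hx'
        rwa [hT.res_eq le_rfl (hT.ht_covBy hy)] at this
      · intro hy
        have hxy := h1 hy
        have hty := hT.ht_covBy hxy
        refine ⟨hxy, ?_, ?_, fun z hz hz' => ?_⟩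
        · rw [hty]; exact Order.succ_le_of_lt hxβ
        · have := hx.2.1
          rw [min_eq_left hx'] at this
          rw [min_eq_left (hx'.trans (ht_le_ht hxy.le)), hT.res_mono hxy.le hx']
          exact this
        · have hzx : z ≤ x := by
            refine hT.le_of_ht_le hz.le hxy.le ?_
            rw [← Order.lt_succ_iff, ← hty]; exact ht_lt_ht hz
          rcases hzx.eq_or_lt with rfl | hzx
          · rwa [hT.res_eq le_rfl hty]
          · rw [hT.res_mono hxy.le (Order.succ_le_of_lt (ht_lt_ht hzx))]
            exact hx.2.2 z hzx hz'
    · rw [not_le] at hx'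
      obtain ⟨k, hk, he⟩ := hF x ((hlow x hx'.le).2 hx) hx'
      refine ⟨k, hk, ?_⟩
      rw [← he]
      congr 1
      ext y
      refine and_congr_right fun hy => (hlow y ?_).symm
      rw [hT.ht_covBy hy]; exact Order.succ_le_of_lt hx'
  · have hcβ := (hC c hc).1
    refine ⟨hcβ.le, ?_, fun z hz hz' => ?_⟩
    · rw [hcβ, min_eq_left hγ]; exact (hC c hc).2
    · exact (hI z hz' ((ht_lt_ht hz).trans_eq hcβ)).2.2.1 _ (hT.covBy_res hz)
        ⟨c, hc, res_le _ _⟩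

theorem GenPromise.injective_of_mem (hT : IsOmega1Tree T) {U : GenPromise T} {β : Ordinal.{u}}
    (hβ : β ∈ Set.Ico U.base ω₁) {Y : Set (Fin U.dim → T)} (hY : Y ∈ U.val β) {a : Fin U.dim → T}
    (ha : a ∈ Y) : (∀ i, ht (a i) = β) ∧ Function.Injective a := by
  obtain ⟨x, hx, hxh, h⟩ := U.exists_derived
  obtain ⟨-, -, h⟩ := h β hβ Y hY
  refine ⟨(h a ha).2, fun i j hij => hx ?_⟩
  exact hT.eq_of_ht_eq ((h a ha).1.1 i) (hij ▸ (h a ha).1.1 j) (hxh i j)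

/-- The restriction of `Y` to the top level of `p` is again a member of the promise. Fulfilment
supplies a suitable tuple there, and it has an extension in `Y`. The traces are distinct because
they lie above the distinct base points of the promise. -/
theorem Condition.exists_tuple (hT : IsOmega1Tree T) {S : Set ℕ} (p : Condition T S)
    {U : GenPromise T} (hU : U ∈ p.Γ) {β : Ordinal.{u}} (hγ : p.F.top < β) (hβ : β < ω₁)
    {Y : Set (Fin U.dim → T)} (hY : Y ∈ U.val β) {t : Set T} (ht' : t.Finite) :
    ∃ b ∈ Y, (∀ i, ht (b i) = β ∧ res p.F.top (b i) ∈ p.F.one ∧ res p.F.top (b i) ∉ t) ∧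
      Function.Injective fun i => res p.F.top (b i) := by
  classical
  have hb := p.base_le U hU
  have hY' := U.restrict_mem _ _ hb hγ hβ Y hY
  obtain ⟨a, ha, h⟩ := p.fulfills U hU (ht'.toFinset.filter fun y => ht y = p.F.top)
    (fun y hy => (Finset.mem_filter.1 hy).2) _ hY'
  obtain ⟨hat, hai⟩ := GenPromise.injective_of_mem hT ⟨hb, p.F.top_lt⟩ hY' ha
  obtain ⟨-, b, hbY, hab⟩ := ha
  have hr : ∀ i, res p.F.top (b i) = a i := fun i => hT.res_eq (hab i) (hat i)
  refine ⟨b, hbY, fun i => ⟨(GenPromise.injective_of_mem hT ⟨hb.trans hγ.le, hβ⟩ hY hbY).1 i, ?_, ?_⟩,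
    ?_⟩
  · rw [hr]; exact (h i).2
  · rw [hr]
    intro hi
    exact (h i).1 (Finset.mem_filter.2 ⟨ht'.mem_toFinset.2 hi, hat i⟩)
  · simp only [hr]; exact hai

/-- Fulfilling witnesses for all promises of `p` at a higher level, with pairwise distinct traces on
the top level of `p`, which moreover avoid a given finite set. -/
theorem Condition.exists_witnesses (hT : IsOmega1Tree T) {S : Set ℕ} (p : Condition T S)
    {β : Ordinal.{u}} (hγ : p.F.top < β) (hβ : β < ω₁) {t₀ : Set T} (ht₀ : t₀.Finite) :
    ∃ C : Set T, (∀ c ∈ C, ht c = β ∧ res p.F.top c ∈ p.F.one ∧ res p.F.top c ∉ t₀) ∧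
      Set.InjOn (res p.F.top) C ∧
      ∀ U ∈ p.Γ, ∀ Y ∈ U.val β, ∀ t : Set T, t.Finite → (∀ y ∈ t, ht y = β) →
        ∃ b ∈ Y, ∀ i, b i ∈ C ∧ b i ∉ t := by
  let P : Set T → Prop := fun X => X.Finite ∧
    (∀ c ∈ X, ht c = β ∧ res p.F.top c ∈ p.F.one ∧ res p.F.top c ∉ t₀) ∧ Set.InjOn (res p.F.top) X
  have := p.countable.to_subtype
  have hcU : ∀ U : p.Γ, Countable (U.1.val β) := fun U =>
    (U.1.countable β ⟨(p.base_le U.1 U.2).trans hγ.le, hβ⟩).to_subtype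
  have := (Set.countable_ofPred_finite_subset (hT.countable_level β)).to_subtype
  -- The set `C` is built from finite approximations. There is one requirement for each promise,
  -- member and finite subset of level `β`, countably many in all; in the order dual, larger
  -- approximations are stronger.
  let D : (Σ U : p.Γ, U.1.val β) × {t : Set T | t.Finite ∧ t ⊆ {y : T | ht y = β}} →
      Set (Subtype P)ᵒᵈ :=
    fun r => {X | ∃ b ∈ r.1.2.1, ∀ i, b i ∈ (OrderDual.ofDual X).1 ∧ b i ∉ r.2.1}
  have hD : ∀ r, IsDense (D r) := by
    rintro ⟨⟨⟨U, hU⟩, ⟨Y, hY⟩⟩, ⟨t, htf, htβ⟩⟩ X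
    obtain ⟨X, hXf, hX, hXi⟩ := X
    -- Avoiding the traces of `X` keeps the traces injective; avoiding those of `t` keeps `b` away
    -- from `t`.
    obtain ⟨b, hb, hb1, hb2⟩ := p.exists_tuple hT hU hγ hβ hY
      ((ht₀.union (hXf.image (res p.F.top))).union (htf.image (res p.F.top)))
    refine ⟨⟨X ∪ Set.range b, hXf.union (Set.finite_range b), ?_, ?_⟩, ⟨b, hb, fun i => ⟨?_, ?_⟩⟩, ?_⟩
    · rintro c (hc | ⟨i, rfl⟩)
      · exact hX c hc
      · exact ⟨(hb1 i).1, (hb1 i).2.1, fun h => (hb1 i).2.2 (Or.inl (Or.inl h))⟩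
    · have hne : ∀ c ∈ X, ∀ i, res p.F.top c ≠ res p.F.top (b i) := fun c hc i he =>
        (hb1 i).2.2 (Or.inl (Or.inr ⟨c, hc, he⟩))
      rintro c (hc | ⟨i, rfl⟩) c' (hc' | ⟨j, rfl⟩) he
      · exact hXi hc hc' he
      · exact absurd he (hne c hc j)
      · exact absurd he.symm (hne c' hc' i)
      · rw [hb2 he]
    · exact Or.inr ⟨i, rfl⟩
    · exact fun h => (hb1 i).2.2 (Or.inr ⟨_, h, rfl⟩)
    · exact Set.subset_union_left (s := X)
  obtain ⟨s, hs, -, hsD⟩ := exists_generic_seq D hD (OrderDual.toDual ⟨∅, by simp [P]⟩)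
  refine ⟨⋃ k, (OrderDual.ofDual (s k)).1, ?_, ?_, fun U hU Y hY t htf htβ => ?_⟩
  · intro c hc
    obtain ⟨k, hk⟩ := Set.mem_iUnion.1 hc
    exact (OrderDual.ofDual (s k)).2.2.1 c hk
  · intro c hc c' hc' he
    obtain ⟨k, hk⟩ := Set.mem_iUnion.1 hc
    obtain ⟨l, hl⟩ := Set.mem_iUnion.1 hc'
    exact (OrderDual.ofDual (s (max k l))).2.2.2 (hs (le_max_left k l) hk)
      (hs (le_max_right k l) hl) he
  · obtain ⟨k, b, hb, h⟩ := hsD ⟨⟨⟨U, hU⟩, ⟨Y, hY⟩⟩, ⟨t, htf, htβ⟩⟩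
    exact ⟨b, hb, fun i => ⟨Set.mem_iUnion.2 ⟨k, (h i).1⟩, (h i).2⟩⟩

/-- Fulfilling witnesses are added with traces that are pairwise distinct and different from those
of `C`. Thus, from the top level on, the points above a node come either only from `C` or from a
single witness, and no node needs more than two successors. -/
theorem Condition.exists_extension (hT : IsOmega1Tree T) (hn : IsNormal T) {S : Set ℕ} {n : ℕ}
    (hnS : n ∈ S) (hn2 : 2 ≤ n) (hImm : ∀ x : T, (n : ℕ∞) ≤ (Imm x).encard)
    (p : Condition T S) {β : Ordinal.{u}} (hγ : p.F.top < β) (hβ : β < ω₁)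
    (C : Set T) (hC : ∀ c ∈ C, ht c = β ∧ res p.F.top c ∈ p.F.one)
    (hfin : (res p.F.top '' C).Finite)
    (hsucc : ∀ x, p.F.top ≤ ht x → ht x < β → {y ∈ Imm x | ∃ c ∈ C, y ≤ c}.encard ≤ 2) :
    ∃ q ≤ p, q.F.top = β ∧ q.Γ = p.Γ ∧ C ⊆ q.F.one := by
  obtain ⟨C', hC', hinj, hU⟩ := p.exists_witnesses hT hγ hβ hfin
  have hres : ∀ x c, p.F.top ≤ ht x → x ≤ c → res p.F.top c = res p.F.top x := fun x c hx hc =>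
    hT.res_mono hc hx
  obtain ⟨G, hG, hGF, hGS, hCG⟩ := SubtreeFun.exists_extension hT hn hnS (by omega) hImm p.F
    p.splitting hβ hγ.le (C ∪ C') (by
      rintro c (hc | hc)
      · exact hC c hc
      · exact ⟨(hC' c hc).1, (hC' c hc).2.1⟩) (by
      intro x hx hxβ
      by_cases hxC : ∃ c ∈ C, x ≤ c
      · obtain ⟨c, hc, hxc⟩ := hxC
        refine (Set.encard_le_encard ?_).trans ((hsucc x hx hxβ).trans (by exact_mod_cast hn2))
        rintro y ⟨hy, c', hc' | hc', hyc⟩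
        · exact ⟨hy, c', hc', hyc⟩
        · refine absurd ⟨c, hc, ?_⟩ (hC' c' hc').2.2
          rw [hres x c hx hxc, hres x c' hx (hy.le.trans hyc)]
      · refine le_trans (Set.encard_le_one_iff.2 ?_) (by exact_mod_cast (by omega : 1 ≤ n))
        have key : ∀ y, y ∈ Imm x → (∃ c ∈ C ∪ C', y ≤ c) → ∃ c ∈ C', y ≤ c := by
          rintro y hy ⟨c, hc | hc, hyc⟩
          · exact absurd ⟨c, hc, hy.le.trans hyc⟩ hxC
          · exact ⟨c, hc, hyc⟩
        rintro y y' ⟨hy, hyc⟩ ⟨hy', hyc'⟩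
        obtain ⟨c, hc, hyc⟩ := key y hy hyc
        obtain ⟨c', hc', hyc'⟩ := key y' hy' hyc'
        have : c = c' := hinj hc hc' (by
          rw [hres x c hx (hy.le.trans hyc), hres x c' hx (hy'.le.trans hyc')])
        subst this
        exact hT.eq_of_ht_eq hyc hyc' (by rw [hT.ht_covBy hy, hT.ht_covBy hy']))
  subst hG
  refine ⟨⟨G, hGS, p.Γ, p.countable, fun U hU => (p.base_le U hU).trans hγ.le, ?_⟩,
    ⟨hGF, subset_rfl⟩, rfl, rfl, fun c hc => hCG (Or.inl hc)⟩
  intro U hUΓ t ht Y hY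
  obtain ⟨b, hb, h⟩ := hU U hUΓ Y hY t t.finite_toSet ht
  exact ⟨b, hb, fun i => ⟨(h i).2, hCG (Or.inr (h i).1)⟩⟩

end Extension

/-! ### Pruned sets of tuples and the central density argument. -/

section Pruning

theorem exists_forall_notMem_of_disjoint {T : Type*} {m : ℕ} {D : ℕ → Fin m → T}
    (hD : ∀ k l, k ≠ l → ∀ i j, D k i ≠ D l j) {t : Set T} (ht : t.Finite) :
    ∃ k, ∀ i, D k i ∉ t := by
  by_contra! hcon
  choose i hi using hcon
  refine Set.infinite_of_injective_forall_mem (f := fun k => D k (i k)) (fun k l he => ?_) hi ht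
  by_contra hkl
  exact hD k l hkl _ _ he

variable {T : Type u} [PartialOrder T] [WellFoundedLT T]

/-- A downwards closed set `W` of level tuples above `a`, each of which has extensions in `W` to all
countable levels. -/
structure IsPruned {m : ℕ} (a : Fin m → T) (W : Set (Fin m → T)) : Prop where
  mem : a ∈ W
  above : ∀ b ∈ W, a ≤ b
  level : ∀ b ∈ W, ∀ i j, ht (b i) = ht (b j)
  down : ∀ b ∈ W, ∀ c, a ≤ c → c ≤ b → (∀ i j, ht (c i) = ht (c j)) → c ∈ W
  extend : ∀ b ∈ W, ∀ β < ω₁, (∀ i, ht (b i) ≤ β) → ∃ c ∈ W, b ≤ c ∧ ∀ i, ht (c i) = β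

/-- The kept tuples are those with extensions in `W` on all countable levels. If a kept tuple had no
kept extension on level `β`, each of its countably many extensions there would die at some countable
level. These levels have a common countable bound, yet an extension above that bound passes through
one of the dying tuples. -/
theorem exists_isPruned (hT : IsOmega1Tree T) {m : ℕ} {a : Fin m → T} {W : Set (Fin m → T)}
    (above : ∀ b ∈ W, a ≤ b) (level : ∀ b ∈ W, ∀ i j, ht (b i) = ht (b j))
    (down : ∀ b ∈ W, ∀ c, a ≤ c → c ≤ b → (∀ i j, ht (c i) = ht (c j)) → c ∈ W)
    (hlev : ∀ i j, ht (a i) = ht (a j))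
    (hne : ∀ β < ω₁, (∀ i, ht (a i) ≤ β) → ∃ b ∈ W, ∀ i, ht (b i) = β) :
    ∃ V ⊆ W, IsPruned a V := by
  have hcap : ∀ {β : Ordinal.{u}} {b c : Fin m → T}, b ≤ c → (∀ i, ht (b i) ≤ β) →
      (∀ i, β ≤ ht (c i)) → b ≤ (fun i => res β (c i)) := fun hbc h1 h2 i =>
    hT.le_res (hbc i) (h1 i) (h2 i)
  refine ⟨{b ∈ W | ∀ β < ω₁, (∀ i, ht (b i) ≤ β) → ∃ c ∈ W, b ≤ c ∧ ∀ i, ht (c i) = β},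
    fun b hb => hb.1, ⟨?_, ?_⟩, fun b hb => above b hb.1, fun b hb => level b hb.1, ?_, ?_⟩
  · by_cases hm : m = 0
    · subst hm
      obtain ⟨b, hb, -⟩ := hne 0 (Ordinal.omega_pos 1) (fun i => i.elim0)
      rwa [Subsingleton.elim a b]
    · have i0 : Fin m := ⟨0, Nat.pos_of_ne_zero hm⟩
      obtain ⟨b, hb, hb'⟩ := hne (ht (a i0)) (hT.ht_lt _) (fun i => (hlev _ _).le)
      exact down b hb a le_rfl (above b hb) hlev
  · intro β hβ h
    obtain ⟨c, hc, hcβ⟩ := hne β hβ h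
    exact ⟨c, hc, above c hc, hcβ⟩
  · rintro b ⟨hb, hbe⟩ c hac hcb hc
    refine ⟨down b hb c hac hcb hc, fun β hβ h => ?_⟩
    obtain ⟨γ, hγ, hγb⟩ := exists_lt_omega1_forall_lt (fun i => ht (b i)) fun i => hT.ht_lt _
    obtain ⟨d, hd, hbd, hdβ⟩ := hbe (max β γ) (max_lt hβ hγ) fun i =>
      (hγb i).le.trans (le_max_right _ _)
    have hle : ∀ i, β ≤ ht (d i) := fun i => (le_max_left _ _).trans (hdβ i).ge
    have h1 := hcap (hcb.trans hbd) h hle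
    refine ⟨_, down d hd _ (hac.trans h1) (fun i => res_le _ _) fun i j => ?_, h1, fun i =>
      ht_res (hle i)⟩
    rw [ht_res (hle i), ht_res (hle j)]
  · rintro b ⟨hb, hbe⟩ β hβ h
    by_contra! hcon
    let L : Set (Fin m → T) := {c | c ∈ W ∧ b ≤ c ∧ ∀ i, ht (c i) = β}
    have hL : L.Countable := (hT.countable_tuples m β).mono fun c hc => hc.2.2
    have hbad : ∀ c : L, ∃ ε < ω₁, β ≤ ε ∧ ∀ d ∈ W, c.1 ≤ d → ¬ ∀ i, ht (d i) = ε := by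
      rintro ⟨c, hc, hbc, hcβ⟩
      by_contra! hcon'
      obtain ⟨i, hi⟩ := hcon c ⟨hc, fun ε hε hcε => by
        by_cases hm : m = 0
        · subst hm
          exact ⟨c, hc, le_rfl, fun i => i.elim0⟩
        · exact hcon' ε hε ((hcβ ⟨0, Nat.pos_of_ne_zero hm⟩).ge.trans (hcε _))⟩ hbc
      exact hi (hcβ i)
    choose ε hε hβε hbad using hbad
    have := hL.to_subtype
    obtain ⟨ζ, hζ, hεζ⟩ := exists_lt_omega1_forall_lt ε hε
    obtain ⟨d, hd, hbd, hdζ⟩ := hbe (max β ζ) (max_lt hβ hζ) fun i =>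
      (h i).trans (le_max_left _ _)
    have hle : ∀ i, β ≤ ht (d i) := fun i => (le_max_left _ _).trans (hdζ i).ge
    have h1 := hcap hbd h hle
    let c : L := ⟨_, down d hd (fun i => res β (d i)) ((above b hb).trans h1)
      (fun i => res_le _ _) (fun i j => by rw [ht_res (hle i), ht_res (hle j)]), h1,
      fun i => ht_res (hle i)⟩
    have hle' : ∀ i, ε c ≤ ht (d i) := fun i =>
      (hεζ c).le.trans ((le_max_right _ _).trans (hdζ i).ge)
    have h2 : c.1 ≤ fun i => res (ε c) (d i) :=
      hcap (fun i => res_le _ _) (fun i => (ht_res (hle i)).le.trans (hβε c)) hle'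
    refine hbad c _ (down d hd (fun i => res (ε c) (d i)) (((above b hb).trans h1).trans h2)
      (fun i => res_le _ _) fun i j => ?_) h2 fun i => ht_res (hle' i)
    rw [ht_res (hle' i), ht_res (hle' j)]

namespace IsPruned

variable {m : ℕ} {a : Fin m → T} {W : Set (Fin m → T)}

/-- If all extensions of `b` in `W` agreed at coordinate `i` on each level, these entries would form
a chain reaching every countable level, which an Aronszajn tree does not have. -/
theorem exists_split_at (h : IsPruned a W) (hA : IsAronszajn T) {b : Fin m → T} (hb : b ∈ W)
    (i : Fin m) : ∃ c ∈ W, ∃ d ∈ W, b ≤ c ∧ b ≤ d ∧ (∀ j k, ht (c j) = ht (d k)) ∧ c i ≠ d i := by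
  have hT := hA.toIsOmega1Tree
  by_contra! hcon
  let B : Set T := {x | ∃ c ∈ W, b ≤ c ∧ c i = x}
  have key : ∀ c ∈ W, ∀ d ∈ W, b ≤ c → b ≤ d → ht (c i) ≤ ht (d i) → c i ≤ d i := by
    intro c hc d hd hbc hbd hcd
    obtain ⟨e, he, hce, het⟩ := h.extend c hc (ht (d i)) (hT.ht_lt _) fun j =>
      (h.level c hc j i).le.trans hcd
    rw [← hcon e he d hd (hbc.trans hce) hbd fun j k => (het j).trans (h.level d hd i k)]
    exact hce i
  have hchain : IsChain (· ≤ ·) B := by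
    rintro _ ⟨c, hc, hbc, rfl⟩ _ ⟨d, hd, hbd, rfl⟩ -
    rcases le_total (ht (c i)) (ht (d i)) with hle | hle
    · exact Or.inl (key c hc d hd hbc hbd hle)
    · exact Or.inr (key d hd c hc hbd hbc hle)
  have := (hA.chain_countable B hchain).to_subtype
  obtain ⟨β, hβ, hlt⟩ := exists_lt_omega1_forall_lt (fun x : B => ht x.1) fun x => hT.ht_lt _
  have hbB : b i ∈ B := ⟨b, hb, le_rfl, rfl⟩
  obtain ⟨c, hc, hbc, hcβ⟩ := h.extend b hb β hβ fun j =>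
    (h.level b hb j i).le.trans (hlt ⟨_, hbB⟩).le
  exact (hlt ⟨c i, c, hc, hbc, rfl⟩).ne (hcβ i)

/-- Coordinates are separated one at a time. Split `c` at `i` into `e` and `f`; an extension `g` of
`d` to the same level differs at `i` from at least one of them, and earlier separations persist
upwards. -/
theorem exists_split (h : IsPruned a W) (hA : IsAronszajn T) {b : Fin m → T} (hb : b ∈ W) :
    ∃ c ∈ W, ∃ d ∈ W, b ≤ c ∧ b ≤ d ∧ (∀ j k, ht (c j) = ht (d k)) ∧ ∀ i, c i ≠ d i := by
  have hT := hA.toIsOmega1Tree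
  suffices H : ∀ s : Finset (Fin m), ∃ c ∈ W, ∃ d ∈ W, b ≤ c ∧ b ≤ d ∧
      (∀ j k, ht (c j) = ht (d k)) ∧ ∀ i ∈ s, c i ≠ d i by
    obtain ⟨c, hc, d, hd, h1, h2, h3, h4⟩ := H Finset.univ
    exact ⟨c, hc, d, hd, h1, h2, h3, fun i => h4 i (Finset.mem_univ i)⟩
  intro s
  induction s using Finset.induction_on with
  | empty => exact ⟨b, hb, b, hb, le_rfl, le_rfl, h.level b hb, by simp⟩
  | insert i s _ ih =>
    obtain ⟨c, hc, d, hd, hbc, hbd, hcd, hne⟩ := ih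
    obtain ⟨e, he, f, hf, hce, hcf, hef, hi⟩ := h.exists_split_at hA hc i
    obtain ⟨g, hg, hdg, hgt⟩ := h.extend d hd (ht (e i)) (hT.ht_lt _) fun j => by
      rw [← hcd i j]; exact ht_le_ht (hce i)
    have hstep : ∀ e', c ≤ e' → ∀ j ∈ s, e' j ≠ g j := fun e' he' j hj hj' =>
      hne j hj (hT.eq_of_ht_eq (he' j) (hj' ▸ hdg j) (hcd j j))
    by_cases hgi : e i = g i
    · refine ⟨f, hf, g, hg, hbc.trans hcf, hbd.trans hdg, fun j k => ?_, fun j hj => ?_⟩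
      · rw [hgt, hef i j]
      · rcases Finset.mem_insert.1 hj with rfl | hj
        · rw [← hgi]; exact hi.symm
        · exact hstep f hcf j hj
    · refine ⟨e, he, g, hg, hbc.trans hce, hbd.trans hdg, fun j k => ?_, fun j hj => ?_⟩
      · rw [hgt]; exact h.level e he j i
      · rcases Finset.mem_insert.1 hj with rfl | hj
        · exact hgi
        · exact hstep e hce j hj

/-- The cones above distinct entries of `a` are disjoint, so tuples of `W` can only meet in equal
coordinates. -/
theorem index_eq (h : IsPruned a W) (hT : IsOmega1Tree T) (ha : Function.Injective a)
    {b c : Fin m → T} (hb : b ∈ W) (hc : c ∈ W) {x : T} {i j : Fin m} (hx : ht (a i) ≤ ht x)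
    (hxb : x ≤ b i) (hxc : x ≤ c j) : i = j := by
  have hl := h.level a h.mem
  refine ha (hT.eq_of_ht_eq (x := x) ?_ ?_ (hl i j))
  · exact hT.le_of_ht_le (h.above b hb i) hxb hx
  · exact hT.le_of_ht_le (h.above c hc j) hxc ((hl j i).le.trans hx)

/-- Infinitely many pairwise disjoint tuples on some level of a pruned set, whose downwards closure
has at most two immediate successors at each node. -/
theorem exists_spread (h : IsPruned a W) (hA : IsAronszajn T) (hm : 0 < m)
    (ha : Function.Injective a) :
    ∃ β < ω₁, (∀ i, ht (a i) < β) ∧ ∃ D : ℕ → Fin m → T, (∀ k, D k ∈ W ∧ ∀ i, ht (D k i) = β) ∧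
      (∀ k l, k ≠ l → ∀ i j, D k i ≠ D l j) ∧
      ∀ x, (∀ i, ht (a i) ≤ ht x) → {y ∈ Imm x | ∃ k i, y ≤ D k i}.encard ≤ 2 := by
  have hT := hA.toIsOmega1Tree
  choose f hf g hg hbf hbg hfg hne using fun b : W => h.exists_split hA b.2
  -- A comb: `B` is the spine, `E k` is the tooth that leaves it after `B k`, and `D k` prolongs
  -- this tooth to the common level `β`.
  let B : ℕ → W := fun k => Nat.rec ⟨a, h.mem⟩ (fun _ b => ⟨f b, hf b⟩) k
  let E : ℕ → Fin m → T := fun k => g (B k)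
  have hBmono : Monotone B := monotone_nat_of_le_succ fun k => hbf (B k)
  have hBE : ∀ k, (B k).1 ≤ E k := fun k => hbg (B k)
  have hEB : ∀ k i j, ht (E k i) = ht ((B (k + 1)).1 j) := fun k i j => (hfg (B k) j i).symm
  have hEBne : ∀ k i, E k i ≠ (B (k + 1)).1 i := fun k i => (hne (B k) i).symm
  let i0 : Fin m := ⟨0, hm⟩
  obtain ⟨β, hβ, hEβ⟩ := exists_lt_omega1_forall_lt (fun k => ht (E k i0)) fun k => hT.ht_lt _
  have hEW : ∀ k, E k ∈ W := fun k => hg (B k)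
  choose D hD hED hDβ using fun k => h.extend (E k) (hEW k) β hβ fun i =>
    (h.level _ (hEW k) i i0).le.trans (hEβ k).le
  have hBD : ∀ k l, k < l → (B (k + 1)).1 ≤ D l := fun k l hkl =>
    (show (B (k + 1)).1 ≤ (B l).1 from hBmono hkl).trans ((hBE l).trans (hED l))
  have hdisj : ∀ k l, k < l → ∀ i, D k i ≠ D l i := by
    intro k l hkl i he
    exact hEBne k i (hT.eq_of_ht_eq (hED k i) (he ▸ hBD k l hkl i) (hEB k i i))
  refine ⟨β, hβ, fun i => ?_, D, fun k => ⟨hD k, hDβ k⟩, fun k l hkl i j he => ?_, fun x hx => ?_⟩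
  · rw [h.level a h.mem i i0]
    exact (ht_le_ht (h.above _ (hEW 0) i0)).trans_lt (hEβ 0)
  · have hle := h.above _ (hD k) i
    obtain rfl : i = j := h.index_eq hT ha (hD k) (hD l) (ht_le_ht hle) le_rfl he.le
    rcases hkl.lt_or_gt with hkl | hkl
    · exact hdisj k l hkl i he
    · exact hdisj l k hkl i he.symm
  · by_cases hex : ∃ k, ∃ i, x < D k i
    swap
    · refine (Set.encard_eq_zero.2 (Set.eq_empty_iff_forall_notMem.2 ?_)).trans_le zero_le
      rintro y ⟨hy, k, i, hyk⟩
      exact hex ⟨k, i, hy.lt.trans_le hyk⟩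
    classical
    -- Let `D k` be the first tooth through `x`. All later teeth through `x` follow the spine up to
    -- `B (k + 1)`, which has not yet been reached at `x`; so a successor points either towards `D
    -- k` or towards `B (k + 1)`.
    obtain ⟨i, hi⟩ := Nat.find_spec hex
    set k := Nat.find hex
    refine (Set.encard_le_encard (t := {res (Order.succ (ht x)) (D k i),
      res (Order.succ (ht x)) ((B (k + 1)).1 i)}) ?_).trans
      ((Set.encard_insert_le _ _).trans (by rw [Set.encard_singleton]; rfl))
    rintro y ⟨hy, l, j, hyl⟩
    have hxl := hy.lt.trans_le hyl
    obtain rfl : i = j := h.index_eq hT ha (hD k) (hD l) (hx i) hi.le hxl.le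
    have hyt := hT.ht_covBy hy
    rcases (Nat.find_min' hex ⟨i, hxl⟩).eq_or_lt with he | hlt
    · left
      change y = res (Order.succ (ht x)) (D (Nat.find hex) i)
      rw [he]
      exact (hT.res_eq hyl hyt).symm
    · right
      have hBl := hBD k l hlt i
      refine (hT.res_eq (hT.le_of_ht_le hyl hBl ?_) hyt).symm
      rw [hyt, Order.succ_le_iff]
      by_contra hge
      rw [not_lt] at hge
      have h1 : (B (k + 1)).1 i ≤ x := hT.le_of_ht_le hBl hxl.le hge
      exact hEBne k i (hT.eq_of_ht_eq (hED k i) (h1.trans hi.le) (hEB k i i))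

end IsPruned

/-- The traces of a finite set miss one of the disjoint tuples entirely, and then every extension of
that tuple misses the set. -/
theorem IsPruned.well_distributed {m : ℕ} {a : Fin m → T} {W : Set (Fin m → T)}
    (h : IsPruned a W) (hT : IsOmega1Tree T) {β : Ordinal.{u}} {D : ℕ → Fin m → T}
    (hDW : ∀ k, D k ∈ W ∧ ∀ i, ht (D k i) = β) (hD : ∀ k l, k ≠ l → ∀ i j, D k i ≠ D l j)
    {δ : Ordinal.{u}} (hβδ : β ≤ δ) (hδ : δ < ω₁) {t : Set T} (htf : t.Finite) :
    ∃ b ∈ W, (∀ i, ht (b i) = δ) ∧ ∀ i, b i ∉ t := by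
  obtain ⟨k, hk⟩ := exists_forall_notMem_of_disjoint hD (htf.image (res β))
  obtain ⟨b, hb, hDb, hbt⟩ := h.extend _ (hDW k).1 δ hδ fun i => ((hDW k).2 i).le.trans hβδ
  exact ⟨b, hb, hbt, fun i hi => hk i ⟨b i, hi, hT.res_eq (hDb i) ((hDW k).2 i)⟩⟩

open Classical in
/-- The generalized promise given by a pruned set. -/
noncomputable def GenPromise.ofPruned (hT : IsOmega1Tree T) {m : ℕ} (hm : 0 < m) {a : Fin m → T}
    (ha : Function.Injective a) {W : Set (Fin m → T)} (h : IsPruned a W) {β : Ordinal.{u}}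
    (hβ : β < ω₁) {D : ℕ → Fin m → T} (hDW : ∀ k, D k ∈ W ∧ ∀ i, ht (D k i) = β)
    (hD : ∀ k l, k ≠ l → ∀ i j, D k i ≠ D l j) : GenPromise T where
  dim := m
  dim_pos := hm
  base := β
  base_lt := hβ
  val δ := if δ ∈ Set.Ico β ω₁ then {{b ∈ W | ∀ i, ht (b i) = δ}} else ∅
  val_eq_empty δ hδ := if_neg hδ
  exists_derived := by
    refine ⟨a, ha, h.level a h.mem, fun δ hδ Y hY => ?_⟩
    rw [if_pos hδ, Set.mem_singleton_iff] at hY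
    subst hY
    refine ⟨fun hfin => ?_, (hT.countable_tuples m δ).mono fun b hb => hb.2, fun b hb =>
      ⟨⟨h.above b hb.1, h.level b hb.1⟩, hb.2⟩⟩
    obtain ⟨b, hb, hbδ, hbt⟩ := h.well_distributed hT hDW hD hδ.1 hδ.2
      (hfin.image fun b => b ⟨0, hm⟩)
    exact hbt ⟨0, hm⟩ ⟨b, ⟨hb, hbδ⟩, rfl⟩
  nonempty δ hδ := by
    rw [if_pos hδ]; exact Set.singleton_nonempty _
  countable δ hδ := by
    rw [if_pos hδ]; exact Set.countable_singleton _
  well_distributed δ hδ Y hY t _ := by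
    rw [if_pos hδ, Set.mem_singleton_iff] at hY
    subst hY
    obtain ⟨b, hb, hbδ, hbt⟩ := h.well_distributed hT hDW hD hδ.1 hδ.2 t.finite_toSet
    exact ⟨b, ⟨hb, hbδ⟩, hbt⟩
  restrict_mem α δ hβα hαδ hδ Y hY := by
    rw [if_pos ⟨hβα.trans hαδ.le, hδ⟩, Set.mem_singleton_iff] at hY
    subst hY
    rw [if_pos ⟨hβα, hαδ.trans hδ⟩, Set.mem_singleton_iff]
    ext b
    constructor
    · rintro ⟨hbα, c, ⟨hc, hcδ⟩, hbc⟩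
      have hab : a ≤ b := fun i => hT.le_of_ht_le (h.above c hc i) (hbc i) (by
        rw [hbα]
        exact ((ht_le_ht (h.above _ (hDW 0).1 i)).trans_eq ((hDW 0).2 i)).trans hβα)
      exact ⟨h.down c hc b hab hbc fun i j => by rw [hbα, hbα], hbα⟩
    · rintro ⟨hb, hbα⟩
      obtain ⟨c, hc, hbc, hcδ⟩ := h.extend b hb δ hδ fun i => (hbα i).le.trans hαδ.le
      exact ⟨hbα, c, ⟨hc, hcδ⟩, hbc⟩

theorem GenPromise.mem_val_ofPruned (hT : IsOmega1Tree T) {m : ℕ} (hm : 0 < m) {a : Fin m → T}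
    (ha : Function.Injective a) {W : Set (Fin m → T)} (h : IsPruned a W) {β : Ordinal.{u}}
    (hβ : β < ω₁) {D : ℕ → Fin m → T} (hDW : ∀ k, D k ∈ W ∧ ∀ i, ht (D k i) = β)
    (hD : ∀ k l, k ≠ l → ∀ i j, D k i ≠ D l j) {δ : Ordinal.{u}} (hδ : δ ∈ Set.Ico β ω₁)
    {Y : Set (Fin m → T)} :
    Y ∈ (GenPromise.ofPruned hT hm ha h hβ hDW hD).val δ ↔ Y = {b ∈ W | ∀ i, ht (b i) = δ} := by
  change Y ∈ (if δ ∈ Set.Ico β ω₁ then ({{b ∈ W | ∀ i, ht (b i) = δ}} : Set (Set (Fin m → T)))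
    else ∅) ↔ _
  rw [if_pos hδ, Set.mem_singleton_iff]

/-- The central density argument: a tuple of `p` on its top level cannot have, on every countable
level, extensions that are avoided by all conditions of a dense set below `p`. -/
theorem Condition.exists_level_of_dense (hA : IsAronszajn T) (hn : IsNormal T) {S : Set ℕ} {n : ℕ}
    (hnS : n ∈ S) (hn2 : 2 ≤ n) (hImm : ∀ x : T, (n : ℕ∞) ≤ (Imm x).encard)
    (p : Condition T S) {D : Set (Condition T S)} (hD : IsDense D) {ζ : Ordinal.{u}} (hζ : ζ < ω₁)
    {m : ℕ} (hm : 0 < m) {a : Fin m → T} (ha : Function.Injective a)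
    (hap : ∀ i, a i ∈ p.F.one ∧ ht (a i) = p.F.top) :
    ∃ β < ω₁, p.F.top ≤ β ∧ ∀ b, a ≤ b → (∀ i, ht (b i) = β) →
      ∃ q ∈ D, q ≤ p ∧ ζ ≤ q.F.top ∧ q.F.top < β ∧ ∀ i, res q.F.top (b i) ∈ q.F.one := by
  have hT := hA.toIsOmega1Tree
  by_contra! hcon
  -- The uncaught tuples. Only conditions with top level strictly below the tuple are tested, which
  -- makes the set downwards closed.
  let W : Set (Fin m → T) := {b | a ≤ b ∧ (∀ i j, ht (b i) = ht (b j)) ∧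
    ∀ q ∈ D, q ≤ p → ζ ≤ q.F.top → (∀ i, q.F.top < ht (b i)) → ∃ i, res q.F.top (b i) ∉ q.F.one}
  obtain ⟨V, hVW, hV⟩ : ∃ V ⊆ W, IsPruned a V := by
    refine exists_isPruned hT (fun b hb => hb.1) (fun b hb => hb.2.1) ?_
      (fun i j => by rw [(hap i).2, (hap j).2]) fun β hβ haβ => ?_
    · rintro b ⟨hab, hb, hbq⟩ c hac hcb hc
      refine ⟨hac, hc, fun q hq hqp hζq hqc => ?_⟩
      obtain ⟨i, hi⟩ := hbq q hq hqp hζq fun i => (hqc i).trans_le (ht_le_ht (hcb i))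
      exact ⟨i, by rwa [← hT.res_mono (hcb i) (hqc i).le]⟩
    · obtain ⟨b, hab, hbβ, hb⟩ := hcon β hβ ((hap ⟨0, hm⟩).2 ▸ haβ _)
      refine ⟨b, ⟨hab, fun i j => by rw [hbβ, hbβ], fun q hq hqp hζq hqb => ?_⟩, hbβ⟩
      exact hb q hq hqp hζq ((hqb ⟨0, hm⟩).trans_eq (hbβ _))
  obtain ⟨β, hβ, haβ, E, hE, hEd, hE2⟩ := hV.exists_spread hA hm ha
  have hpβ : p.F.top < β := (hap ⟨0, hm⟩).2 ▸ haβ ⟨0, hm⟩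
  have hresE : ∀ k i, res p.F.top (E k i) = a i := fun k i =>
    hT.res_eq (hV.above _ (hE k).1 i) (hap i).2
  -- All tuples `E k` have trace `a` on the top level of `p`, so infinitely many points are added
  -- over a finite set of traces.
  obtain ⟨p₁, hp₁, hp₁β, hp₁Γ, hp₁E⟩ := p.exists_extension hT hn hnS hn2 hImm hpβ hβ
    {y | ∃ k i, y = E k i} (by
      rintro _ ⟨k, i, rfl⟩
      rw [hresE]
      exact ⟨(hE k).2 i, (hap i).1⟩) ((Set.finite_range a).subset (by
      rintro _ ⟨_, ⟨k, i, rfl⟩, rfl⟩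
      exact ⟨i, (hresE k i).symm⟩)) (by
      intro x hx hxβ
      refine (Set.encard_le_encard ?_).trans (hE2 x fun i => (hap i).2.le.trans hx)
      rintro y ⟨hy, _, ⟨k, i, rfl⟩, hyk⟩
      exact ⟨hy, k, i, hyk⟩)
  -- The disjoint tuples `E k` are what makes `p₁` fulfill the promise given by `V`.
  let U := GenPromise.ofPruned hT hm ha hV hβ hE hEd
  let p₂ : Condition T S := ⟨p₁.F, p₁.splitting, insert U p₁.Γ, p₁.countable.insert U, by
    rintro V (rfl | hV)
    · exact hp₁β.ge
    · exact p₁.base_le V hV, by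
    rintro V' (rfl | hV')
    · intro t _ Y hY
      rw [hp₁β] at hY
      obtain rfl := (GenPromise.mem_val_ofPruned hT hm ha hV hβ hE hEd ⟨le_rfl, hβ⟩).1 hY
      obtain ⟨k, hk⟩ := exists_forall_notMem_of_disjoint hEd t.finite_toSet
      exact ⟨E k, hE k, fun i => ⟨hk i, hp₁E ⟨k, i, rfl⟩⟩⟩
    · exact p₁.fulfills V' hV'⟩
  have hp₂ : p₂ ≤ p := ⟨hp₁.1, hp₁.2.trans (Set.subset_insert _ _)⟩
  obtain ⟨p₃, hp₃, hζ₃⟩ : ∃ p₃ ≤ p₂, ζ ≤ p₃.F.top := by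
    by_cases hlt : p₂.F.top < ζ
    · obtain ⟨q, hq, hqt, -⟩ := p₂.exists_extension hT hn hnS hn2 hImm hlt hζ ∅ (by simp) (by simp)
        (by simp)
      exact ⟨q, hq, hqt.ge⟩
    · exact ⟨p₂, le_rfl, not_lt.1 hlt⟩
  obtain ⟨q, hqD, hq⟩ := hD p₃
  have hUq : U ∈ q.Γ := hq.2 (hp₃.2 (Set.mem_insert _ _))
  have hmem : q.F.top ∈ Set.Ico β ω₁ := ⟨q.base_le U hUq, q.F.top_lt⟩
  obtain ⟨c, hc, hcq⟩ := q.fulfills U hUq ∅ (by simp) {b ∈ V | ∀ i, ht (b i) = q.F.top}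
    ((GenPromise.mem_val_ofPruned hT hm ha hV hβ hE hEd hmem).2 rfl)
  -- One level above the top of `q`, since being uncaught says nothing about conditions whose top
  -- level is that of the tuple.
  obtain ⟨b, hb, hcb, hbt⟩ := hV.extend c hc.1 _ (succ_lt_omega1 q.F.top_lt) fun i =>
    (hc.2 i).le.trans (Order.le_succ _)
  obtain ⟨i, hi⟩ := (hVW hb).2.2 q hqD (hq.trans (hp₃.trans hp₂)) (hζ₃.trans hq.1.1) fun i => by
    rw [hbt]; exact Order.lt_succ _
  rw [hT.res_eq (hcb i) (hc.2 i)] at hi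
  exact hi (hcq i).2

end Pruning

/-! ### Sets of hereditary cardinality less than `κ`. -/

section HereditaryCardinality

variable {κ : Cardinal.{u}} {x y : ZFSet.{u}}

theorem HeredCardLT.mono {κ' : Cardinal.{u}} (h : HeredCardLT κ x) (hκ : κ ≤ κ') :
    HeredCardLT κ' x :=
  lt_of_lt_of_le h (Cardinal.lift_le.2 hκ)

theorem HeredCardLT.mem (h : HeredCardLT κ x) (hy : y ∈ x) : HeredCardLT κ y :=
  lt_of_le_of_lt (Cardinal.mk_subtype_mono fun _ ht => Relation.TransGen.tail ht hy) h

theorem HeredCardLT.card_lt (h : HeredCardLT κ x) :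
    #{y : ZFSet.{u} // y ∈ x} < Cardinal.lift.{u + 1} κ :=
  lt_of_le_of_lt (Cardinal.mk_subtype_mono fun _ ht =>
    Relation.TransGen.single (r := fun a b : ZFSet.{u} => a ∈ b) ht) h

/-- The transitive closure consists of the members and their transitive closures: by regularity,
fewer than `κ` sets of size less than `κ` have a small union. -/
theorem HeredCardLT.of_forall (hκ : κ.IsRegular) (hx : ∀ y ∈ x, HeredCardLT κ y)
    (hc : #{y : ZFSet.{u} // y ∈ x} < Cardinal.lift.{u + 1} κ) : HeredCardLT κ x := by
  have hκ' : (Cardinal.lift.{u + 1} κ).IsRegular := hκ.lift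
  have hsub : {t : ZFSet.{u} | Relation.TransGen (· ∈ ·) t x} ⊆
      {y | y ∈ x} ∪ ⋃ y : {y : ZFSet.{u} // y ∈ x}, {t | Relation.TransGen (· ∈ ·) t y.1} := by
    intro t ht
    cases ht with
    | single h => exact Or.inl h
    | tail h1 h2 => exact Or.inr (Set.mem_iUnion.2 ⟨⟨_, h2⟩, h1⟩)
  refine (Cardinal.mk_le_mk_of_subset hsub).trans_lt ((Cardinal.mk_union_le _ _).trans_lt ?_)
  refine Cardinal.add_lt_of_lt hκ'.aleph0_le hc ?_
  exact (Cardinal.card_iUnion_lt_iff_forall_of_isRegular hκ' hc).2 fun y => hx y.1 y.2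

theorem HeredCardLT.of_countable (hκ : κ.IsRegular) (hκ' : ℵ₀ < κ)
    (hx : ∀ y ∈ x, HeredCardLT κ y) (hc : {y | y ∈ x}.Countable) : HeredCardLT κ x :=
  .of_forall hκ hx (hc.le_aleph0.trans_lt (by rwa [Cardinal.aleph0_lt_lift]))

theorem HeredCardLT.of_subset (hκ : κ.IsRegular) (h : HeredCardLT κ x) (hyx : y ⊆ x) :
    HeredCardLT κ y :=
  .of_forall hκ (fun _ hz => h.mem (hyx hz))
    ((Cardinal.mk_subtype_mono fun _ hz => hyx hz).trans_lt h.card_lt)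

theorem HeredCardLT.upair (hκ : κ.IsRegular) (hx : HeredCardLT κ x) (hy : HeredCardLT κ y) :
    HeredCardLT κ {x, y} := by
  refine .of_forall hκ (fun z hz => ?_) ?_
  · rcases ZFSet.mem_pair.1 hz with rfl | rfl
    · exact hx
    · exact hy
  · have hfin : {z : ZFSet.{u} | z ∈ ({x, y} : ZFSet.{u})}.Finite := by
      refine (Set.toFinite ({x, y} : Set ZFSet.{u})).subset fun z hz => ?_
      simpa using hz
    exact hfin.lt_aleph0.trans_le hκ.lift.aleph0_le

theorem HeredCardLT.pair (hκ : κ.IsRegular) (hx : HeredCardLT κ x) (hy : HeredCardLT κ y) :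
    HeredCardLT κ (ZFSet.pair x y) := by
  refine .upair hκ ?_ (.upair hκ hx hy)
  rw [← ZFSet.pair_eq_singleton]
  exact .upair hκ hx hx

theorem HeredCardLT.range (hκ : κ.IsRegular) {Q : Type v} [Small.{u} Q] (f : Q → ZFSet.{u})
    (hf : ∀ q, HeredCardLT κ (f q)) (hQ : #(Shrink.{u} Q) < κ) :
    HeredCardLT κ (ZFSet.range f) := by
  refine .of_forall hκ (fun y hy => ?_) ?_
  · obtain ⟨q, rfl⟩ := ZFSet.mem_range.1 hy
    exact hf q
  · have hs : Function.Surjective (fun s : Shrink.{u} Q => (⟨f ((equivShrink Q).symm s),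
        ZFSet.mem_range_self _⟩ : {y : ZFSet.{u} // y ∈ ZFSet.range f})) := by
      rintro ⟨y, hy⟩
      obtain ⟨q, rfl⟩ := ZFSet.mem_range.1 hy
      exact ⟨equivShrink Q q, by simp⟩
    have := Cardinal.mk_le_of_surjective (hs.comp (Equiv.ulift.{u + 1}).surjective)
    rw [Cardinal.mk_uLift] at this
    exact this.trans_lt (Cardinal.lift_lt.2 hQ)

theorem heredCardLT_toZFSet (hκ : κ.IsRegular) (hκ' : ℵ₀ < κ) (α : Ordinal.{u}) (hα : α < ω₁) :
    HeredCardLT κ (Ordinal.toZFSet α) := by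
  induction α using WellFoundedLT.induction with
  | _ α ih =>
    refine .of_countable hκ hκ' (fun y hy => ?_) ?_
    · obtain ⟨β, hβ, rfl⟩ := Ordinal.mem_toZFSet_iff.1 hy
      exact ih β hβ (hβ.trans hα)
    · refine ((countable_Iio_of_lt_omega1 hα).image Ordinal.toZFSet).mono fun y hy => ?_
      exact Ordinal.mem_toZFSet_iff.1 hy

theorem small_transGen_mem (x : ZFSet.{u}) :
    Small.{u} {t : ZFSet.{u} | Relation.TransGen (· ∈ ·) t x} := by
  induction x using ZFSet.inductionOn with
  | _ x ih =>
    have hsub : {t : ZFSet.{u} | Relation.TransGen (· ∈ ·) t x} ⊆ {y | y ∈ x} ∪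
        ⋃ y : {y : ZFSet.{u} // y ∈ x}, {t | Relation.TransGen (· ∈ ·) t y.1} := by
      intro t ht
      cases ht with
      | single h => exact Or.inl h
      | tail h1 h2 => exact Or.inr (Set.mem_iUnion.2 ⟨⟨_, h2⟩, h1⟩)
    have h1 : Small.{u} {y : ZFSet.{u} | y ∈ x} := ZFSet.small_coe x
    have h2 : Small.{u} {y : ZFSet.{u} // y ∈ x} := h1
    have h3 : ∀ y : {y : ZFSet.{u} // y ∈ x},
        Small.{u} {t : ZFSet.{u} | Relation.TransGen (· ∈ ·) t y.1} := fun y => ih y.1 y.2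
    exact small_subset hsub

theorem exists_heredCardLT (x : ZFSet.{u}) : ∃ μ : Cardinal.{u}, HeredCardLT μ x := by
  have := small_transGen_mem x
  refine ⟨Order.succ #(Shrink.{u} {t : ZFSet.{u} | Relation.TransGen (· ∈ ·) t x}), ?_⟩
  have h := Cardinal.lift_mk_shrink' {t : ZFSet.{u} | Relation.TransGen (· ∈ ·) t x}
  change #{t : ZFSet.{u} | Relation.TransGen (· ∈ ·) t x} < _
  rw [Cardinal.lift_id'.{u, u + 1}] at h
  rw [← h]
  exact Cardinal.lift_lt.2 (Order.lt_succ _)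

end HereditaryCardinality

/-! ### First-order definability in `H(κ)`. -/

section Definability

open FirstOrder Language

variable {κ : Cardinal.{u}} {α β : Type}

/-- The underlying set of an element of `H(κ)`. -/
def H.set (x : H κ) : ZFSet.{u} := x.1

theorem H.prop (x : H κ) : HeredCardLT κ x.set := x.2

/-- A set of hereditary cardinality less than `κ`, as an element of `H(κ)`. -/
def H.mk (x : ZFSet.{u}) (hx : HeredCardLT κ x) : H κ := ⟨x, hx⟩

@[simp] theorem H.set_mk (x : ZFSet.{u}) (hx : HeredCardLT κ x) : (H.mk x hx).set = x := rfl

theorem H.set_inj {x y : H κ} : x.set = y.set ↔ x = y := Subtype.ext_iff.symm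

theorem H.exists_set_eq {x : H κ} {t : ZFSet.{u}} (ht : t ∈ x.set) : ∃ y : H κ, y.set = t :=
  ⟨H.mk t (x.prop.mem ht), rfl⟩

/-- The symbol for membership. -/
def memSymbol : setLanguage.Relations 2 := MemRel.mem

theorem relMap_memSymbol (v : Fin 2 → H κ) :
    Structure.RelMap memSymbol v ↔ (v 0).set ∈ (v 1).set := Iff.rfl

/-- A relation on `H(κ)` which is first-order definable without parameters. -/
def FODef (R : (α → H κ) → Prop) : Prop :=
  ∃ φ : setLanguage.Formula α, ∀ v, φ.Realize v ↔ R v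

/-- A projection to one of the variables. -/
def IsVar (f : (α → H κ) → H κ) : Prop := ∃ i, ∀ v, f v = v i

theorem IsVar.intro (i : α) : IsVar (fun v : α → H κ => v i) := ⟨i, fun _ => rfl⟩

namespace FODef

theorem congr {R R' : (α → H κ) → Prop} (h : FODef R) (hR : ∀ v, R' v ↔ R v) : FODef R' :=
  h.imp fun _ hφ v => (hφ v).trans (hR v).symm

/-- Arguments are projections rather than variable indices, so that these rules apply unchanged
below quantifiers, where variables are reached through `Sum.inl` and `Sum.inr`. -/
theorem mem {f g : (α → H κ) → H κ} (hf : IsVar f) (hg : IsVar g) :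
    FODef fun v => (f v).set ∈ (g v).set := by
  obtain ⟨i, hi⟩ := hf
  obtain ⟨j, hj⟩ := hg
  refine ⟨memSymbol.formula₂ (Term.var i) (Term.var j), fun v => ?_⟩
  rw [Formula.realize_rel₂, relMap_memSymbol]
  simp only [hi, hj]
  rfl

theorem eq {f g : (α → H κ) → H κ} (hf : IsVar f) (hg : IsVar g) :
    FODef fun v => (f v).set = (g v).set := by
  obtain ⟨i, hi⟩ := hf
  obtain ⟨j, hj⟩ := hg
  refine ⟨Term.equal (L := setLanguage) (Term.var i) (Term.var j), fun v => ?_⟩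
  rw [Formula.realize_equal]
  simp only [hi, hj]
  exact H.set_inj.symm

theorem not {R : (α → H κ) → Prop} (h : FODef R) : FODef fun v => ¬ R v := by
  obtain ⟨φ, hφ⟩ := h
  exact ⟨φ.not, fun v => by rw [Formula.realize_not, hφ]⟩

theorem and {R R' : (α → H κ) → Prop} (h : FODef R) (h' : FODef R') :
    FODef fun v => R v ∧ R' v := by
  obtain ⟨φ, hφ⟩ := h
  obtain ⟨ψ, hψ⟩ := h'
  exact ⟨φ ⊓ ψ, fun v => by rw [Formula.realize_inf, hφ, hψ]⟩

theorem or {R R' : (α → H κ) → Prop} (h : FODef R) (h' : FODef R') :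
    FODef fun v => R v ∨ R' v := by
  obtain ⟨φ, hφ⟩ := h
  obtain ⟨ψ, hψ⟩ := h'
  exact ⟨φ ⊔ ψ, fun v => by rw [Formula.realize_sup, hφ, hψ]⟩

theorem imp {R R' : (α → H κ) → Prop} (h : FODef R) (h' : FODef R') :
    FODef fun v => R v → R' v := by
  obtain ⟨φ, hφ⟩ := h
  obtain ⟨ψ, hψ⟩ := h'
  exact ⟨φ.imp ψ, fun v => by rw [Formula.realize_imp, hφ, hψ]⟩

theorem iff {R R' : (α → H κ) → Prop} (h : FODef R) (h' : FODef R') :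
    FODef fun v => (R v ↔ R' v) := by
  obtain ⟨φ, hφ⟩ := h
  obtain ⟨ψ, hψ⟩ := h'
  exact ⟨φ.iff ψ, fun v => by rw [Formula.realize_iff, hφ, hψ]⟩

theorem forall_index {ι : Type} [Finite ι] {R : ι → (α → H κ) → Prop} (h : ∀ i, FODef (R i)) :
    FODef fun v => ∀ i, R i v := by
  choose φ hφ using h
  exact ⟨Formula.iInf φ, fun v => by simp only [Formula.realize_iInf, hφ]⟩

theorem exs [Finite β] {R : (α → H κ) → (β → H κ) → Prop}
    (h : FODef fun w : α ⊕ β → H κ => R (fun i => w (Sum.inl i)) (fun i => w (Sum.inr i))) :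
    FODef fun v => ∃ x, R v x := by
  obtain ⟨φ, hφ⟩ := h
  exact ⟨φ.iExs β, fun v => by simp only [Formula.realize_iExs, hφ]; rfl⟩

theorem alls [Finite β] {R : (α → H κ) → (β → H κ) → Prop}
    (h : FODef fun w : α ⊕ β → H κ => R (fun i => w (Sum.inl i)) (fun i => w (Sum.inr i))) :
    FODef fun v => ∀ x, R v x :=
  (exs (R := fun v x => ¬ R v x) h.not).not.congr fun v => by push Not; rfl

theorem ex {R : (α → H κ) → H κ → Prop}
    (h : FODef fun w : α ⊕ Unit → H κ => R (fun i => w (Sum.inl i)) (w (Sum.inr ()))) :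
    FODef fun v => ∃ x, R v x :=
  (exs (β := Unit) (R := fun v x => R v (x ())) h).congr fun _ =>
    ⟨fun ⟨x, hx⟩ => ⟨fun _ => x, hx⟩, fun ⟨x, hx⟩ => ⟨x (), hx⟩⟩

theorem all {R : (α → H κ) → H κ → Prop}
    (h : FODef fun w : α ⊕ Unit → H κ => R (fun i => w (Sum.inl i)) (w (Sum.inr ()))) :
    FODef fun v => ∀ x, R v x :=
  (alls (β := Unit) (R := fun v x => R v (x ())) h).congr fun _ =>
    ⟨fun hx x => hx (x ()), fun hx x => hx fun _ => x⟩

/-- `H(κ)` is transitive, so extensionality may be tested on elements of `H(κ)`. -/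
theorem upair {f g h : (α → H κ) → H κ} (hf : IsVar f) (hg : IsVar g) (hh : IsVar h) :
    FODef fun v => (h v).set = {(f v).set, (g v).set} := by
  obtain ⟨i, hi⟩ := hf
  obtain ⟨j, hj⟩ := hg
  obtain ⟨k, hk⟩ := hh
  simp only [hi, hj, hk]
  refine (all (R := fun v t => t.set ∈ (v k).set ↔ t.set = (v i).set ∨ t.set = (v j).set)
    ((mem (.intro _) (.intro _)).iff
      ((eq (.intro _) (.intro _)).or (eq (.intro _) (.intro _))))).congr fun v => ?_
  constructor
  · intro h t
    rw [h, ZFSet.mem_pair]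
  · intro h
    ext t
    rw [ZFSet.mem_pair]
    constructor
    · exact fun ht => (h (H.mk t ((v k).prop.mem ht))).1 ht
    · rintro (rfl | rfl)
      · exact (h (v i)).2 (Or.inl rfl)
      · exact (h (v j)).2 (Or.inr rfl)

theorem pair {f g h : (α → H κ) → H κ} (hf : IsVar f) (hg : IsVar g) (hh : IsVar h) :
    FODef fun v => (h v).set = ZFSet.pair (f v).set (g v).set := by
  obtain ⟨i, hi⟩ := hf
  obtain ⟨j, hj⟩ := hg
  obtain ⟨k, hk⟩ := hh
  simp only [hi, hj, hk]
  refine (ex (R := fun v s => ∃ t : H κ, s.set = {(v i).set, (v i).set} ∧ t.set = {(v i).set, (v j).set} ∧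
    (v k).set = {s.set, t.set}) (ex (.and (.upair (.intro _) (.intro _) (.intro _))
      (.and (.upair (.intro _) (.intro _) (.intro _))
        (.upair (.intro _) (.intro _) (.intro _)))))).congr fun v => ?_
  constructor
  · intro h
    have h1 : ({(v i).set} : ZFSet.{u}) ∈ (v k).set := by rw [h]; simp [ZFSet.pair]
    have h2 : ({(v i).set, (v j).set} : ZFSet.{u}) ∈ (v k).set := by rw [h]; simp [ZFSet.pair]
    exact ⟨H.mk _ ((v k).prop.mem h1), H.mk _ ((v k).prop.mem h2), (ZFSet.pair_eq_singleton _).symm, rfl, h⟩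
  · rintro ⟨s, t, hs, ht, h⟩
    rw [h, hs, ht, ZFSet.pair_eq_singleton]
    rfl

theorem pair_mem {f g h : (α → H κ) → H κ} (hf : IsVar f) (hg : IsVar g) (hh : IsVar h) :
    FODef fun v => ZFSet.pair (f v).set (g v).set ∈ (h v).set := by
  obtain ⟨i, hi⟩ := hf
  obtain ⟨j, hj⟩ := hg
  obtain ⟨k, hk⟩ := hh
  simp only [hi, hj, hk]
  refine (ex (R := fun v s => s.set = ZFSet.pair (v i).set (v j).set ∧ s.set ∈ (v k).set)
    (.and (.pair (.intro _) (.intro _) (.intro _)) (.mem (.intro _) (.intro _)))).congr fun v => ?_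
  constructor
  · intro h
    exact ⟨H.mk _ ((v k).prop.mem h), rfl, h⟩
  · rintro ⟨s, hs, h⟩
    rwa [← hs]

end FODef

variable (N : Submodel κ)

/-- The Tarski–Vaught property: an existential statement with parameters in `N` has a witness in
`N`. -/
theorem Submodel.exists_mem {R : (α → H κ) → H κ → Prop}
    (hR : FODef fun w : α ⊕ Unit → H κ => R (fun i => w (Sum.inl i)) (w (Sum.inr ())))
    (v : α → H κ) (hv : ∀ i, v i ∈ N) (h : ∃ x, R v x) : ∃ x ∈ N, R v x := by
  obtain ⟨φ, hφ⟩ := hR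
  let v' : α → N := fun i => ⟨v i, hv i⟩
  have hvv : v = N.subtype ∘ v' := rfl
  have h1 : (φ.iExs Unit).Realize v := by
    rw [Formula.realize_iExs]
    obtain ⟨x, hx⟩ := h
    exact ⟨fun _ => x, (hφ _).2 hx⟩
  rw [hvv, ElementaryEmbedding.map_formula, Formula.realize_iExs] at h1
  obtain ⟨x, hx⟩ := h1
  rw [← ElementaryEmbedding.map_formula N.subtype, hφ] at hx
  exact ⟨(x ()).1, (x ()).2, hx⟩

end Definability

/-! ### Closure properties of elementary submodels. -/

section ElementaryClosure

variable {κ : Cardinal.{u}} {x y : ZFSet.{u}}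

theorem HeredCardLT.of_pair (h : HeredCardLT κ (ZFSet.pair x y)) :
    HeredCardLT κ x ∧ HeredCardLT κ y := by
  have h1 : HeredCardLT κ {x, y} := h.mem (by simp [ZFSet.pair])
  exact ⟨h1.mem (by simp), h1.mem (by simp)⟩

theorem IsVar.inl {α β : Type} {f : (α → H κ) → H κ} (hf : IsVar f) :
    IsVar fun w : α ⊕ β → H κ => f fun i => w (Sum.inl i) := by
  obtain ⟨i, hi⟩ := hf
  exact ⟨Sum.inl i, fun w => hi _⟩

variable (N : Submodel κ)

theorem Submodel.has_iff : N.Has x ↔ ∃ a ∈ N, H.set a = x := by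
  constructor
  · rintro ⟨h, hN⟩
    exact ⟨_, hN, rfl⟩
  · rintro ⟨a, ha, rfl⟩
    exact ⟨a.prop, ha⟩

variable {N}

theorem Submodel.has_set {a : H κ} (ha : a ∈ N) : N.Has a.set := ⟨a.prop, ha⟩

variable (N)

theorem Submodel.exists_mem₁ {R : H κ → H κ → Prop}
    (hR : FODef fun w : Fin 1 ⊕ Unit → H κ => R (w (Sum.inl 0)) (w (Sum.inr ())))
    {a : H κ} (ha : a ∈ N) (h : ∃ x, R a x) : ∃ x ∈ N, R a x :=
  N.exists_mem (R := fun v x => R (v 0) x) hR ![a] (by simpa using ha) h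

theorem Submodel.exists_mem₂ {R : H κ → H κ → H κ → Prop}
    (hR : FODef fun w : Fin 2 ⊕ Unit → H κ =>
      R (w (Sum.inl 0)) (w (Sum.inl 1)) (w (Sum.inr ())))
    {a b : H κ} (ha : a ∈ N) (hb : b ∈ N) (h : ∃ x, R a b x) : ∃ x ∈ N, R a b x :=
  N.exists_mem (R := fun v x => R (v 0) (v 1) x) hR ![a, b]
    (Fin.forall_fin_two.2 ⟨ha, hb⟩) h

theorem Submodel.has_of_pair (h : N.Has (ZFSet.pair x y)) : N.Has x ∧ N.Has y := by
  obtain ⟨a, ha, hxy⟩ := N.has_iff.1 h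
  obtain ⟨hx, hy⟩ := h.1.of_pair
  constructor
  · obtain ⟨x', hx', y', h'⟩ := N.exists_mem₁ (R := fun a x => ∃ y : H κ, a.set = ZFSet.pair x.set y.set)
      (.ex (.pair (.intro _) (.intro _) (.intro _))) ha ⟨H.mk x hx, H.mk y hy, hxy⟩
    rw [hxy, ZFSet.pair_inj] at h'
    rw [h'.1]
    exact N.has_set hx'
  · obtain ⟨y', hy', x', h'⟩ := N.exists_mem₁ (R := fun a y => ∃ x : H κ, a.set = ZFSet.pair x.set y.set)
      (.ex (.pair (.intro _) (.intro _) (.intro _))) ha ⟨H.mk y hy, H.mk x hx, hxy⟩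
    rw [hxy, ZFSet.pair_inj] at h'
    rw [h'.2]
    exact N.has_set hy'

/-- `ω` is a set whose members are exactly the empty set and the successors of its own members. Any
`w ∈ N` with this property serves: by `∈`-induction all its members are definable from members of
`N`, and it contains every natural number. -/
theorem Submodel.exists_omega (hκ : κ.IsRegular) (hκ' : ℵ₀ < κ) :
    ∃ w ∈ N, (∀ n ∈ w.set, N.Has n) ∧ ∀ k : ℕ, Ordinal.toZFSet (k : Ordinal.{u}) ∈ w.set := by
  let P : H κ → Prop := fun w => ∀ n : H κ, n.set ∈ w.set ↔
    (∀ t : H κ, t.set ∉ n.set) ∨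
      ∃ k : H κ, k.set ∈ w.set ∧ ∀ t : H κ, t.set ∈ n.set ↔ t.set ∈ k.set ∨ t.set = k.set
  have hsucc : ∀ n k : H κ, (∀ t : H κ, t.set ∈ n.set ↔ t.set ∈ k.set ∨ t.set = k.set) ↔
      n.set = insert k.set k.set := by
    intro n k
    constructor
    · intro h
      ext t
      rw [ZFSet.mem_insert_iff]
      constructor
      · intro ht
        obtain ⟨t, rfl⟩ := H.exists_set_eq ht
        exact ((h t).1 ht).symm
      · rintro (rfl | ht)
        · exact (h k).2 (Or.inr rfl)
        · obtain ⟨t, rfl⟩ := H.exists_set_eq ht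
          exact (h t).2 (Or.inl ht)
    · intro h t
      rw [h, ZFSet.mem_insert_iff, or_comm]
  have hempty : ∀ n : H κ, (∀ t : H κ, t.set ∉ n.set) ↔ n.set = ∅ := by
    intro n
    rw [ZFSet.eq_empty]
    constructor
    · intro h t ht
      obtain ⟨t, rfl⟩ := H.exists_set_eq ht
      exact h t ht
    · exact fun h t => h _
  have hω : HeredCardLT κ (Ordinal.toZFSet (Ordinal.omega0.{u})) :=
    heredCardLT_toZFSet hκ hκ' _ Ordinal.omega0_lt_omega_one
  have hnat : ∀ x : ZFSet.{u}, x ∈ Ordinal.toZFSet (Ordinal.omega0.{u}) ↔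
      ∃ k : ℕ, Ordinal.toZFSet (k : Ordinal.{u}) = x := by
    intro x
    rw [Ordinal.mem_toZFSet_iff]
    constructor
    · rintro ⟨a, ha, rfl⟩
      obtain ⟨k, rfl⟩ := Ordinal.lt_omega0.1 ha
      exact ⟨k, rfl⟩
    · rintro ⟨k, rfl⟩
      exact ⟨k, Ordinal.natCast_lt_omega0 k, rfl⟩
  have hex : ∃ w, P w := by
    refine ⟨H.mk _ hω, fun n => ?_⟩
    simp only [hsucc, hempty, H.set_mk, hnat]
    constructor
    · rintro ⟨k, hk⟩
      cases k with
      | zero => left; rw [← hk]; simp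
      | succ k =>
        right
        refine ⟨H.mk _ (hω.mem ((hnat _).2 ⟨k, rfl⟩)), ⟨k, rfl⟩, ?_⟩
        rw [← hk, H.set_mk, ← Ordinal.toZFSet_add_one]
        simp
    · rintro (h | ⟨k, ⟨l, hl⟩, h⟩)
      · exact ⟨0, by rw [h]; simp⟩
      · refine ⟨l + 1, ?_⟩
        rw [h, ← hl, ← Ordinal.toZFSet_add_one]
        simp
  obtain ⟨w, hwN, hw⟩ := N.exists_mem (α := Empty) (R := fun _ w => P w)
    (.all (.iff (.mem (.intro _) (.intro _)) (.or (.all (.not (.mem (.intro _) (.intro _))))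
      (.ex (.and (.mem (.intro _) (.intro _)) (.all (.iff (.mem (.intro _) (.intro _))
        (.or (.mem (.intro _) (.intro _)) (.eq (.intro _) (.intro _)))))))))) (fun i => i.elim)
    (fun i => i.elim) hex
  refine ⟨w, hwN, fun n => ?_, fun k => ?_⟩
  · induction n using ZFSet.inductionOn with
    | _ n ih =>
      intro hn
      obtain ⟨n, rfl⟩ := H.exists_set_eq hn
      rcases (hw n).1 hn with h | ⟨k, hk, h⟩
      · obtain ⟨n', hn', h'⟩ := N.exists_mem (α := Empty)
          (R := fun _ n => ∀ t : H κ, t.set ∉ n.set) (.all (.not (.mem (.intro _) (.intro _))))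
          (fun i => i.elim) (fun i => i.elim) ⟨n, h⟩
        rw [(hempty n).1 h, ← (hempty n').1 h']
        exact N.has_set hn'
      · obtain ⟨k', hk', he⟩ := N.has_iff.1 (ih k.set ((h k).2 (Or.inr rfl)) hk)
        obtain rfl := H.set_inj.1 he
        obtain ⟨n', hn', h'⟩ := N.exists_mem₁
          (R := fun k n => ∀ t : H κ, t.set ∈ n.set ↔ t.set ∈ k.set ∨ t.set = k.set)
          (.all (.iff (.mem (.intro _) (.intro _)) (.or (.mem (.intro _) (.intro _))
            (.eq (.intro _) (.intro _))))) hk' ⟨n, h⟩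
        rw [(hsucc n _).1 h, ← (hsucc n' _).1 h']
        exact N.has_set hn'
  · have hk : HeredCardLT κ (Ordinal.toZFSet (k : Ordinal.{u})) :=
      hω.mem ((hnat _).2 ⟨k, rfl⟩)
    change (H.mk _ hk).set ∈ w.set
    induction k with
    | zero => exact (hw _).2 (Or.inl ((hempty _).2 (by simp)))
    | succ k ih =>
      have hk' : HeredCardLT κ (Ordinal.toZFSet (k : Ordinal.{u})) :=
        hω.mem ((hnat _).2 ⟨k, rfl⟩)
      refine (hw _).2 (Or.inr ⟨H.mk _ hk', ih hk', (hsucc _ _).2 ?_⟩)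
      simp

/-- By elementarity `N` contains a function that enumerates `x` along `ω`. Its arguments are in `N`,
hence so are its values. -/
theorem Submodel.has_of_countable (hκ : κ.IsRegular) (hκ' : ℵ₀ < κ) (hx : N.Has x)
    (hc : {y | y ∈ x}.Countable) (hy : y ∈ x) : N.Has y := by
  obtain ⟨w, hwN, hw, hkw⟩ := N.exists_omega hκ hκ'
  obtain ⟨a, haN, rfl⟩ := N.has_iff.1 hx
  obtain ⟨g, hg⟩ := hc.exists_eq_range ⟨y, hy⟩
  have hgmem : ∀ k, g k ∈ a.set := fun k => by
    have : g k ∈ {y | y ∈ a.set} := by rw [hg]; exact ⟨k, rfl⟩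
    exact this
  let f : ZFSet.{u} := ZFSet.range fun k : ℕ => ZFSet.pair (Ordinal.toZFSet (k : Ordinal.{u})) (g k)
  have hf : HeredCardLT κ f := by
    refine .of_countable hκ hκ' (fun z hz => ?_) ?_
    · obtain ⟨k, rfl⟩ := ZFSet.mem_range.1 hz
      exact .pair hκ (w.prop.mem (hkw k)) (a.prop.mem (hgmem k))
    · refine (Set.countable_range fun k : ℕ =>
        ZFSet.pair (Ordinal.toZFSet (k : Ordinal.{u})) (g k)).mono fun z hz => ?_
      exact ZFSet.mem_range.1 hz
  have hpf : ∀ n z, ZFSet.pair n z ∈ f ↔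
      ∃ k : ℕ, n = Ordinal.toZFSet (k : Ordinal.{u}) ∧ z = g k := by
    intro n z
    rw [ZFSet.mem_range]
    refine exists_congr fun k => ?_
    rw [ZFSet.pair_inj, eq_comm, eq_comm (a := g k)]
  obtain ⟨F, hFN, hF1, hF2⟩ := N.exists_mem₂ (R := fun w x f =>
    (∀ y : H κ, y.set ∈ x.set → ∃ n : H κ, n.set ∈ w.set ∧ ZFSet.pair n.set y.set ∈ f.set) ∧
    ∀ n y y' : H κ, ZFSet.pair n.set y.set ∈ f.set → ZFSet.pair n.set y'.set ∈ f.set →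
      y.set = y'.set)
    (.and (.all (.imp (.mem (.intro _) (.intro _)) (.ex (.and (.mem (.intro _) (.intro _))
      (.pair_mem (.intro _) (.intro _) (.intro _))))))
      (.all (.all (.all (.imp (.pair_mem (.intro _) (.intro _) (.intro _))
        (.imp (.pair_mem (.intro _) (.intro _) (.intro _)) (.eq (.intro _) (.intro _)))))))) hwN haN
    ⟨H.mk f hf, fun z hz => by
      obtain ⟨k, hk⟩ : z.set ∈ Set.range g := by rw [← hg]; exact hz
      exact ⟨H.mk _ (w.prop.mem (hkw k)), hkw k, (hpf _ _).2 ⟨k, rfl, hk.symm⟩⟩, fun n z z' h h' => by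
      obtain ⟨k, hk, h⟩ := (hpf _ _).1 h
      obtain ⟨k', hk', h'⟩ := (hpf _ _).1 h'
      rw [hk] at hk'
      have := Ordinal.toZFSet_injective hk'
      rw [h, h', Nat.cast_injective this]⟩
  obtain ⟨y, rfl⟩ := H.exists_set_eq hy
  obtain ⟨n, hnw, hn⟩ := hF1 y hy
  obtain ⟨n', hn', he⟩ := N.has_iff.1 (hw _ hnw)
  obtain rfl := H.set_inj.1 he
  obtain ⟨z, hzN, hz⟩ := N.exists_mem₂ (R := fun f n y => ZFSet.pair n.set y.set ∈ f.set)
    (.pair_mem (.intro _) (.intro _) (.intro _)) hFN hn' ⟨y, hn⟩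
  rw [hF2 _ _ _ hn hz]
  exact N.has_set hzN

theorem Submodel.countable_setOf_has {Q : Type v} (f : Q → ZFSet.{u}) (hf : Function.Injective f)
    (hN : (N : Set (H κ)).Countable) : {q | N.Has (f q)}.Countable := by
  refine Set.countable_of_injective_of_countable_image (f := f) hf.injOn
    ((hN.image H.set).mono ?_)
  rintro _ ⟨q, hq, rfl⟩
  exact N.has_iff.1 hq

/-- Countable ordinals in `N` are subsets of `N`, so `N ∩ ω₁` is an initial segment; it is bounded
since `N` is countable. -/
theorem Submodel.exists_omega1_eq (hκ : κ.IsRegular) (hκ' : ℵ₀ < κ)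
    (hN : (N : Set (H κ)).Countable) : ∃ δ < ω₁, N.omega1 = Set.Iio δ := by
  have hdown : ∀ α ∈ N.omega1, ∀ β < α, β ∈ N.omega1 := by
    rintro α ⟨hα, hαN⟩ β hβ
    refine ⟨hβ.trans hα, N.has_of_countable hκ hκ' hαN ?_ (Ordinal.toZFSet_mem_toZFSet_iff.2 hβ)⟩
    refine ((countable_Iio_of_lt_omega1 hα).image Ordinal.toZFSet).mono fun y hy => ?_
    exact Ordinal.mem_toZFSet_iff.1 hy
  have hc : N.omega1.Countable :=
    (N.countable_setOf_has _ Ordinal.toZFSet_injective hN).mono fun α hα => hα.2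
  have := hc.to_subtype
  obtain ⟨β, hβ, hlt⟩ := exists_lt_omega1_forall_lt (fun α : N.omega1 => α.1) fun α => α.2.1
  have hβN : β ∈ {γ | γ ∉ N.omega1} := fun h => (hlt ⟨β, h⟩).false
  have hne : {γ | γ ∉ N.omega1}.Nonempty := ⟨β, hβN⟩
  refine ⟨sInf {γ | γ ∉ N.omega1}, (csInf_le' hβN).trans_lt hβ, ?_⟩
  ext α
  rw [Set.mem_Iio]
  constructor
  · intro hα
    by_contra hle
    rw [not_lt] at hle
    have h1 := csInf_mem hne
    rcases hle.eq_or_lt with he | hlt'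
    · rw [he] at h1; exact h1 hα
    · exact h1 (hdown α hα _ hlt')
  · intro hα
    by_contra h
    exact (csInf_le' (show α ∈ {γ | γ ∉ N.omega1} from h)).not_gt hα

end ElementaryClosure

/-! ### The tree, its heights and the conditions inside `N`. -/

section TreeCodes

variable {T : Type u} [PartialOrder T]

/-- The strict order of the tree, realized along `e`. -/
noncomputable def ltCode (e : T → ZFSet.{u}) : ZFSet.{u} :=
  ZFSet.range fun r : {r : T × T // r.1 < r.2} => ZFSet.pair (e r.1.1) (e r.1.2)

theorem pair_mem_ltCode (e : T ↪ ZFSet.{u}) {a b : ZFSet.{u}} :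
    ZFSet.pair a b ∈ ltCode e ↔ ∃ x y, e x = a ∧ e y = b ∧ x < y := by
  rw [ltCode, ZFSet.mem_range]
  constructor
  · rintro ⟨⟨⟨x, y⟩, h⟩, he⟩
    obtain ⟨h1, h2⟩ := ZFSet.pair_inj.1 he
    exact ⟨x, y, h1, h2, h⟩
  · rintro ⟨x, y, rfl, rfl, h⟩
    exact ⟨⟨⟨x, y⟩, h⟩, rfl⟩

theorem pair_mem_ltCode_iff (e : T ↪ ZFSet.{u}) {x y : T} :
    ZFSet.pair (e x) (e y) ∈ ltCode e ↔ x < y := by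
  rw [pair_mem_ltCode]
  constructor
  · rintro ⟨x', y', hx, hy, h⟩
    rwa [e.injective hx, e.injective hy] at h
  · exact fun h => ⟨x, y, rfl, rfl, h⟩

/-- The order of a poset, realized along `P`. -/
noncomputable def leCode {Q : Type v} [Preorder Q] [Small.{u} Q] (P : Q → ZFSet.{u}) : ZFSet.{u} :=
  ZFSet.range fun r : {r : Q × Q // r.1 ≤ r.2} => ZFSet.pair (P r.1.1) (P r.1.2)

theorem pair_mem_leCode_iff {Q : Type v} [Preorder Q] [Small.{u} Q] (P : Q ↪ ZFSet.{u}) {p q : Q} :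
    ZFSet.pair (P p) (P q) ∈ leCode P ↔ p ≤ q := by
  rw [leCode, ZFSet.mem_range]
  constructor
  · rintro ⟨⟨⟨x, y⟩, h⟩, he⟩
    obtain ⟨h1, h2⟩ := ZFSet.pair_inj.1 he
    rwa [P.injective h1, P.injective h2] at h
  · exact fun h => ⟨⟨⟨p, q⟩, h⟩, rfl⟩

theorem mem_setCode {Q : Type v} [Small.{u} Q] {P : Q → ZFSet.{u}} {D : Set Q} {x : ZFSet.{u}} :
    x ∈ setCode P D ↔ ∃ q ∈ D, P q = x := by
  rw [setCode, ZFSet.mem_range]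
  constructor
  · rintro ⟨⟨q, hq⟩, h⟩
    exact ⟨q, hq, h⟩
  · rintro ⟨q, hq, h⟩
    exact ⟨⟨q, hq⟩, h⟩

variable {κ : Cardinal.{u}} {N : Submodel κ} {e : T ↪ ZFSet.{u}}

theorem card_lt_of_has (hN : N.Has (treeCode e)) : #T < κ := by
  obtain ⟨h, -⟩ := hN.1.of_pair
  have h1 := h.card_lt
  have hinj : Function.Injective fun x : T => (⟨e x, ZFSet.mem_range_self x⟩ :
      {y : ZFSet.{u} // y ∈ ZFSet.range e}) := fun x y h => e.injective (congrArg Subtype.val h)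
  have h2 := Cardinal.lift_mk_le_lift_mk_of_injective hinj
  rw [Cardinal.lift_id'.{u, u + 1}] at h2
  exact Cardinal.lift_lt.1 (h2.trans_lt h1)

variable [WellFoundedLT T]

/-- The height function of the tree, realized along `e`. -/
noncomputable def htCode (e : T → ZFSet.{u}) : ZFSet.{u} :=
  ZFSet.range fun x : T => ZFSet.pair (e x) (Ordinal.toZFSet (ht x))

theorem pair_mem_htCode (e : T ↪ ZFSet.{u}) {a v : ZFSet.{u}} :
    ZFSet.pair a v ∈ htCode e ↔ ∃ x, e x = a ∧ Ordinal.toZFSet (ht x) = v := by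
  rw [htCode, ZFSet.mem_range]
  exact exists_congr fun x => ZFSet.pair_inj

theorem pair_mem_htCode_iff (e : T ↪ ZFSet.{u}) {x : T} {v : ZFSet.{u}} :
    ZFSet.pair (e x) v ∈ htCode e ↔ v = Ordinal.toZFSet (ht x) := by
  rw [pair_mem_htCode]
  constructor
  · rintro ⟨x', hx, h⟩
    rw [← h, e.injective hx]
  · exact fun h => ⟨x, rfl, h.symm⟩

theorem mem_toZFSet_ht {x : T} {w : ZFSet.{u}} :
    w ∈ Ordinal.toZFSet (ht x) ↔ ∃ y < x, w = Ordinal.toZFSet (ht y) := by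
  rw [Ordinal.mem_toZFSet_iff]
  constructor
  · rintro ⟨α, hα, rfl⟩
    obtain ⟨y, hy, rfl⟩ := exists_le_ht_eq x α hα.le
    exact ⟨y, lt_of_le_of_ne hy fun h => by rw [h] at hα; exact hα.false, rfl⟩
  · rintro ⟨y, hy, rfl⟩
    exact ⟨_, ht_lt_ht hy, rfl⟩

theorem IsOmega1Tree.aleph0_lt_card (hT : IsOmega1Tree T) : ℵ₀ < #T := by
  by_contra h
  rw [not_lt, Cardinal.mk_le_aleph0_iff] at h
  obtain ⟨β, hβ, hlt⟩ := exists_lt_omega1_forall_lt (fun x : T => ht x) hT.ht_lt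
  obtain ⟨x, hx⟩ := hT.level_nonempty β hβ
  exact (hlt x).ne hx

/-- The recursion that the height of `x` is the set of heights of its predecessors is expressible in
`H(κ)`. Elementarity gives a solution in `N`, and well-founded induction identifies it with the
height function. -/
theorem has_htCode (hκ : κ.IsRegular) (hT : IsOmega1Tree T) (hN : N.Has (treeCode e)) :
    N.Has (htCode e) := by
  have hTκ := card_lt_of_has hN
  have hκ' := hT.aleph0_lt_card.trans hTκ
  obtain ⟨h1, h2⟩ := N.has_of_pair hN
  obtain ⟨d, hdN, hd⟩ := N.has_iff.1 h1
  obtain ⟨l, hlN, hl⟩ := N.has_iff.1 h2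
  change l.set = ltCode e at hl
  have hdm : ∀ x, e x ∈ d.set := fun x => by rw [hd]; exact ZFSet.mem_range_self x
  have heH : ∀ x, HeredCardLT κ (e x) := fun x => d.prop.mem (hdm x)
  have hordH : ∀ x : T, HeredCardLT κ (Ordinal.toZFSet (ht x)) := fun x =>
    heredCardLT_toZFSet hκ hκ' _ (hT.ht_lt x)
  have hH : HeredCardLT κ (htCode e) := by
    refine .range hκ _ (fun x => .pair hκ (heH x) (hordH x)) ?_
    have := Cardinal.lift_mk_shrink'.{u, u} T
    rw [Cardinal.lift_id, Cardinal.lift_id] at this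
    rwa [this]
  obtain ⟨h, hhN, hh1, hh2⟩ := N.exists_mem₂ (R := fun d l h =>
    (∀ x : H κ, x.set ∈ d.set → ∃ v : H κ, ZFSet.pair x.set v.set ∈ h.set) ∧
    ∀ z : H κ, z.set ∈ h.set → ∃ x v : H κ, z.set = ZFSet.pair x.set v.set ∧ x.set ∈ d.set ∧
      ∀ w : H κ, w.set ∈ v.set ↔
        ∃ y : H κ, ZFSet.pair y.set x.set ∈ l.set ∧ ZFSet.pair y.set w.set ∈ h.set)
    (.and (.all (.imp (.mem (.intro _) (.intro _))
        (.ex (.pair_mem (.intro _) (.intro _) (.intro _)))))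
      (.all (.imp (.mem (.intro _) (.intro _)) (.ex (.ex (.and
        (.pair (.intro _) (.intro _) (.intro _)) (.and (.mem (.intro _) (.intro _))
          (.all (.iff (.mem (.intro _) (.intro _)) (.ex (.and
            (.pair_mem (.intro _) (.intro _) (.intro _))
            (.pair_mem (.intro _) (.intro _) (.intro _)))))))))))))
    hdN hlN ⟨H.mk _ hH, fun x hx => by
      rw [hd] at hx
      obtain ⟨x', hx'⟩ := ZFSet.mem_range.1 hx
      exact ⟨H.mk _ (hordH x'), (pair_mem_htCode e).2 ⟨x', hx', rfl⟩⟩, fun z hz => by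
      obtain ⟨x, hx⟩ := ZFSet.mem_range.1 hz
      refine ⟨H.mk _ (heH x), H.mk _ (hordH x), hx.symm, hdm x, fun w => ?_⟩
      simp only [H.set_mk]
      rw [mem_toZFSet_ht, hl]
      constructor
      · rintro ⟨y, hy, hw⟩
        exact ⟨H.mk _ (heH y), (pair_mem_ltCode_iff e).2 hy, (pair_mem_htCode_iff e).2 hw⟩
      · rintro ⟨y, hy, hw⟩
        obtain ⟨y', x', hy', hx', hlt⟩ := (pair_mem_ltCode e).1 hy
        rw [← hy', pair_mem_htCode_iff] at hw
        exact ⟨y', e.injective hx' ▸ hlt, hw⟩⟩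
  have key : ∀ x : T, ∀ v : ZFSet.{u}, ZFSet.pair (e x) v ∈ h.set ↔ v = Ordinal.toZFSet (ht x) := by
    intro x
    induction x using WellFoundedLT.induction with
    | _ x ih =>
      have huniq : ∀ v : ZFSet.{u}, ZFSet.pair (e x) v ∈ h.set → v = Ordinal.toZFSet (ht x) := by
        intro v hv
        obtain ⟨z, hz⟩ := H.exists_set_eq hv
        obtain ⟨x', v', hz', -, hv'⟩ := hh2 z (hz ▸ hv)
        rw [hz, ZFSet.pair_inj] at hz'
        obtain ⟨hx, rfl⟩ := hz'
        ext w
        rw [mem_toZFSet_ht]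
        constructor
        · intro hw
          obtain ⟨w, rfl⟩ := H.exists_set_eq hw
          obtain ⟨y, hy, hyw⟩ := (hv' w).1 hw
          rw [hl, ← hx] at hy
          obtain ⟨y', x'', hy', hx', hlt⟩ := (pair_mem_ltCode e).1 hy
          rw [e.injective hx'] at hlt
          rw [← hy', ih y' hlt] at hyw
          exact ⟨y', hlt, hyw⟩
        · rintro ⟨y, hy, rfl⟩
          refine (hv' (H.mk _ (hordH y))).2 ⟨H.mk _ (heH y), ?_, (ih y hy _).2 rfl⟩
          rw [hl, ← hx]
          exact (pair_mem_ltCode_iff e).2 hy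
      refine fun v => ⟨huniq v, ?_⟩
      rintro rfl
      obtain ⟨v, hv⟩ := hh1 (H.mk _ (heH x)) (hdm x)
      rw [← huniq _ hv]
      exact hv
  have : h.set = htCode e := by
    ext z
    constructor
    · intro hz
      obtain ⟨z, rfl⟩ := H.exists_set_eq hz
      obtain ⟨x, v, hzv, hxd, -⟩ := hh2 z hz
      rw [hd] at hxd
      obtain ⟨x', hx'⟩ := ZFSet.mem_range.1 hxd
      rw [hzv, ← hx'] at hz ⊢
      rw [key] at hz
      exact (pair_mem_htCode_iff e).2 hz
    · intro hz
      obtain ⟨x, rfl⟩ := ZFSet.mem_range.1 hz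
      exact (key x _).2 rfl
  rw [← this]
  exact N.has_set hhN

/-- Conversely to the definability of heights, a level whose index is in `N` is a countable element
of `N`, hence a subset of `N`. -/
theorem has_iff_ht_mem (hκ : κ.IsRegular) (hT : IsOmega1Tree T) (hN : N.Has (treeCode e)) (x : T) :
    N.Has (e x) ↔ ht x ∈ N.omega1 := by
  have hκ' := hT.aleph0_lt_card.trans (card_lt_of_has hN)
  have hordH : ∀ x : T, HeredCardLT κ (Ordinal.toZFSet (ht x)) := fun x =>
    heredCardLT_toZFSet hκ hκ' _ (hT.ht_lt x)
  obtain ⟨h, hhN, hh⟩ := N.has_iff.1 (has_htCode hκ hT hN)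
  have heH : ∀ x, HeredCardLT κ (e x) := fun x =>
    hN.1.of_pair.1.mem (ZFSet.mem_range_self x)
  constructor
  · intro hx
    obtain ⟨x', hx', he⟩ := N.has_iff.1 hx
    obtain ⟨v, hvN, hv⟩ := N.exists_mem₂ (R := fun h x v => ZFSet.pair x.set v.set ∈ h.set)
      (.pair_mem (.intro _) (.intro _) (.intro _)) hhN hx'
      ⟨H.mk _ (hordH x), by rw [he, hh]; exact (pair_mem_htCode_iff e).2 rfl⟩
    rw [he, hh, pair_mem_htCode_iff] at hv
    exact ⟨hT.ht_lt x, hv ▸ N.has_set hvN⟩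
  · rintro ⟨-, hα⟩
    obtain ⟨α, hαN, hα⟩ := N.has_iff.1 hα
    let L : ZFSet.{u} := setCode e {y | ht y = ht x}
    have hLc : {y | y ∈ L}.Countable := by
      refine ((hT.countable_level (ht x)).image e).mono fun y hy => ?_
      exact mem_setCode.1 hy
    have hL : HeredCardLT κ L := by
      refine .of_countable hκ hκ' (fun y hy => ?_) hLc
      obtain ⟨z, -, rfl⟩ := mem_setCode.1 hy
      exact heH z
    have hLspec : ∀ y : ZFSet.{u}, y ∈ L ↔ ZFSet.pair y α.set ∈ h.set := by
      intro y
      rw [mem_setCode, hh, pair_mem_htCode, hα]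
      constructor
      · rintro ⟨z, hz, rfl⟩
        exact ⟨z, rfl, by rw [show ht z = ht x from hz]⟩
      · rintro ⟨z, rfl, hz⟩
        exact ⟨z, Ordinal.toZFSet_injective hz, rfl⟩
    obtain ⟨L', hL'N, hL'⟩ := N.exists_mem₂
      (R := fun h α L => ∀ y : H κ, y.set ∈ L.set ↔ ZFSet.pair y.set α.set ∈ h.set)
      (.all (.iff (.mem (.intro _) (.intro _)) (.pair_mem (.intro _) (.intro _) (.intro _))))
      hhN hαN ⟨H.mk L hL, fun y => hLspec y.set⟩
    have hLL : L'.set = L := by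
      ext y
      constructor
      · intro hy
        obtain ⟨y, rfl⟩ := H.exists_set_eq hy
        exact (hLspec _).2 ((hL' y).1 hy)
      · intro hy
        exact (hL' (H.mk y (hL.mem hy))).2 ((hLspec _).1 hy)
    refine N.has_of_countable hκ hκ' (x := L) (hLL ▸ N.has_set hL'N) hLc ?_
    exact mem_setCode.2 ⟨x, rfl, rfl⟩

/-- The heights of tree points in `N` thus have no maximum, which lets top levels of conditions in
`N` be cofinal in `N ∩ ω₁`. -/
theorem exists_gt_has (hn : IsNormal T)
    (hN : N.Has (treeCode e)) {x : T} (hx : N.Has (e x)) : ∃ y, x < y ∧ N.Has (e y) := by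
  have heH : ∀ x, HeredCardLT κ (e x) := fun x =>
    hN.1.of_pair.1.mem (ZFSet.mem_range_self x)
  obtain ⟨l, hlN, hl⟩ := N.has_iff.1 (N.has_of_pair hN).2
  change l.set = ltCode e at hl
  obtain ⟨x', hx', he⟩ := N.has_iff.1 hx
  obtain ⟨y, z, hxy, -⟩ := hn.incomparable x
  obtain ⟨y', hy', h⟩ := N.exists_mem₂ (R := fun l x y => ZFSet.pair x.set y.set ∈ l.set)
    (.pair_mem (.intro _) (.intro _) (.intro _)) hlN hx'
    ⟨H.mk _ (heH y), by rw [he, hl]; exact (pair_mem_ltCode_iff e).2 hxy⟩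
  rw [he, hl] at h
  obtain ⟨a, b, ha, hb, hlt⟩ := (pair_mem_ltCode e).1 h
  exact ⟨b, e.injective ha ▸ hlt, hb ▸ N.has_set hy'⟩

/-- Value 1 means that the coded value is non-empty, so formulas need not mention the numerals 0 and
1. -/
theorem pair_mem_code {F : SubtreeFun T} {a v : ZFSet.{u}} (h : ZFSet.pair a v ∈ F.code e) :
    ∃ x, e x = a ∧ ht x ≤ F.top ∧ ((∃ s, s ∈ v) ↔ x ∈ F.one) := by
  obtain ⟨⟨x, hx⟩, h⟩ := ZFSet.mem_range.1 h
  obtain ⟨h1, h2⟩ := ZFSet.pair_inj.1 h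
  refine ⟨x, h1, hx, ?_⟩
  rw [← h2]
  by_cases hxF : x ∈ F.one
  · simp only [hxF, if_true, iff_true]
    exact ⟨_, Ordinal.toZFSet_mem_toZFSet_iff.2 zero_lt_one⟩
  · simp [hxF]

theorem exists_pair_mem_code {F : SubtreeFun T} {x : T} (hx : ht x ≤ F.top) :
    ∃ v, ZFSet.pair (e x) v ∈ F.code e :=
  ⟨_, ZFSet.mem_range.2 ⟨⟨x, hx⟩, rfl⟩⟩

theorem Condition.codeEmb_apply (hT : IsOmega1Tree T) {S : Set ℕ} (p : Condition T S) :
    Condition.codeEmb hT e S p = ZFSet.pair (p.F.code e) (setCode (GenPromise.code e) p.Γ) := rfl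

/-- A point maximal in the domain of the subtree function has the top level as its height, because
by normality every lower point has an extension there. Elementarity yields such a point in `N`. -/
theorem top_mem_omega1 (hκ : κ.IsRegular) (hT : IsOmega1Tree T) (hn : IsNormal T) {S : Set ℕ}
    (hN : N.Has (treeCode e)) {p : Condition T S} (hp : N.Has (Condition.codeEmb hT e S p)) :
    p.F.top ∈ N.omega1 := by
  have heH : ∀ x, HeredCardLT κ (e x) := fun x =>
    hN.1.of_pair.1.mem (ZFSet.mem_range_self x)
  obtain ⟨l, hlN, hl⟩ := N.has_iff.1 (N.has_of_pair hN).2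
  change l.set = ltCode e at hl
  obtain ⟨F, hFN, hF⟩ := N.has_iff.1 (N.has_of_pair (Condition.codeEmb_apply hT p ▸ hp)).1
  obtain ⟨x, hx⟩ := hT.level_nonempty p.F.top p.F.top_lt
  obtain ⟨x', hx', ⟨v, hv⟩, hmax⟩ := N.exists_mem₂ (R := fun l F x =>
    (∃ v : H κ, ZFSet.pair x.set v.set ∈ F.set) ∧
    ∀ y v : H κ, ZFSet.pair y.set v.set ∈ F.set → ¬ ZFSet.pair x.set y.set ∈ l.set)
    (.and (.ex (.pair_mem (.intro _) (.intro _) (.intro _))) (.all (.all (.imp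
      (.pair_mem (.intro _) (.intro _) (.intro _))
      (.not (.pair_mem (.intro _) (.intro _) (.intro _))))))) hlN hFN
    ⟨H.mk _ (heH x), by
      obtain ⟨v, hv⟩ := exists_pair_mem_code (e := e) hx.le
      rw [← hF] at hv
      exact ⟨H.mk v (F.prop.mem hv).of_pair.2, hv⟩, fun y v hyv hxy => by
      rw [hF] at hyv
      obtain ⟨y', hy', hyt, -⟩ := pair_mem_code hyv
      rw [hl, ← hy', H.set_mk, pair_mem_ltCode_iff] at hxy
      exact (hyt.trans hx.ge).not_gt (ht_lt_ht hxy)⟩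
  rw [hF] at hv
  obtain ⟨z, hz, hzt, -⟩ := pair_mem_code hv
  have hzN : N.Has (e z) := hz ▸ N.has_set hx'
  have := (has_iff_ht_mem hκ hT hN z).1 hzN
  rcases hzt.eq_or_lt with h | h
  · rwa [← h]
  · obtain ⟨y, hzy, hy⟩ := hT.exists_ge_ht_eq hn z p.F.top_lt hzt
    obtain ⟨w, hw⟩ := exists_pair_mem_code (e := e) hy.le
    rw [← hF] at hw
    refine absurd ?_ (hmax (H.mk _ (heH y)) (H.mk w (F.prop.mem hw).of_pair.2) hw)
    rw [hl, ← hz, H.set_mk, pair_mem_ltCode_iff]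
    refine lt_of_le_of_ne hzy fun he => ?_
    rw [he] at h
    exact h.ne hy

end TreeCodes

/-! ### Reflecting the density argument into `N`. -/

section MasterConditions

variable {T : Type u} [PartialOrder T] [WellFoundedLT T] {κ : Cardinal.{u}}

/-- `q` codes a condition in `D` below `p` whose top level is at least the height of `z` and less
than that of `y`, and which contains the restrictions of the entries of `b`. -/
def GoodAt (lt le D p z y : H κ) {m : ℕ} (b : Fin m → H κ) (q : H κ) : Prop :=
  q.set ∈ D.set ∧ ZFSet.pair q.set p.set ∈ le.set ∧ ∃ F G : H κ, q.set = ZFSet.pair F.set G.set ∧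
    (∃ v : H κ, ZFSet.pair z.set v.set ∈ F.set) ∧ (¬ ∃ v : H κ, ZFSet.pair y.set v.set ∈ F.set) ∧
    ∀ i, ∀ u v : H κ, ZFSet.pair u.set (b i).set ∈ lt.set → ZFSet.pair u.set v.set ∈ F.set →
      ∃ s : H κ, s.set ∈ v.set

theorem FODef.goodAt {α : Type} {lt le D p z y q : (α → H κ) → H κ} {m : ℕ}
    {b : Fin m → (α → H κ) → H κ} (hlt : IsVar lt) (hle : IsVar le) (hD : IsVar D) (hp : IsVar p)
    (hz : IsVar z) (hy : IsVar y) (hb : ∀ i, IsVar (b i)) (hq : IsVar q) :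
    FODef fun w => GoodAt (lt w) (le w) (D w) (p w) (z w) (y w) (fun i => b i w) (q w) :=
  .and (.mem hq hD) (.and (.pair_mem hq hp hle) (.ex (.ex (.and
    (.pair (.intro _) (.intro _) hq.inl.inl) (.and
      (.ex (.pair_mem hz.inl.inl.inl (.intro _) (.intro _))) (.and
        (.not (.ex (.pair_mem hy.inl.inl.inl (.intro _) (.intro _))))
        (.forall_index fun i => .all (.all (.imp
          (.pair_mem (.intro _) (hb i).inl.inl.inl.inl hlt.inl.inl.inl.inl)
          (.imp (.pair_mem (.intro _) (.intro _) (.intro _))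
            (.ex (.mem (.intro _) (.intro _)))))))))))))

/-- The top level is located through the domain of the function: `z` lies in it, `y` does not. Value
1 at all points of the domain below `b i` amounts to value 1 at the restriction of `b i`, by
downward closure. -/
theorem goodAt_iff (hT : IsOmega1Tree T) (e : T ↪ ZFSet.{u}) {S : Set ℕ} {D₀ : Set (Condition T S)}
    {p₀ : Condition T S} {z₀ y₀ : T} {m : ℕ} {b₀ : Fin m → T} (hb₀ : ∀ i, ht (b₀ i) = ht y₀)
    {lt le D p z y : H κ} {b : Fin m → H κ} (hlt : lt.set = ltCode e)
    (hle : le.set = leCode (Condition.codeEmb hT e S))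
    (hD : D.set = setCode (Condition.codeEmb hT e S) D₀) (hp : p.set = Condition.codeEmb hT e S p₀)
    (hz : z.set = e z₀) (hy : y.set = e y₀) (hb : ∀ i, (b i).set = e (b₀ i)) (heH : ∀ x, HeredCardLT κ (e x))
    (q : H κ) :
    GoodAt lt le D p z y b q ↔ ∃ q₀ ∈ D₀, Condition.codeEmb hT e S q₀ = q.set ∧ q₀ ≤ p₀ ∧
      ht z₀ ≤ q₀.F.top ∧ q₀.F.top < ht y₀ ∧ ∀ i, res q₀.F.top (b₀ i) ∈ q₀.F.one := by
  have hdom : ∀ {F : SubtreeFun T} {F' : H κ}, F'.set = F.code e → ∀ x : T,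
      (∃ v : H κ, ZFSet.pair (e x) v.set ∈ F'.set) ↔ ht x ≤ F.top := by
    intro F F' hF x
    constructor
    · rintro ⟨v, hv⟩
      rw [hF] at hv
      obtain ⟨x', hx', h, -⟩ := pair_mem_code hv
      rwa [e.injective hx'] at h
    · intro h
      obtain ⟨v, hv⟩ := exists_pair_mem_code (e := e) h
      rw [← hF] at hv
      exact ⟨H.mk v (F'.prop.mem hv).of_pair.2, hv⟩
  unfold GoodAt
  constructor
  · rintro ⟨h1, h2, F, G, h3, h4, h5, h6⟩
    rw [hD, mem_setCode] at h1
    obtain ⟨q₀, hq₀, hq⟩ := h1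
    rw [hp, ← hq, hle, pair_mem_leCode_iff] at h2
    rw [← hq, Condition.codeEmb_apply, ZFSet.pair_inj] at h3
    rw [hz, hdom h3.1.symm] at h4
    rw [hy, hdom h3.1.symm, not_le] at h5
    refine ⟨q₀, hq₀, hq, h2, h4, h5, fun i => ?_⟩
    have hti : q₀.F.top < ht (b₀ i) := by rwa [hb₀]
    obtain ⟨v, hv⟩ := exists_pair_mem_code (e := e) (F := q₀.F) (x := res q₀.F.top (b₀ i))
      (ht_res hti.le).le
    have hvF : v ∈ {v | HeredCardLT κ v} := by
      rw [h3.1] at hv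
      exact (F.prop.mem hv).of_pair.2
    obtain ⟨s, hs⟩ := h6 i (H.mk _ (heH (res q₀.F.top (b₀ i)))) (H.mk v hvF) (by
      rw [hb, hlt, H.set_mk, pair_mem_ltCode_iff]
      refine lt_of_le_of_ne (res_le _ _) fun he => ?_
      have := ht_res hti.le
      rw [he] at this
      exact hti.ne' this) (h3.1 ▸ hv)
    obtain ⟨x', hx', -, h⟩ := pair_mem_code hv
    rw [← e.injective hx']
    exact h.1 ⟨_, hs⟩
  · rintro ⟨q₀, hq₀, hq, hqp, hzq, hqy, h⟩
    have hqH : HeredCardLT κ (ZFSet.pair (q₀.F.code e) (setCode (GenPromise.code e) q₀.Γ)) := by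
      rw [← Condition.codeEmb_apply hT, hq]
      exact q.prop
    refine ⟨hD ▸ mem_setCode.2 ⟨q₀, hq₀, hq⟩, ?_, H.mk _ hqH.of_pair.1, H.mk _ hqH.of_pair.2,
      hq.symm, ?_, ?_, fun i u v hu hv => ?_⟩
    · rw [← hq, hp, hle, pair_mem_leCode_iff]
      exact hqp
    · rw [hz, hdom (H.set_mk _ _)]
      exact hzq
    · rw [hy, hdom (H.set_mk _ _), not_le]
      exact hqy
    · obtain ⟨x, hx, hxt, hxv⟩ := pair_mem_code hv
      rw [← hx, hb, hlt, pair_mem_ltCode_iff] at hu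
      have hxF : x ∈ q₀.F.one :=
        q₀.F.down _ _ (hT.le_res hu.le hxt (by rw [hb₀]; exact hqy.le)) (h i)
      obtain ⟨s, hs⟩ := hxv.2 hxF
      exact ⟨H.mk s (v.prop.mem hs), hs⟩

variable {N : Submodel κ} {e : T ↪ ZFSet.{u}}

/-- Elementarity is used twice: to find a catching level in `N`, and then, with the restriction of
`x` to that level as a parameter in `N`, to find the catching condition in `N`. The points `x`
themselves are outside `N`. -/
theorem exists_le_mem_has (hκ : κ.IsRegular) (hA : IsAronszajn T) (hn : IsNormal T) {S : Set ℕ}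
    {n : ℕ} (hnS : n ∈ S) (hn2 : 2 ≤ n) (hImm : ∀ x : T, (n : ℕ∞) ≤ (Imm x).encard)
    (hN : N.Has (treeCode e))
    (hP : N.Has (posetCode (Condition.codeEmb hA.toIsOmega1Tree e S)))
    {D : Set (Condition T S)} (hD : IsDense D)
    (hDN : N.Has (setCode (Condition.codeEmb hA.toIsOmega1Tree e S) D))
    {p : Condition T S} (hp : N.Has (Condition.codeEmb hA.toIsOmega1Tree e S p))
    {z : T} (hz : N.Has (e z)) {δ : Ordinal.{u}} (hδ : N.omega1 = Set.Iio δ)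
    {m : ℕ} (hm : 0 < m) {x : Fin m → T} (hx : ∀ i, ht (x i) = δ)
    (hxi : Function.Injective fun i => res p.F.top (x i))
    (hxp : ∀ i, res p.F.top (x i) ∈ p.F.one) :
    ∃ q ∈ D, N.Has (Condition.codeEmb hA.toIsOmega1Tree e S q) ∧ q ≤ p ∧ ht z ≤ q.F.top ∧
      ∀ i, res q.F.top (x i) ∈ q.F.one := by
  have hT := hA.toIsOmega1Tree
  have heH : ∀ x, HeredCardLT κ (e x) := fun x =>
    hN.1.of_pair.1.mem (ZFSet.mem_range_self x)
  have hNe : ∀ x : T, N.Has (e x) ↔ ht x < δ := fun x => by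
    rw [has_iff_ht_mem hκ hT hN, hδ]; rfl
  have hpδ : p.F.top < δ := by
    have := top_mem_omega1 hκ hT hn hN hp
    rwa [hδ] at this
  obtain ⟨lt, hltN, hlt⟩ := N.has_iff.1 (N.has_of_pair hN).2
  change lt.set = ltCode e at hlt
  obtain ⟨le, hleN, hle⟩ := N.has_iff.1 (N.has_of_pair hP).2
  change le.set = leCode (Condition.codeEmb hT e S) at hle
  obtain ⟨D', hD'N, hD'⟩ := N.has_iff.1 hDN
  obtain ⟨p', hp'N, hp'⟩ := N.has_iff.1 hp
  obtain ⟨z', hz'N, hz'⟩ := N.has_iff.1 hz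
  obtain ⟨h, hhN, hh⟩ := N.has_iff.1 (has_htCode hκ hT hN)
  let a : Fin m → T := fun i => res p.F.top (x i)
  have hat : ∀ i, ht (a i) = p.F.top := fun i => ht_res (by rw [hx]; exact hpδ.le)
  choose a' ha'N ha' using fun i => N.has_iff.1 ((hNe (a i)).2 (by rw [hat]; exact hpδ))
  obtain ⟨β, hβ, hpβ, hβq⟩ := p.exists_level_of_dense hA hn hnS hn2 hImm hD (hT.ht_lt z) hm hxi
    fun i => ⟨hxp i, hat i⟩
  let i0 : Fin m := ⟨0, hm⟩
  -- a level at which all tuples above `a` are caught by `D` exists in `N`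
  have hlevel : ∃ y : T, ht y < δ ∧ a i0 < y ∧ ∀ b : Fin m → T, (∀ i, a i < b i) →
      (∀ i, ht (b i) = ht y) → ∃ q ∈ D, q ≤ p ∧ ht z ≤ q.F.top ∧ q.F.top < ht y ∧
        ∀ i, res q.F.top (b i) ∈ q.F.one := by
    let par : Fin m ⊕ Fin 6 → H κ := Sum.elim a' ![lt, le, D', p', z', h]
    have hpar : ∀ i, par i ∈ N := by
      rintro (i | i)
      · exact ha'N i
      · fin_cases i
        exacts [hltN, hleN, hD'N, hp'N, hz'N, hhN]
    let R : (Fin m ⊕ Fin 6 → H κ) → H κ → Prop := fun w y =>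
      ZFSet.pair (w (Sum.inl i0)).set y.set ∈ (w (Sum.inr 0)).set ∧
      ∀ b : Fin m → H κ, (∀ i, ZFSet.pair (w (Sum.inl i)).set (b i).set ∈ (w (Sum.inr 0)).set ∧
        ∃ v : H κ, ZFSet.pair (b i).set v.set ∈ (w (Sum.inr 5)).set ∧
          ZFSet.pair y.set v.set ∈ (w (Sum.inr 5)).set) →
      ∃ q, GoodAt (w (Sum.inr 0)) (w (Sum.inr 1)) (w (Sum.inr 2)) (w (Sum.inr 3)) (w (Sum.inr 4)) y b q
    have hR : FODef fun w : (Fin m ⊕ Fin 6) ⊕ Unit → H κ =>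
        R (fun i => w (Sum.inl i)) (w (Sum.inr ())) :=
      .and (.pair_mem (.intro _) (.intro _) (.intro _)) (.alls (.imp (.forall_index fun i => .and
        (.pair_mem (.intro _) (.intro _) (.intro _)) (.ex (.and
          (.pair_mem (.intro _) (.intro _) (.intro _))
          (.pair_mem (.intro _) (.intro _) (.intro _)))))
        (.ex (.goodAt (.intro _) (.intro _) (.intro _) (.intro _) (.intro _) (.intro _)
          (fun i => .intro _) (.intro _)))))
    have hRiff : ∀ y : T, R par (H.mk (e y) (heH y)) ↔ a i0 < y ∧ ∀ b : Fin m → T,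
        (∀ i, a i < b i) → (∀ i, ht (b i) = ht y) → ∃ q ∈ D, q ≤ p ∧ ht z ≤ q.F.top ∧
          q.F.top < ht y ∧ ∀ i, res q.F.top (b i) ∈ q.F.one := by
      intro y
      change (ZFSet.pair (a' i0).set (e y) ∈ lt.set ∧ ∀ b : Fin m → H κ,
        (∀ i, ZFSet.pair (a' i).set (b i).set ∈ lt.set ∧ ∃ v : H κ,
          ZFSet.pair (b i).set v.set ∈ h.set ∧ ZFSet.pair (e y) v.set ∈ h.set) →
        ∃ q, GoodAt lt le D' p' z' (H.mk (e y) (heH y)) b q) ↔ _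
      simp only [ha', hlt, hh]
      rw [pair_mem_ltCode_iff]
      refine and_congr_right fun _ => ⟨fun hb b hab hby => ?_, fun hb b' hb' => ?_⟩
      · obtain ⟨q, hq⟩ := hb (fun i => H.mk _ (heH (b i))) fun i =>
          ⟨(pair_mem_ltCode_iff e).2 (hab i), H.mk (Ordinal.toZFSet (ht y))
            (heredCardLT_toZFSet hκ (hT.aleph0_lt_card.trans (card_lt_of_has hN)) _ (hT.ht_lt y)),
            (pair_mem_htCode_iff e).2 (by rw [hby]; rfl), (pair_mem_htCode_iff e).2 rfl⟩
        obtain ⟨q₀, hq₀, -, hq⟩ := (goodAt_iff hT e hby hlt hle hD' hp' hz' rfl (fun i => rfl)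
          heH q).1 hq
        exact ⟨q₀, hq₀, hq⟩
      · have hb'' : ∀ i, ∃ x : T, e x = (b' i).set ∧ a i < x ∧ ht x = ht y := by
          intro i
          obtain ⟨h1, v, h2, h3⟩ := hb' i
          obtain ⟨x, hx, hxv⟩ := (pair_mem_htCode e).1 h2
          rw [pair_mem_htCode_iff, ← hxv] at h3
          rw [← hx, pair_mem_ltCode_iff] at h1
          exact ⟨x, hx, h1, Ordinal.toZFSet_injective h3⟩
        choose b hbb hab hby using hb''
        obtain ⟨q₀, hq₀, hq⟩ := hb b hab hby
        have hqH : HeredCardLT κ (Condition.codeEmb hT e S q₀) :=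
          hDN.1.mem (mem_setCode.2 ⟨q₀, hq₀, rfl⟩)
        exact ⟨H.mk _ hqH, (goodAt_iff hT e hby hlt hle hD' hp' hz' rfl (fun i => (hbb i).symm)
          heH _).2 ⟨q₀, hq₀, rfl, hq⟩⟩
    -- Level `β + 1`, since only `p.F.top ≤ β` is known and the formula asks for a point strictly
    -- above `a i0`.
    obtain ⟨y, hay, hyt⟩ := hT.exists_ge_ht_eq hn (a i0) (succ_lt_omega1 hβ)
      (by rw [hat]; exact hpβ.trans (Order.le_succ _))
    have hay' : a i0 < y := lt_of_le_of_ne hay fun he => by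
      rw [← he, hat] at hyt
      exact (hyt ▸ hpβ).not_gt (Order.lt_succ _)
    obtain ⟨y', hy'N, hy'⟩ := N.exists_mem hR par hpar ⟨H.mk (e y) (heH y), (hRiff y).2 ⟨hay',
      fun b hab hby => by
      obtain ⟨q, hq, hqp, hzq, hqβ, hqb⟩ := hβq (fun i => res β (b i)) (fun i =>
        hT.le_res (hab i).le (by rw [hat]; exact hpβ) (by rw [hby, hyt]; exact Order.le_succ _))
        (fun i => ht_res (by rw [hby, hyt]; exact Order.le_succ _))
      refine ⟨q, hq, hqp, hzq, hqβ.trans (by rw [hyt]; exact Order.lt_succ _), fun i => ?_⟩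
      have := hqb i
      rwa [hT.res_res hqβ.le (by rw [hby, hyt]; exact Order.le_succ _)] at this⟩⟩
    have hlty := hy'.1
    change ZFSet.pair (a' i0).set y'.set ∈ lt.set at hlty
    rw [hlt] at hlty
    -- Being related to `a i0` ensures that the witness is a tree point.
    obtain ⟨-, y₁, -, hy₁, -⟩ := (pair_mem_ltCode e).1 hlty
    obtain rfl : H.mk (e y₁) (heH y₁) = y' := H.set_inj.1 hy₁
    exact ⟨y₁, (hNe y₁).1 (N.has_set hy'N), (hRiff y₁).1 hy'⟩
  obtain ⟨y, hyδ, hay, hy⟩ := hlevel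
  have hpy : p.F.top < ht y := (hat i0) ▸ ht_lt_ht hay
  have hyx : ∀ i, ht y ≤ ht (x i) := fun i => by rw [hx]; exact hyδ.le
  let b : Fin m → T := fun i => res (ht y) (x i)
  have hby : ∀ i, ht (b i) = ht y := fun i => ht_res (hyx i)
  obtain ⟨q, hq, hqp, hzq, hqy, hqb⟩ := hy b (fun i => by
    refine lt_of_le_of_ne (hT.le_res (res_le _ _) (by rw [hat]; exact hpy.le) (hyx i)) fun he => ?_
    have := hby i
    rw [← show a i = b i from he, hat] at this
    exact hpy.ne this) hby
  choose b' hb'N hb' using fun i => N.has_iff.1 ((hNe (b i)).2 (by rw [hby]; exact hyδ))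
  obtain ⟨y', hy'N, hy'⟩ := N.has_iff.1 ((hNe y).2 hyδ)
  have hgood := goodAt_iff hT e hby hlt hle hD' hp' hz' hy' hb' heH
  have hqH : HeredCardLT κ (Condition.codeEmb hT e S q) :=
    hDN.1.mem (mem_setCode.2 ⟨q, hq, rfl⟩)
  obtain ⟨r, hrN, hr⟩ := N.exists_mem (α := Fin m ⊕ Fin 6)
    (R := fun w q => GoodAt (w (Sum.inr 0)) (w (Sum.inr 1)) (w (Sum.inr 2)) (w (Sum.inr 3))
      (w (Sum.inr 4)) (w (Sum.inr 5)) (fun i => w (Sum.inl i)) q)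
    (.goodAt (.intro _) (.intro _) (.intro _) (.intro _) (.intro _) (.intro _)
      (fun i => .intro _) (.intro _))
    (Sum.elim b' ![lt, le, D', p', z', y']) (by
      rintro (i | i)
      · exact hb'N i
      · fin_cases i
        exacts [hltN, hleN, hD'N, hp'N, hz'N, hy'N])
    ⟨H.mk _ hqH, (hgood _).2 ⟨q, hq, rfl, hqp, hzq, hqy, hqb⟩⟩
  obtain ⟨q', hq', hcode, hqp', hzq', hqy', hqb'⟩ := (hgood r).1 hr
  refine ⟨q', hq', hcode ▸ N.has_set hrN, hqp', hzq', fun i => ?_⟩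
  have := hqb' i
  rwa [hT.res_res hqy'.le (hyx i)] at this

end MasterConditions

/-! ### Construction of total master conditions. -/

section TotalMaster

variable {T : Type u} [PartialOrder T] [WellFoundedLT T]

/-- A lower bound of a descending sequence of conditions, from a set `C` of points of the limit level
that lie above all conditions of the sequence. -/
theorem Condition.exists_limit (hT : IsOmega1Tree T) {S : Set ℕ} {s : ℕ → Condition T S}
    (hs : Antitone s) {δ : Ordinal.{u}} (hδ : δ < ω₁) (hcof : ∀ α < δ, ∃ k, α < (s k).F.top)
    (hlt : ∀ k, (s k).F.top < δ) {C : Set T} (hC : ∀ c ∈ C, ht c = δ)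
    (hCs : ∀ c ∈ C, ∀ k, res (s k).F.top c ∈ (s k).F.one)
    (hcov : ∀ k, ∀ x ∈ (s k).F.one, ∃ c ∈ C, x ≤ c)
    (hful : ∀ k, ∀ U ∈ (s k).Γ, ∀ Y ∈ U.val δ, ∀ t : Set T, t.Finite → (∀ y ∈ t, ht y = δ) →
      ∃ b ∈ Y, ∀ i, b i ∈ C ∧ b i ∉ t) :
    ∃ q : Condition T S, q.F.top = δ ∧ ∀ k, q ≤ s k := by
  have hcompat : ∀ k l x, ht x ≤ (s k).F.top → ht x ≤ (s l).F.top →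
      (x ∈ (s k).F.one ↔ x ∈ (s l).F.one) := by
    intro k l x hk hl
    rcases le_total k l with h | h
    · exact (hs h).1.2 x hk
    · exact ((hs h).1.2 x hl).symm
  -- Level `δ` receives every point whose traces all have value 1. This includes `C`, which suffices
  -- for covering and fulfilment.
  let O : Set T := {x | ht x ≤ δ ∧ ∀ k, res (min (s k).F.top (ht x)) x ∈ (s k).F.one}
  have hO : ∀ k x, ht x ≤ (s k).F.top → (x ∈ (s k).F.one ↔ x ∈ O) := by
    intro k x hx
    constructor
    · refine fun h => ⟨hx.trans (hlt k).le, fun l => ?_⟩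
      have hle := res_le (min (s l).F.top (ht x)) x
      refine (hcompat k l _ ((ht_le_ht hle).trans hx) ?_).1 ((s k).F.down _ _ hle h)
      rw [ht_res (min_le_right _ _)]
      exact min_le_left _ _
    · intro h
      have := h.2 k
      rwa [min_eq_right hx, hT.res_eq le_rfl rfl] at this
  have hCO : C ⊆ O := fun c hc => ⟨(hC c hc).le, fun k => by
    rw [hC c hc, min_eq_left (hlt k).le]
    exact hCs c hc k⟩
  have hsucc : ∀ x : T, ht x < δ → ∃ k, Order.succ (ht x) ≤ (s k).F.top := fun x hx =>
    (hcof _ hx).imp fun k hk => Order.succ_le_of_lt hk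
  let F : SubtreeFun T := ⟨δ, hδ, O, fun x hx => hx.1, fun r hr => by
      have h := (s 0).F.root_mem r hr
      exact (hO 0 r ((s 0).F.ht_le r h)).1 h, fun x y hxy hy => by
      refine ⟨(ht_le_ht hxy).trans hy.1, fun k => (s k).F.down _ _ ?_ (hy.2 k)⟩
      refine hT.le_res ((res_le _ _).trans hxy) ?_ (min_le_right _ _)
      rw [ht_res (min_le_right _ _)]
      exact min_le_min le_rfl (ht_le_ht hxy), fun x hx hxδ => by
      obtain ⟨k, hk⟩ := hsucc x hxδ
      obtain ⟨c, hc, hxc⟩ := hcov k x ((hO k x ((Order.le_succ _).trans hk)).2 hx)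
      exact ⟨c, hCO hc, hxc, hC c hc⟩⟩
  have hsplit : F.IsSplitting S := by
    intro x hx hxδ
    obtain ⟨k, hk⟩ := hsucc x hxδ
    have hx' := (hO k x ((Order.le_succ _).trans hk)).2 hx
    obtain ⟨n, hn, he⟩ := (s k).splitting x hx' ((Order.lt_succ _).trans_le hk)
    refine ⟨n, hn, ?_⟩
    rw [← he]
    congr 1
    ext y
    refine and_congr_right fun hy => (hO k y ?_).symm
    rwa [hT.ht_covBy hy]
  refine ⟨⟨F, hsplit, ⋃ k, (s k).Γ, Set.countable_iUnion fun k => (s k).countable, ?_, ?_⟩, rfl,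
    fun k => ⟨⟨(hlt k).le, hO k⟩, Set.subset_iUnion (fun k => (s k).Γ) k⟩⟩
  · intro U hU
    obtain ⟨k, hk⟩ := Set.mem_iUnion.1 hU
    exact ((s k).base_le U hk).trans (hlt k).le
  · intro U hU t ht Y hY
    obtain ⟨k, hk⟩ := Set.mem_iUnion.1 hU
    obtain ⟨b, hb, h⟩ := hful k U hk Y hY t t.finite_toSet ht
    exact ⟨b, hb, fun i => ⟨(h i).2, hCO (h i).1⟩⟩

variable {κ : Cardinal.{u}} {N : Submodel κ} {e : T ↪ ZFSet.{u}}

theorem exists_le_mem_has_of_finite (hκ : κ.IsRegular) (hA : IsAronszajn T) (hn : IsNormal T)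
    {S : Set ℕ} {n : ℕ} (hnS : n ∈ S) (hn2 : 2 ≤ n) (hImm : ∀ x : T, (n : ℕ∞) ≤ (Imm x).encard)
    (hN : N.Has (treeCode e))
    (hP : N.Has (posetCode (Condition.codeEmb hA.toIsOmega1Tree e S)))
    {D : Set (Condition T S)} (hD : IsDense D)
    (hDN : N.Has (setCode (Condition.codeEmb hA.toIsOmega1Tree e S) D))
    {p : Condition T S} (hp : N.Has (Condition.codeEmb hA.toIsOmega1Tree e S p))
    {z : T} (hz : N.Has (e z)) {δ : Ordinal.{u}} (hδ : N.omega1 = Set.Iio δ)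
    {X : Set T} (hX : X.Finite) (hXne : X.Nonempty)
    (hXp : ∀ x ∈ X, ht x = δ ∧ res p.F.top x ∈ p.F.one) (hXi : Set.InjOn (res p.F.top) X) :
    ∃ q ∈ D, N.Has (Condition.codeEmb hA.toIsOmega1Tree e S q) ∧ q ≤ p ∧ ht z ≤ q.F.top ∧
      ∀ x ∈ X, res q.F.top x ∈ q.F.one := by
  have := hX.to_subtype
  have := hXne.to_subtype
  obtain ⟨m, ⟨f⟩⟩ := Finite.exists_equiv_fin X
  have hm : 0 < m := (f (Classical.arbitrary X)).pos
  obtain ⟨q, hqD, hqN, hqp, hzq, hq⟩ := exists_le_mem_has hκ hA hn hnS hn2 hImm hN hP hD hDN hp hz hδ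
    hm (x := fun i => (f.symm i).1) (fun i => (hXp _ (f.symm i).2).1)
    (fun i j h => f.symm.injective (Subtype.ext (hXi (f.symm i).2 (f.symm j).2 h)))
    (fun i => (hXp _ (f.symm i).2).2)
  refine ⟨q, hqD, hqN, hqp, hzq, fun x hx => ?_⟩
  have := hq (f ⟨x, hx⟩)
  rwa [Equiv.symm_apply_apply] at this

/-- A generic sequence is built from pairs of a condition in `N` and a finite set of reserved points
of level `δ`, with distinct traces of value 1. The tasks are countable in number: enter the dense
sets of `N` with top levels cofinal in `δ`, cover each node of value 1 by a reserved point, and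
reserve tuples for each promise. The limit may lie outside `N`. -/
theorem exists_totalMaster (hκ : κ.IsRegular) (hA : IsAronszajn T) (hn : IsNormal T)
    {S : Set ℕ} {n : ℕ} (hnS : n ∈ S) (hn2 : 2 ≤ n) (hImm : ∀ x : T, (n : ℕ∞) ≤ (Imm x).encard)
    (hNc : (N : Set (H κ)).Countable) (hN : N.Has (treeCode e))
    (hP : N.Has (posetCode (Condition.codeEmb hA.toIsOmega1Tree e S)))
    {p : Condition T S} (hp : N.Has (Condition.codeEmb hA.toIsOmega1Tree e S p)) :
    ∃ q ≤ p, Set.Iio q.F.top = N.omega1 ∧ ∀ D : Set (Condition T S), IsDense D →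
      N.Has (setCode (Condition.codeEmb hA.toIsOmega1Tree e S) D) →
      ∃ w ∈ D, N.Has (Condition.codeEmb hA.toIsOmega1Tree e S w) ∧ q ≤ w := by
  have hT := hA.toIsOmega1Tree
  have hκ' := hT.aleph0_lt_card.trans (card_lt_of_has hN)
  obtain ⟨δ, hδ, hNδ⟩ := N.exists_omega1_eq hκ hκ' hNc
  let P := Condition.codeEmb hT e S
  have hNe : ∀ x : T, N.Has (e x) ↔ ht x < δ := fun x => by
    rw [has_iff_ht_mem hκ hT hN, hNδ]; rfl
  have htop : ∀ {q : Condition T S}, N.Has (P q) → q.F.top < δ := fun {q} hq => by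
    have := top_mem_omega1 hκ hT hn hN hq
    rwa [hNδ] at this
  have huniv : N.Has (setCode P Set.univ) := by
    have : setCode P Set.univ = ZFSet.range P := by
      ext x
      rw [mem_setCode, ZFSet.mem_range]
      simp
    rw [this]
    exact (N.has_of_pair hP).1
  have hudense : IsDense (Set.univ : Set (Condition T S)) := fun q => ⟨q, trivial, le_rfl⟩
  let G : Condition T S × (Set T)ᵒᵈ → Prop := fun r => N.Has (P r.1) ∧
    (OrderDual.ofDual r.2).Finite ∧ (OrderDual.ofDual r.2).Nonempty ∧
    (∀ x ∈ OrderDual.ofDual r.2, ht x = δ ∧ res r.1.F.top x ∈ r.1.F.one) ∧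
    Set.InjOn (res r.1.F.top) (OrderDual.ofDual r.2)
  let cond : Subtype G → Condition T S := fun r => r.1.1
  let pts : Subtype G → Set T := fun r => OrderDual.ofDual r.1.2
  have hle : ∀ {r r' : Subtype G}, r ≤ r' → cond r ≤ cond r' ∧ pts r' ⊆ pts r := fun h => h
  -- strengthening the condition
  have hstep : ∀ (r : Subtype G) (D : Set (Condition T S)), IsDense D → N.Has (setCode P D) →
      ∀ z : T, N.Has (e z) → ∃ r' ≤ r, cond r' ∈ D ∧ ht z ≤ (cond r').F.top := by
    rintro ⟨⟨q, X⟩, hqN, hXf, hXne, hX, hXi⟩ D hD hDN z hz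
    obtain ⟨q', hq'D, hq'N, hq'q, hzq', hq'X⟩ := exists_le_mem_has_of_finite hκ hA hn hnS hn2 hImm hN
      hP hD hDN hqN hz hNδ hXf hXne hX hXi
    refine ⟨⟨⟨q', X⟩, hq'N, hXf, hXne, fun x hx => ⟨(hX x hx).1, hq'X x hx⟩, ?_⟩, ⟨hq'q, le_rfl⟩,
      hq'D, hzq'⟩
    -- Distinct traces stay distinct on the higher top level.
    intro x hx y hy hxy
    refine hXi hx hy ?_
    have hres : ∀ x ∈ OrderDual.ofDual X, res q.F.top (res q'.F.top x) = res q.F.top x :=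
      fun x hx => hT.res_res hq'q.1.1 (by rw [(hX x hx).1]; exact (htop hq'N).le)
    change res q.F.top x = res q.F.top y
    rw [← hres x hx, ← hres y hy]
    exact congrArg _ hxy
  -- adding points of level `δ`
  have hadd : ∀ (r : Subtype G) (Z : Set T), Z.Finite →
      (∀ x ∈ Z, ht x = δ ∧ res (cond r).F.top x ∈ (cond r).F.one ∧
        res (cond r).F.top x ∉ res (cond r).F.top '' pts r) →
      Set.InjOn (res (cond r).F.top) Z → ∃ r' ≤ r, Z ⊆ pts r' := by
    rintro ⟨⟨q, X⟩, hqN, hXf, hXne, hX, hXi⟩ Z hZf hZ hZi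
    refine ⟨⟨⟨q, OrderDual.toDual (OrderDual.ofDual X ∪ Z)⟩, hqN, hXf.union hZf, hXne.inl, ?_, ?_⟩,
      ⟨le_rfl, Set.subset_union_left (s := OrderDual.ofDual X)⟩, Set.subset_union_right⟩
    · rintro x (hx | hx)
      · exact hX x hx
      · exact ⟨(hZ x hx).1, (hZ x hx).2.1⟩
    · rintro x (hx | hx) y (hy | hy) hxy
      · exact hXi hx hy hxy
      · exact absurd ⟨x, hx, hxy⟩ (hZ y hy).2.2
      · exact absurd ⟨y, hy, hxy.symm⟩ (hZ x hx).2.2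
      · exact hZi hx hy hxy
  -- The reserved set starts non-empty because the density argument needs tuples of positive length.
  obtain ⟨x₀, hx₀, hx₀p⟩ : ∃ x₀, ht x₀ = δ ∧ res p.F.top x₀ ∈ p.F.one := by
    obtain ⟨r, hr⟩ := hn.root
    have hrp := p.F.root_mem r hr
    obtain ⟨y, hy, hyt⟩ : ∃ y ∈ p.F.one, ht y = p.F.top := by
      rcases (p.F.ht_le r hrp).eq_or_lt with h | h
      · exact ⟨r, hrp, h⟩
      · obtain ⟨y, hy, -, hyt⟩ := p.F.exists_top r hrp h
        exact ⟨y, hy, hyt⟩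
    obtain ⟨x, hyx, hx⟩ := hT.exists_ge_ht_eq hn y hδ (hyt.trans_le (htop hp).le)
    exact ⟨x, hx, by rwa [hT.res_eq hyx hyt]⟩
  have hcP : {q | N.Has (P q)}.Countable := N.countable_setOf_has P P.injective hNc
  have hcT : {x | N.Has (e x)}.Countable := N.countable_setOf_has e e.injective hNc
  have hcD : {D | N.Has (setCode P D)}.Countable :=
    N.countable_setOf_has (setCode P) (fun D D' h => setCode_inj P.injective h) hNc
  let 𝒰 : Set (GenPromise T) := {U | ∃ q, N.Has (P q) ∧ U ∈ q.Γ}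
  have hc𝒰 : 𝒰.Countable := by
    refine (hcP.biUnion fun q _ => q.countable).mono ?_
    rintro U ⟨q, hq, hU⟩
    exact Set.mem_biUnion hq hU
  have hcval : ∀ U : 𝒰, Countable (U.1.val δ) := by
    rintro ⟨U, q, hq, hU⟩
    exact (U.countable δ ⟨(q.base_le U hU).trans (htop hq).le, hδ⟩).to_subtype
  have := hc𝒰.to_subtype
  have := hcT.to_subtype
  have : Countable {D : Set (Condition T S) // IsDense D ∧ N.Has (setCode P D)} :=
    (hcD.mono fun D (hD : IsDense D ∧ N.Has (setCode P D)) => hD.2).to_subtype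
  have := (Set.countable_ofPred_finite_subset (hT.countable_level δ)).to_subtype
  let E : ({D : Set (Condition T S) // IsDense D ∧ N.Has (setCode P D)} × {x | N.Has (e x)}) ⊕
      {x | N.Has (e x)} ⊕
      ((Σ U : 𝒰, U.1.val δ) × {t : Set T | t.Finite ∧ t ⊆ {y : T | ht y = δ}}) → Set (Subtype G)
    | .inl d => {r | cond r ∈ d.1.1 ∧ ht d.2.1 ≤ (cond r).F.top}
    | .inr (.inl x) => {r | ht x.1 ≤ (cond r).F.top ∧
        (x.1 ∈ (cond r).F.one → ∃ y ∈ pts r, x.1 ≤ y)}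
    -- A promise may enter the sequence late; the task counts as met also when no stronger pair ever
    -- contains that promise.
    | .inr (.inr d) => {r | (∃ b ∈ d.1.2.1, ∀ i, b i ∈ pts r ∧ b i ∉ d.2.1) ∨
        ∀ r' ≤ r, d.1.1.1 ∉ (cond r').Γ}
  have hE : ∀ i, IsDense (E i) := by
    rintro (⟨⟨D, hD, hDN⟩, ⟨z, hz⟩⟩ | ⟨x, hx⟩ | ⟨⟨⟨U, hU⟩, ⟨Y, hY⟩⟩, ⟨t, htf, htδ⟩⟩) r
    · obtain ⟨r', hr', h⟩ := hstep r D hD hDN z hz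
      exact ⟨r', h, hr'⟩
    · obtain ⟨r', hr', -, hxr'⟩ := hstep r Set.univ hudense huniv x hx
      by_cases hxF : x ∈ (cond r').F.one
      swap
      · exact ⟨r', ⟨hxr', fun h => absurd h hxF⟩, hr'⟩
      obtain ⟨y, hy, hxy, hyt⟩ : ∃ y ∈ (cond r').F.one, x ≤ y ∧ ht y = (cond r').F.top := by
        rcases hxr'.eq_or_lt with h | h
        · exact ⟨x, hxF, le_rfl, h⟩
        · exact (cond r').F.exists_top x hxF h
      have hyδ : ht y < δ := hyt ▸ htop r'.2.1
      by_cases hyX : y ∈ res (cond r').F.top '' pts r'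
      · obtain ⟨w, hw, rfl⟩ := hyX
        exact ⟨r', ⟨hxr', fun _ => ⟨w, hw, hxy.trans (res_le _ _)⟩⟩, hr'⟩
      · obtain ⟨w, hyw, hw⟩ := hT.exists_ge_ht_eq hn y hδ hyδ.le
        have hwy : res (cond r').F.top w = y := hT.res_eq hyw hyt
        obtain ⟨r'', hr'', h⟩ := hadd r' {w} (Set.finite_singleton w) (by
          rintro _ rfl
          rw [hwy]
          exact ⟨hw, hy, hyX⟩) (Set.injOn_singleton _ _)
        exact ⟨r'', ⟨hxr'.trans (hle hr'').1.1.1, fun _ => ⟨w, h rfl, hxy.trans hyw⟩⟩,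
          hr''.trans hr'⟩
    · by_cases hex : ∃ r' ≤ r, U ∈ (cond r').Γ
      · obtain ⟨r', hr', hUr'⟩ := hex
        obtain ⟨b, hb, hb1, hb2⟩ := (cond r').exists_tuple hT hUr' (htop r'.2.1) hδ hY
          ((r'.2.2.1.image (res (cond r').F.top)).union (htf.image (res (cond r').F.top)))
        obtain ⟨r'', hr'', h⟩ := hadd r' (Set.range b) (Set.finite_range b) (by
          rintro _ ⟨i, rfl⟩
          exact ⟨(hb1 i).1, (hb1 i).2.1, fun h => (hb1 i).2.2 (Or.inl h)⟩) (by
          rintro _ ⟨i, rfl⟩ _ ⟨j, rfl⟩ hij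
          rw [hb2 hij])
        exact ⟨r'', Or.inl ⟨b, hb, fun i => ⟨h ⟨i, rfl⟩, fun hi => (hb1 i).2.2 (Or.inr ⟨_, hi, rfl⟩)⟩⟩,
          hr''.trans hr'⟩
      · push Not at hex
        exact ⟨r, Or.inr hex, le_rfl⟩
  obtain ⟨s, hs, hs0, hsE⟩ := exists_generic_seq E hE ⟨⟨p, OrderDual.toDual {x₀}⟩, hp,
    Set.finite_singleton x₀, Set.singleton_nonempty x₀, by
      rintro _ rfl
      exact ⟨hx₀, hx₀p⟩, Set.injOn_singleton _ _⟩
  have hsc : Antitone fun k => cond (s k) := fun k l h => (hle (hs h)).1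
  have hsp : ∀ {k l}, k ≤ l → pts (s k) ⊆ pts (s l) := fun h => (hle (hs h)).2
  have hptsδ : ∀ k, ∀ c ∈ pts (s k), ht c = δ := fun k c hc => ((s k).2.2.2.2.1 c hc).1
  obtain ⟨q, hqδ, hq⟩ := Condition.exists_limit hT hsc hδ (C := ⋃ k, pts (s k)) (by
      intro α hα
      obtain ⟨x, hx⟩ := hT.level_nonempty α (hα.trans hδ)
      obtain ⟨y, hxy, hy⟩ := exists_gt_has hn hN ((hNe x).2 (hx ▸ hα))
      obtain ⟨k, hk⟩ := hsE (.inl (⟨Set.univ, hudense, huniv⟩, ⟨y, hy⟩))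
      exact ⟨k, hx ▸ (ht_lt_ht hxy).trans_le hk.2⟩)
    (fun k => htop (s k).2.1) (by
      intro c hc
      obtain ⟨k, hk⟩ := Set.mem_iUnion.1 hc
      exact hptsδ k c hk) (by
      intro c hc k
      obtain ⟨l, hl⟩ := Set.mem_iUnion.1 hc
      have h1 := ((s (max k l)).2.2.2.2.1 c (hsp (le_max_right k l) hl)).2
      have h2 := hsc (le_max_left k l)
      have hcδ := hptsδ l c hl
      have hkc : (cond (s k)).F.top ≤ ht c := hcδ ▸ (htop (s k).2.1).le
      refine (h2.1.2 _ (ht_res hkc).le).2 ((cond (s (max k l))).F.down _ _ ?_ h1)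
      refine hT.le_res (res_le _ _) ?_ (hcδ ▸ (htop (s (max k l)).2.1).le)
      rw [ht_res hkc]
      exact h2.1.1) (by
      intro k x hx
      have hxδ : ht x < δ := ((cond (s k)).F.ht_le x hx).trans_lt (htop (s k).2.1)
      obtain ⟨l, hxl, hl⟩ := hsE (.inr (.inl ⟨x, (hNe x).2 hxδ⟩))
      have hxF : x ∈ (cond (s l)).F.one := by
        rcases le_total k l with h | h
        · exact ((hsc h).1.2 x ((cond (s k)).F.ht_le x hx)).1 hx
        · exact ((hsc h).1.2 x hxl).2 hx
      obtain ⟨y, hy, hxy⟩ := hl hxF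
      exact ⟨y, Set.mem_iUnion.2 ⟨l, hy⟩, hxy⟩) (by
      intro k U hU Y hY t htf htδ
      obtain ⟨l, hl⟩ := hsE (.inr (.inr (⟨⟨U, ⟨_, (s k).2.1, hU⟩⟩, ⟨Y, hY⟩⟩, ⟨t, htf, htδ⟩)))
      rcases hl with ⟨b, hb, h⟩ | h
      · exact ⟨b, hb, fun i => ⟨Set.mem_iUnion.2 ⟨l, (h i).1⟩, (h i).2⟩⟩
      · exact absurd ((hsc (le_max_left k l)).2 hU) (h _ (hs (le_max_right k l))))
  refine ⟨q, ?_, by rw [hqδ, hNδ], fun D hD hDN => ?_⟩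
  · have := hq 0
    rw [hs0] at this
    exact this
  -- The task for `D` also asks for a point whose height is to be reached; the root is a harmless
  -- choice.
  · obtain ⟨r, hr⟩ := hn.root
    have hrp := p.F.root_mem r hr
    obtain ⟨k, hk, -⟩ := hsE (.inl (⟨D, hD, hDN⟩, ⟨r, (hNe r).2
      ((p.F.ht_le r hrp).trans_lt (htop hp))⟩))
    exact ⟨_, hk, (s k).2.1, hq k⟩

end TotalMaster

/-! ### Countable distributivity and reals. -/

section NoReals

variable {Q : Type v} [Preorder Q]

theorem ForcesEq.mono {x y : PName Q} {p q : Q} (h : ForcesEq x y p) (hqp : q ≤ p) :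
    ForcesEq x y q := by
  cases x
  cases y
  rw [ForcesEq] at h ⊢
  exact ⟨fun i r hr => h.1 i r (hr.trans hqp), fun j r hr => h.2 j r (hr.trans hqp)⟩

theorem ForcesEq.symm {x y : PName Q} {p : Q} (h : ForcesEq x y p) : ForcesEq y x p := by
  induction x generalizing y p with
  | mk ι x c ih =>
    cases y
    rw [ForcesEq] at h ⊢
    refine ⟨fun j q hq hj => ?_, fun i q hq hi => ?_⟩
    · obtain ⟨r, hr, i, hi, he⟩ := h.2 j q hq hj
      exact ⟨r, hr, i, hi, ih i he⟩
    · obtain ⟨r, hr, j, hj, he⟩ := h.1 i q hq hi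
      exact ⟨r, hr, j, hj, ih i he⟩

theorem ForcesMem.mono {x y : PName Q} {p q : Q} (h : ForcesMem x y p) (hqp : q ≤ p) :
    ForcesMem x y q := by
  cases y
  exact fun r hr => h r (hr.trans hqp)

/-- A countably distributive forcing poset adds no reals. -/
theorem addsNoReals_of_distributive
    (h : ∀ D : ℕ → Set Q, (∀ n, IsDense (D n)) → ∀ p, ∃ q ≤ p, ∀ n, ∃ w ∈ D n, q ≤ w) :
    AddsNoReals Q := by
  intro x p hx
  let nm : ℕ → PName Q := fun n => PName.check (PSet.ofNat.{v} n)
  -- The conditions deciding whether `n` belongs to `x`.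
  let D : ℕ → Set Q := fun n =>
    {q | ForcesMem (nm n) x q ∨ ∀ r ≤ q, ¬ ForcesMem (nm n) x r}
  obtain ⟨q, hqp, hq⟩ := h D (fun n p => by
    by_cases hex : ∃ q ≤ p, ForcesMem (nm n) x q
    · obtain ⟨q, hqp, hq⟩ := hex
      exact ⟨q, Or.inl hq, hqp⟩
    · push Not at hex
      exact ⟨p, Or.inr hex, le_rfl⟩) p
  have hqD : ∀ n, ∀ r ≤ q, ForcesMem (nm n) x r → ForcesMem (nm n) x q := by
    intro n r hr hrx
    obtain ⟨w, hw | hw, hqw⟩ := hq n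
    · exact ForcesMem.mono hw hqw
    · exact absurd hrx (hw r (hr.trans hqw))
  refine ⟨q, hqp, PSet.mk (ULift.{v} {n : ℕ // ForcesMem (nm n) x q})
    (fun n => PSet.ofNat n.down.1), ?_⟩
  cases x with
  | mk ι y c =>
    rw [PName.check, ForcesEq]
    refine ⟨fun i r hr hri => ?_, fun j r hr _ => ?_⟩
    · obtain ⟨r', hr', j, -, hj⟩ := hx i r (hr.trans hqp) hri r le_rfl
      have hmem : ForcesMem (nm j.1.down) (PName.mk ι y c) r' := fun s hs =>
        ⟨s, le_rfl, i, hs.trans (hr'.trans hri), (ForcesEq.mono hj hs).symm⟩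
      exact ⟨r', hr', (⟨⟨j.1.down, hqD _ r' (hr'.trans hr) hmem⟩⟩, r'), le_rfl, hj⟩
    · obtain ⟨t, hts, i, hi, he⟩ := j.1.down.2 r hr
      exact ⟨t, hts, i, hi, he.symm⟩

end NoReals

/-! ### Countable elementary submodels, by Löwenheim–Skolem. -/

section Models

open FirstOrder

theorem exists_submodel {κ : Cardinal.{u}} (hH : ℵ₀ ≤ #(H κ)) {s : Set (H κ)} (hs : s.Countable) :
    ∃ N : Submodel κ, s ⊆ N ∧ (N : Set (H κ)).Countable := by
  have hcard : setLanguage.card ≤ ℵ₀ := by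
    have h1 : ∀ l, Countable (setLanguage.Functions l) := fun l =>
      inferInstanceAs (Countable Empty)
    have h2 : ∀ l, Countable (setLanguage.Relations l) := fun l => by
      have : Subsingleton (MemRel l) := ⟨fun a b => by cases a; cases b; rfl⟩
      exact inferInstanceAs (Countable (MemRel l))
    have : Countable setLanguage.Symbols :=
      inferInstanceAs (Countable ((Σ l, setLanguage.Functions l) ⊕ Σ l, setLanguage.Relations l))
    exact Cardinal.mk_le_aleph0
  obtain ⟨N, hsN, hN⟩ := Language.exists_elementarySubstructure_card_eq setLanguage s
    (ℵ₀ : Cardinal.{0}) le_rfl (by simpa using hs.le_aleph0) (by simpa using hcard)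
    (by simpa using hH)
  refine ⟨N, hsN, ?_⟩
  rw [← Cardinal.le_aleph0_iff_set_countable]
  have h : #N = ℵ₀ := by simpa using hN
  exact h.le

end Models

/-! ### Properness, distributivity and the chain condition. -/

section Main

variable {T : Type u} [PartialOrder T] [WellFoundedLT T]

theorem isProper_condition (hA : IsAronszajn T) (hn : IsNormal T) {S : Set ℕ} {n : ℕ} (hnS : n ∈ S)
    (hn2 : 2 ≤ n) (hImm : ∀ x : T, (n : ℕ∞) ≤ (Imm x).encard) (e : T ↪ ZFSet.{u}) :
    IsProper (Condition.codeEmb hA.toIsOmega1Tree e S) := by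
  obtain ⟨μ, hμ⟩ := exists_heredCardLT (treeCode e)
  refine ⟨μ, fun κ hκμ hκ => ⟨treeCode e, hμ.mono hκμ, fun N hNc hN hP p hp => ?_⟩⟩
  obtain ⟨q, hqp, -, hq⟩ := exists_totalMaster hκ hA hn hnS hn2 hImm hNc hN hP hp
  refine ⟨q, hqp, fun D hD hDN r hr => ?_⟩
  obtain ⟨w, hwD, hwN, hqw⟩ := hq D hD hDN
  exact ⟨w, hwD, hwN, r, le_rfl, hr.trans hqw⟩

/-- Put the dense sets `D k` into one countable elementary submodel; a total master condition for it
lies below a member of each. -/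
theorem distributive_condition (hA : IsAronszajn T) (hn : IsNormal T) {S : Set ℕ} {n : ℕ}
    (hnS : n ∈ S) (hn2 : 2 ≤ n) (hImm : ∀ x : T, (n : ℕ∞) ≤ (Imm x).encard) (e : T ↪ ZFSet.{u})
    (D : ℕ → Set (Condition T S)) (hD : ∀ k, IsDense (D k)) (p : Condition T S) :
    ∃ q ≤ p, ∀ k, ∃ w ∈ D k, q ≤ w := by
  have hT := hA.toIsOmega1Tree
  let P := Condition.codeEmb hT e S
  obtain ⟨μ₁, hμ₁⟩ := exists_heredCardLT (treeCode e)
  obtain ⟨μ₂, hμ₂⟩ := exists_heredCardLT (posetCode P)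
  let κ : Cardinal.{u} := Order.succ (max ℵ₀ (max μ₁ μ₂))
  have hκ : κ.IsRegular := Cardinal.isRegular_succ (le_max_left _ _)
  have h1 : HeredCardLT κ (treeCode e) := hμ₁.mono
    (((le_max_left _ _).trans (le_max_right _ _)).trans (Order.le_succ _))
  have h2 : HeredCardLT κ (posetCode P) := hμ₂.mono
    (((le_max_right _ _).trans (le_max_right _ _)).trans (Order.le_succ _))
  have hPH : HeredCardLT κ (ZFSet.range P) := h2.of_pair.1
  have hpH : HeredCardLT κ (P p) := hPH.mem (ZFSet.mem_range_self p)
  have hDH : ∀ k, HeredCardLT κ (setCode P (D k)) := fun k => .of_subset hκ hPH fun z hz => by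
    obtain ⟨q, -, rfl⟩ := mem_setCode.1 hz
    exact ZFSet.mem_range_self q
  have hHinf : ℵ₀ ≤ #(H κ) := by
    have hinj : Function.Injective fun x : T =>
        H.mk (e x) (h1.of_pair.1.mem (ZFSet.mem_range_self x)) := fun x y hxy =>
      e.injective (H.set_inj.2 hxy)
    have := Cardinal.lift_mk_le_lift_mk_of_injective hinj
    rw [Cardinal.lift_id'.{u, u + 1}] at this
    refine le_trans ?_ this
    rw [Cardinal.aleph0_le_lift]
    exact hT.aleph0_lt_card.le
  obtain ⟨N, hsN, hNc⟩ := exists_submodel hHinf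
    (s := {H.mk _ h1, H.mk _ h2, H.mk _ hpH} ∪ Set.range fun k => H.mk _ (hDH k))
    ((Set.toFinite _).countable.union (Set.countable_range _))
  obtain ⟨q, hqp, -, hq⟩ := exists_totalMaster hκ hA hn hnS hn2 hImm hNc
    (e := e) ⟨h1, hsN (Or.inl (Or.inl rfl))⟩ ⟨h2, hsN (Or.inl (Or.inr (Or.inl rfl)))⟩
    (p := p) ⟨hpH, hsN (Or.inl (Or.inr (Or.inr rfl)))⟩
  refine ⟨q, hqp, fun k => ?_⟩
  obtain ⟨w, hw, -, hqw⟩ := hq (D k) (hD k) ⟨hDH k, hsN (Or.inr ⟨k, rfl⟩)⟩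
  exact ⟨w, hw, hqw⟩

/-- Fulfilment depends only on the subtree function, so the promises may be united. -/
theorem Condition.compatible_of_eq {S : Set ℕ} {p q : Condition T S} (h : p.F = q.F) :
    Compatible p q := by
  refine ⟨⟨p.F, p.splitting, p.Γ ∪ q.Γ, p.countable.union q.countable, ?_, ?_⟩,
    ⟨⟨le_rfl, fun _ _ => Iff.rfl⟩, Set.subset_union_left⟩,
    ⟨by rw [← h]; exact ⟨le_rfl, fun _ _ => Iff.rfl⟩, Set.subset_union_right⟩⟩
  · rintro U (hU | hU)
    · exact p.base_le U hU
    · rw [h]; exact q.base_le U hU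
  · rintro U (hU | hU)
    · exact p.fulfills U hU
    · rw [h]; exact q.fulfills U hU

theorem IsOmega1Tree.card_le (hT : IsOmega1Tree T) : #T ≤ ℵ₁ := by
  choose f hf using fun α => (Set.countable_iff_exists_injOn).1 (hT.countable_level α)
  have hinj : Function.Injective fun x : T => ((⟨ht x, hT.ht_lt x⟩, f (ht x) x) :
      Set.Iio (ω₁ : Ordinal.{u}) × ℕ) := by
    intro x y hxy
    obtain ⟨h1, h2⟩ := Prod.mk.inj hxy
    have h1 : ht x = ht y := congrArg Subtype.val h1
    simp only [h1] at h2
    exact hf (ht y) h1 rfl h2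
  have := Cardinal.lift_mk_le_lift_mk_of_injective hinj
  rw [Cardinal.lift_id'.{u, u + 1}, Cardinal.mk_prod, Cardinal.mk_Iio_ordinal] at this
  rw [← Cardinal.lift_le.{u + 1}]
  refine this.trans ?_
  simp

/-- An antichain injects into the subtree functions. Each of these is given by a countable ordinal
and a countable subset of `T`, so under CH there are at most `ℵ₁ · ℵ₁ ^ ℵ₀ = ℵ₁` of them. -/
theorem omega2CC_condition (hT : IsOmega1Tree T) (hCH : (𝔠 : Cardinal.{0}) = ℵ₁) (S : Set ℕ) :
    IsOmega2CC (Condition T S) := by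
  intro A hA
  have hCH' : (𝔠 : Cardinal.{u + 1}) = ℵ₁ := by
    have := congrArg Cardinal.lift.{u + 1, 0} hCH
    simpa using this
  have henum : ∀ F : SubtreeFun T, ∃ f : ℕ → Option T, ∀ x, x ∈ F.one ↔ ∃ k, f k = some x := by
    intro F
    have hc : F.one.Countable := (hT.countable_ht_lt (succ_lt_omega1 F.top_lt)).mono fun x hx =>
      Order.lt_succ_of_le (F.ht_le x hx)
    rcases F.one.eq_empty_or_nonempty with h | h
    · exact ⟨fun _ => none, fun x => by simp [h]⟩
    · obtain ⟨f, hf⟩ := hc.exists_eq_range h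
      exact ⟨fun k => some (f k), fun x => by simp [hf]⟩
  choose f hf using henum
  have hinj : Function.Injective fun p : A => ((⟨p.1.F.top, p.1.F.top_lt⟩, f p.1.F) :
      Set.Iio (ω₁ : Ordinal.{u}) × (ℕ → Option T)) := by
    rintro ⟨p, hp⟩ ⟨q, hq⟩ hpq
    obtain ⟨h1, h2⟩ := Prod.mk.inj hpq
    have h1 : p.F.top = q.F.top := congrArg Subtype.val h1
    have h3 : p.F.one = q.F.one := by
      ext x
      rw [hf, hf]
      exact h2 ▸ Iff.rfl
    have h4 : p.F = q.F := by
      generalize p.F = F at h1 h3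
      generalize q.F = G at h1 h3
      cases F
      cases G
      simp only at h1 h3
      subst h1 h3
      rfl
    by_contra hne
    exact hA p hp q hq (fun h => hne (Subtype.ext h)) (Condition.compatible_of_eq h4)
  have hO : Cardinal.lift.{u + 1} #(Option T) ≤ ℵ₁ := by
    rw [Cardinal.mk_option, Cardinal.lift_add]
    refine Cardinal.add_le_of_le (Cardinal.aleph0_le_aleph 1) ?_ ?_
    · simpa using hT.card_le
    · simpa using Cardinal.one_le_aleph0.trans (Cardinal.aleph0_le_aleph 1)
  have h1 := Cardinal.mk_le_of_injective hinj
  refine h1.trans_lt (lt_of_le_of_lt ?_ (Cardinal.aleph_lt_aleph.2 (one_lt_two : (1 : Ordinal) < 2)))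
  rw [Cardinal.mk_prod, Cardinal.mk_Iio_ordinal]
  have h2 : Cardinal.lift.{u + 1} #(ℕ → Option T) ≤ ℵ₁ := by
    have : #(ℕ → Option T) = #(Option T) ^ (ℵ₀ : Cardinal.{u}) := by simp
    rw [this, Cardinal.lift_power, Cardinal.lift_aleph0, ← hCH']
    refine (Cardinal.power_le_power_right (hO.trans hCH'.ge)).trans ?_
    simp
  refine (mul_le_mul' (b := ℵ₁) (d := ℵ₁) ?_ h2).trans ?_
  · simp
  · exact (Cardinal.mul_eq_self (Cardinal.aleph0_le_aleph 1)).le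

end Main

end SubtreeForcing

theorem corollary6p6 {T : Type u} [PartialOrder T] [WellFoundedLT T]
    (hT : IsAronszajn T) (hnormal : IsNormal T)
    (S : Set ℕ) (hS : S.Nonempty) (hS2 : ∀ n ∈ S, 2 ≤ n)
    (hImm : ∀ x : T, (⨆ n ∈ S, (n : ℕ∞)) ≤ (Imm x).encard)
    (e : T ↪ ZFSet.{u}) :
    (∀ κ : Cardinal.{u}, κ.IsRegular →
      ∀ N : Submodel κ, (N : Set (H κ)).Countable →
        N.Has (treeCode e) →
        N.Has (posetCode (Condition.codeEmb hT.toIsOmega1Tree e S)) →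
        ∀ p : Condition T S, N.Has (Condition.codeEmb hT.toIsOmega1Tree e S p) →
          ∃ q ≤ p, Set.Iio q.F.top = N.omega1 ∧
            IsTotalMaster (Condition.codeEmb hT.toIsOmega1Tree e S) N q) ∧
    IsTotallyProper (Condition.codeEmb hT.toIsOmega1Tree e S) ∧
    ((𝔠 : Cardinal.{0}) = ℵ₁ → IsOmega2CC (Condition T S)) := by
  obtain ⟨n, hn⟩ := hS
  -- One element `n` of `S` is enough: all newly added nodes below the top level get exactly `n`
  -- successors.
  have hImm' : ∀ x : T, (n : ℕ∞) ≤ (Imm x).encard := fun x =>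
    (le_iSup₂ (f := fun (m : ℕ) (_ : m ∈ S) => (m : ℕ∞)) n hn).trans (hImm x)
  refine ⟨fun κ hκ N hNc hN hP p hp => ?_,
    ⟨isProper_condition hT hnormal hn (hS2 n hn) hImm' e, addsNoReals_of_distributive
      (distributive_condition hT hnormal hn (hS2 n hn) hImm' e)⟩,
    fun hCH => omega2CC_condition hT.toIsOmega1Tree hCH S⟩
  obtain ⟨q, hqp, hqN, hq⟩ := exists_totalMaster hκ hT hnormal hn (hS2 n hn) hImm' hNc hN hP hp
  exact ⟨q, hqp, hqN, fun D hD _ hDN => hq D hD hDN⟩
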